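/- **Notation.** $\left[{n\atop m}\right]$ is the unsigned Stirling number of the first kind, $[P]\in\{0,1\}$ is Iverson's bracket, $H_n^{(r)}=\sum_{k=1}^n k^{-r}$, $p_n(\alpha,R)=\prod_{0\le j<n}(R+\alpha j)$, $(R)_n=p_n(1,R)$, $\binom{n}{k}=0$ for $k<0$. Let $\mathrm{FP}_0=0,\ \mathrm{FP}_1=1,\ \mathrm{FQ}_0=1,\ \mathrm{FQ}_1=1-Rz$, and let both $Y=\mathrm{FP}$ and $Y=\mathrm{FQ}$ satisfy $Y_h=(1-(R+2\alpha(h-1))z)Y_{h-1}-\alpha(R+\alpha(h-2))(h-1)z^2Y_{h-2}$ for $h\ge2$; put $\mathrm{Conv}_h(\alpha,R;z)=\mathrm{FP}_h(\alpha,R;z)/\mathrm{FQ}_h(\alpha,R;z)$, a power series in $z$ with coefficients in $\mathbb Z[\alpha,R]$. A congruence $x\equiv y \pmod p$ between numbers means that $x-y$ is an integer multiple of $p$. Congruences are for all $n\ge 0$ unless a range is given. Then the following hold. **1. Generation by convergents.** $\left[{n\atop m}\right]=[R^m](R)_n$ for all $n,m\ge0$. For every $h\ge2$: $\left[{n\atop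 m}\right]=[z^n][R^m]\mathrm{Conv}_h(1,R;z)$ for $1\le m\le n\le h$, and $[R^m]\,p_n(1,R)\equiv[z^n][R^m]\mathrm{Conv}_h(1,R;z)\pmod h$ for all $n,m\ge0$. For an integer $\alpha\ge1$ let $T_\alpha(0,0)=1$, $T_\alpha(n,0)=T_\alpha(0,n)=0$ for $n\geq 1$, and $T_\alpha(n,k)=(\alpha n+1-2\alpha)T_\alpha(n-1,k)+T_\alpha(n-1,k-1)$ for $n,k\ge1$. Then for $n,m\ge1$ and $p\ge2$, $T_\alpha(n,m)=[s^{m-1}]p_{n-1}(\alpha,s+1)\equiv[z^{n-1}][R^{m-1}]\mathrm{Conv}_p(\alpha,R+1;z)\pmod p$. **2. Quasi-polynomial formulas.** Let $h\ge2$ and $W_h(w)=\sum_{i=0}^{h-1}\binom{h-1}{i}\frac{h!}{(i+1)!}(-w)^i$. For each $m\ge1$, $[R^m]\mathrm{Conv}_h(1,R;z)=N(z)/\big(z^{h-1}W_h(1/z)\big)^m$ for some $N\in\mathbb Z[z]$. The polynomial $W_h$ has exactly $h-1$ distinct complex roots $\omega_{h,1},\dots,\omega_{h,h-1}$, and for each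 $m\ge1$ there are polynomials $p^{[m]}_{h,i}\in\mathbb C[n]$ of degree exactly $m-1$ $(1\le i\le h-1)$ such that $[z^n][R^m]\mathrm{Conv}_h(1,R;z)=\sum_i p^{[m]}_{h,i}(n)\,\omega_{h,i}^n$ for all $n>m$, and $$\left[{n\atop m}\right]=\Big(\sum_{i=1}^{h-1}p^{[m]}_{h,i}(n)\,\omega_{h,i}^n\Big)[n>m]+[n=m]\quad(m\le n\le h),$$ $$\left[{n\atop m}\right]\equiv\Big(\sum_{i=1}^{h-1}p^{[m]}_{h,i}(n)\,\omega_{h,i}^n\Big)[n>m]+[n=m]\pmod h\quad(n\ge m).$$ For $h=2$ the root set is $\{2\}$, for $h=3$ it is $\{3-\sqrt3,3+\sqrt3\}$. **3. Modulo 2.** For $n\ge1$, $n!\equiv\sum_{m=1}^n\binom{\lfloor n/2\rfloor}{m-\lceil n/2\rceil}(-1)^{n-m}n^m+[n=0]\pmod 2$. For $n\ge m\ge1$, $\left[{n\atop m}\right]\equiv\binom{\lfloor n/2\rfloor}{m-\lceil n/2\rceil}=[x^m]\,x^{\lceil n/2\rceil}(x+1)^{\lfloor n/2\rfloor}\pmod2$.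 Moreover $\left[{n\atop m}\right]\equiv f_m(n)[n>m]+[n=m]\pmod2$ for $1\le m\le6$, with $f_1=\frac{2^n}{4}$, $f_2=\frac{3\cdot2^n}{16}(n-1)$, $f_3=2^{n-7}(9n-20)(n-1)$, $f_4=2^{n-9}(3n-10)(3n-7)(n-1)$, $f_5=2^{n-13}(27n^3-279n^2+934n-1008)(n-1)$, $f_6=\frac{2^{n-15}}5(9n^2-71n+120)(3n-14)(3n-11)(n-1)$. **4. Modulo 3.** For $n\ge m\ge1$, $$\left[{n\atop m}\right]\equiv[x^m]\,x^{\lceil n/3\rceil}(x+1)^{\lceil(n-1)/3\rceil}(x+2)^{\lfloor n/3\rfloor}\pmod3,$$ $$\left[{n\atop m}\right]\equiv\sum_{k=0}^m\binom{\lceil(n-1)/3\rceil}{k}\binom{\lfloor n/3\rfloor}{m-k-\lceil n/3\rceil}2^{\lceil n/3\rceil+\lfloor n/3\rfloor-(m-k)}\pmod3.$$ Moreover $\left[{n\atop m}\right]\equiv\Big(\sum_{j=\pm1}g_{m,j}(n)(3+j\sqrt3)^n\Big)[n>m]+[n=m]\pmod3$ for $1\le m\le4$, with $g_{1,j}=\frac1{36}(9-5j\sqrt3)$,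 $g_{2,j}=\frac1{216}\big((44n-41)-(25n-24)j\sqrt3\big)$, $g_{3,j}=\frac1{15552}\big((1299n^2-3837n+2412)-(745n^2-2217n+1418)j\sqrt3\big)$, $g_{4,j}=\frac1{279936}\big((6409n^3-38778n^2+70901n-37092)-(3690n^3-22374n^2+41088n-21708)j\sqrt3\big)$. **5. First-order harmonic numbers.** $n!\,H_n^{(1)}=\left[{n+1\atop2}\right]$. With $D_4=24z^3-36z^2+12z-1$, $D_5=120z^4-240z^3+120z^2-20z+1$, $D_6=720z^5-1800z^4+1200z^3-300z^2+30z-1$: $$n!H_n^{(1)}\equiv[z^{n+1}]\Big(\tfrac{36z^2-48z+325}{576}+\tfrac{17040z^2+1782z+6467}{576D_4}+\tfrac{78828z^2-33987z+3071}{288D_4^2}\Big)\pmod4,$$ $$n!H_n^{(1)}\equiv[z^{n}]\Big(\tfrac{3z-4}{48}+\tfrac{1300z^2+890z+947}{96D_4}+\tfrac{24568z^2-10576z+955}{96D_4^2}\Big)\pmod4,$$ $$n!H_n^{(1)}\equiv[z^{n-1}]\Big(\tfrac1{16}+\tfrac{-96z^2+794z+397}{48D_4}+\tfrac{5730z^2-2453z+221}{24D_4^2}\Big)\pmod4\quad(n\ge1),$$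 $$n!H_n^{(1)}\equiv[z^n]\Big(\tfrac{12z-29}{300}+\tfrac{80130z^3+54450z^2+79113z+108164}{900D_5}+\tfrac{17470170z^3-11428050z^2+2081551z-108077}{900D_5^2}\Big)\pmod5,$$ $$n!H_n^{(1)}\equiv[z^n]\Big(\tfrac{10z-37}{360}+\tfrac{1419408z^4+903312z^3+1797924z^2+2950002z+4780681}{2160D_6}+\tfrac{5581246248z^4-4906594848z^3+1347715644z^2-140481648z+4780903}{2160D_6^2}\Big)\pmod6.$$ For $h\ge1$, with $C_{h,n}(1,R)=[z^n]\mathrm{FP}_h(1,R;z)$: $$(n-1)!\,H_{n-1}^{(1)}=[R^2]\Big(-\sum_{k=0}^{n-1}\binom h{n-k}(1-h-R)_{n-k}(R)_k+C_{h,n}(1,R)\Big)\quad(1\le n\le h),$$ $$(n-1)!\,H_{n-1}^{(1)}\equiv[R^2]\Big(-\sum_{k=0}^{n-1}\binom h{n-k}(1-h-R)_{n-k}(R)_k\Big)\pmod h\quad(n\ge h).$$ **6. Second- and third-order harmonic numbers.** For all $n\ge 0$, $$(n!)^2H_n^{(2)}=\left[{n+1\atop2}\right]^2-2\left[{n+1\atop1}\right]\left[{n+1\atop3}\right],$$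 $$(n!)^3H_n^{(3)}=\left[{n+1\atop2}\right]^3-3\left[{n+1\atop1}\right]\left[{n+1\atop2}\right]\left[{n+1\atop3}\right]+3\left[{n+1\atop1}\right]^2\left[{n+1\atop4}\right],$$ and for every $p\ge2$ these numbers are congruent modulo $p$ to $h^{(2)}_p(n)$ and $h^{(3)}_p(n)$, the right-hand sides with every $\left[{n+1\atop m}\right]$ replaced by $[z^{n+1}][R^m]\mathrm{Conv}_p(1,R;z)$. Moreover $$(n!)^2H_n^{(2)}\equiv[z^n]\tfrac{z(1-3z+9z^2-8z^3)}{(1-4z)^2}\pmod2,$$ $$\tfrac{z(1-3z+9z^2-8z^3)}{(1-4z)^2}=\tfrac{5z}{16}-\tfrac{z^2}2+\tfrac{11}{64(1-4z)^2}-\tfrac{11}{64(1-4z)}=z+5z^2+33z^3+176z^4+880z^5+4224z^6+\cdots;$$ $$(n!)^2H_n^{(2)}\equiv[z^n]\tfrac{z(1-61z+1339z^2-13106z^3+62284z^4-144264z^5+151776z^6-124416z^7+41472z^8)}{(1-6z)^3(1-24z+36z^2)^2}\pmod3,$$ where this rational function equals $$-\tfrac{13}{324}+\tfrac{14z}{81}-\tfrac{4z^2}{27}+\tfrac{25}{1944(-1+6z)^3}+\tfrac{115}{1944(-1+6z)^2}+\tfrac5{162(-1+6z)}+\tfrac{-787+17624z}{216(1-24z+36z^2)^2}+\tfrac{2377+3754z}{648(1-24z+36z^2)}$$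 $$=z+5z^2+49z^3+820z^4+18232z^5+437616z^6+\cdots;$$ $$(n!)^3H_n^{(3)}\equiv[z^n]\tfrac{z(1-7z+49z^2-144z^3+192z^4)}{(1-8z)^2}\pmod2,$$ $$\tfrac{z(1-7z+49z^2-144z^3+192z^4)}{(1-8z)^2}=\tfrac{11z}{32}-\tfrac{3z^2}2+3z^3+\tfrac{21}{256(1-8z)^2}-\tfrac{21}{256(1-8z)}=z+9z^2+129z^3+1344z^4+13440z^5+129024z^6+\cdots;$$ and, with $D=1-108z+216z^2$, $E=1-36z+216z^2$, $$(n!)^3H_n^{(3)}\equiv[z^n]\Big(-\tfrac{143}{5832}+\tfrac{625z}{2916}-\tfrac{4z^2}9+\tfrac{4z^3}3+\tfrac{115(-6719+711956z)}{93312D^2}+\tfrac{774079+1459082z}{93312D}-\tfrac{125(-11+312z)}{11664E^4}-\tfrac{10(1+306z)}{729E^3}+\tfrac{-20677+269268z}{93312E^2}+\tfrac{11851+89478z}{93312E}\Big)\pmod3,$$ where this series is $z+9z^2+251z^3+16280z^4+1586800z^5+171547200z^6+\cdots$. Finally, for $r\in\{2,3\}$ and $p\in\{4,5\}$, $\sum_{n\ge0}h^{(r)}_p(n)z^n$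 is a rational function $N(z)/\mathrm{Den}_{r,p}(z)$ with $N\in\mathbb Z[z]$, where $\mathrm{Den}_{2,4}=(-1+72z-720z^2+576z^3)^2(-1+36z-288z^2+576z^3)^3$; $\mathrm{Den}_{2,5}=(1-160z+5040z^2-28800z^3+14400z^4)^2(1-120z+4680z^2-76800z^3+561600z^4-1728000z^5+1728000z^6)^3$; $\mathrm{Den}_{3,4}=(1-24z)^4(-1+504z-17280z^2+13824z^3)^2(-1+144z-5184z^2+13824z^3)^4(-1+216z-3456z^2+13824z^3)^4$; $\mathrm{Den}_{3,5}=(1-1520z+273600z^2-4320000z^3+1728000z^4)^2(1-240z+14400z^2-288000z^3+1728000z^4)^4\,(1-1680z+1051200z^2-319776000z^3+51914304000z^4-4764026880000z^5+251795865600000z^6-7537618944000000z^7+121956544512000000z^8-998751928320000000z^9+4084826112000000000z^{10}-7739670528000000000z^{11}+5159780352000000000z^{12})^4$. -/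

import Mathlib

open scoped Polynomial PowerSeries

/-! ### Product sequences, J-fraction convergents, triangles -/

/-- The symbolic product `p_n(α, R) = R (R + α) ⋯ (R + (n - 1) α)`, with `p_0 = 1`. -/
def genProd {A : Type*} [CommRing A] (α R : A) (n : ℕ) : A :=
  ∏ j ∈ Finset.range n, (R + (j : A) * α)

/-- The numerator `FP_h(α, R; z)` of the `h`-th convergent, a polynomial in `z`. -/
noncomputable def convP {A : Type*} [CommRing A] (α R : A) : ℕ → A[X]
  | 0 => 0
  | 1 => 1
  | h + 2 =>
      (1 - Polynomial.C (R + 2 * α * ((h : A) + 1)) * Polynomial.X) * convP α R (h + 1) -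
        Polynomial.C (α * (R + α * (h : A)) * ((h : A) + 1)) * Polynomial.X ^ 2 * convP α R h

/-- The denominator `FQ_h(α, R; z)` of the `h`-th convergent, a polynomial in `z`. -/
noncomputable def convQ {A : Type*} [CommRing A] (α R : A) : ℕ → A[X]
  | 0 => 1
  | 1 => 1 - Polynomial.C R * Polynomial.X
  | h + 2 =>
      (1 - Polynomial.C (R + 2 * α * ((h : A) + 1)) * Polynomial.X) * convQ α R (h + 1) -
        Polynomial.C (α * (R + α * (h : A)) * ((h : A) + 1)) * Polynomial.X ^ 2 * convQ α R h

/-- The `h`-th convergent `Conv_h(α, R; z) = FP_h / FQ_h` as a power series in `z`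
(the denominator has constant term `1`, see `coeff_zero_convQ`). -/
noncomputable def convGF {A : Type*} [CommRing A] (α R : A) (h : ℕ) : A⟦X⟧ :=
  (convP α R h : A⟦X⟧) * PowerSeries.invOfUnit (convQ α R h : A⟦X⟧) 1

theorem coeff_zero_convQ {A : Type*} [CommRing A] (α R : A) :
    ∀ h : ℕ, (convQ α R h).coeff 0 = 1
  | 0 => by simp [convQ]
  | 1 => by simp [convQ]
  | h + 2 => by
      have := coeff_zero_convQ α R (h + 1)
      simp [convQ, Polynomial.mul_coeff_zero, this]

theorem convQ_mul_convGF {A : Type*} [CommRing A] (α R : A) (h : ℕ) :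
    (convQ α R h : A⟦X⟧) * convGF α R h = (convP α R h : A⟦X⟧) := by
  have h1 : PowerSeries.constantCoeff (convQ α R h : A⟦X⟧) = ((1 : Aˣ) : A) := by
    rw [Polynomial.constantCoeff_coe, coeff_zero_convQ]; simp
  rw [convGF, mul_left_comm, PowerSeries.mul_invOfUnit _ _ h1, mul_one]

/-- `[z^n] [R^m] Conv_h(α, ρ(R); z)` for an integer `α` and a polynomial `ρ(R)` in the
indeterminate `R`. -/
noncomputable def convCoeff (h : ℕ) (α : ℤ) (ρ : ℤ[X]) (n m : ℕ) : ℤ :=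
  (PowerSeries.coeff n (convGF (Polynomial.C α) ρ h)).coeff m

/-- `[z^n] [R^m] Conv_h(1, R; z)`. -/
noncomputable def stirlingConv (h n m : ℕ) : ℤ :=
  convCoeff h 1 Polynomial.X n m

/-- The `α`-factorial triangle, supported on `1 ≤ k ≤ n` and `n = k = 0`, with
`T(n, k) = (α n + 1 - 2 α) T(n - 1, k) + T(n - 1, k - 1)` for `n, k ≥ 1`. -/
def alphaTriangle (α : ℤ) : ℕ → ℕ → ℤ
  | 0, 0 => 1
  | 0, _ + 1 => 0
  | _ + 1, 0 => 0
  | n + 1, k + 1 =>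
      (α * ((n : ℤ) + 1) + 1 - 2 * α) * alphaTriangle α n (k + 1) + alphaTriangle α n k

/-- The polynomial `∑_{i < h} C(h - 1, i) (h! / (i + 1)!) (-w)^i`, whose roots are the
`ω_{h,i}`; the quotient of factorials is an exact integer quotient. -/
noncomputable def omegaPoly (h : ℕ) : ℤ[X] :=
  ∑ i ∈ Finset.range h,
    Polynomial.C (((h - 1).choose i * (h.factorial / (i + 1).factorial) : ℕ) : ℤ) *
      (-Polynomial.X) ^ i

/-! ### Congruences, binomials, harmonic numbers -/

/-- `x ≡ y (mod p)` for elements of a field: `x - y` is an integer multiple of `p`. -/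
def CongrMod {K : Type*} [Field K] (p : ℕ) (x y : K) : Prop :=
  ∃ k : ℤ, x - y = (k : K) * (p : K)

/-- Binomial coefficient with an integer lower index, zero for a negative one. -/
def binomZ (n : ℕ) (k : ℤ) : ℕ := if 0 ≤ k then n.choose k.toNat else 0

/-- The `r`-order harmonic number `H_n^{(r)} = ∑_{k = 1}^n k^{-r}`. -/
def genHarmonic (n r : ℕ) : ℚ := ∑ k ∈ Finset.Icc 1 n, 1 / (k : ℚ) ^ r

/-- `(n!)^r H_n^{(r)}`. -/
def scaledHarmonic (r n : ℕ) : ℚ := (n.factorial : ℚ) ^ r * genHarmonic n r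

/-- The combination of coefficients of `Conv_p(1, R; z)` for `(n!)^2 H_n^{(2)}`. -/
noncomputable def harmConv2 (p n : ℕ) : ℤ :=
  stirlingConv p (n + 1) 2 ^ 2 - 2 * stirlingConv p (n + 1) 1 * stirlingConv p (n + 1) 3

/-- The combination of coefficients of `Conv_p(1, R; z)` for `(n!)^3 H_n^{(3)}`. -/
noncomputable def harmConv3 (p n : ℕ) : ℤ :=
  stirlingConv p (n + 1) 2 ^ 3 -
    3 * stirlingConv p (n + 1) 1 * stirlingConv p (n + 1) 2 * stirlingConv p (n + 1) 3 +
    3 * stirlingConv p (n + 1) 1 ^ 2 * stirlingConv p (n + 1) 4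

/-! ### Rational generating functions

Below `z` is the variable of `ℚ⟦X⟧`; every denominator has constant term `±1`. -/

/-- The series expansion of `c · N / D`. -/
noncomputable def frac (c : ℚ) (N D : ℚ⟦X⟧) : ℚ⟦X⟧ := PowerSeries.C c * N * D⁻¹

/-- First order, modulo 4, at `[z^(n+1)]`. -/
noncomputable def gfH1Mod4A : ℚ⟦X⟧ :=
  let z : ℚ⟦X⟧ := PowerSeries.X
  let D : ℚ⟦X⟧ := 24 * z ^ 3 - 36 * z ^ 2 + 12 * z - 1
  PowerSeries.C (1 / 576) * (36 * z ^ 2 - 48 * z + 325) +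
    frac (1 / 576) (17040 * z ^ 2 + 1782 * z + 6467) D +
    frac (1 / 288) (78828 * z ^ 2 - 33987 * z + 3071) (D ^ 2)

/-- First order, modulo 4, at `[z^n]`. -/
noncomputable def gfH1Mod4B : ℚ⟦X⟧ :=
  let z : ℚ⟦X⟧ := PowerSeries.X
  let D : ℚ⟦X⟧ := 24 * z ^ 3 - 36 * z ^ 2 + 12 * z - 1
  PowerSeries.C (1 / 48) * (3 * z - 4) +
    frac (1 / 96) (1300 * z ^ 2 + 890 * z + 947) D +
    frac (1 / 96) (24568 * z ^ 2 - 10576 * z + 955) (D ^ 2)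

/-- First order, modulo 4, at `[z^(n-1)]`. -/
noncomputable def gfH1Mod4C : ℚ⟦X⟧ :=
  let z : ℚ⟦X⟧ := PowerSeries.X
  let D : ℚ⟦X⟧ := 24 * z ^ 3 - 36 * z ^ 2 + 12 * z - 1
  PowerSeries.C (1 / 16) +
    frac (1 / 48) (-96 * z ^ 2 + 794 * z + 397) D +
    frac (1 / 24) (5730 * z ^ 2 - 2453 * z + 221) (D ^ 2)

/-- First order, modulo 5. -/
noncomputable def gfH1Mod5 : ℚ⟦X⟧ :=
  let z : ℚ⟦X⟧ := PowerSeries.X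
  let D : ℚ⟦X⟧ := 120 * z ^ 4 - 240 * z ^ 3 + 120 * z ^ 2 - 20 * z + 1
  PowerSeries.C (1 / 300) * (12 * z - 29) +
    frac (1 / 900) (80130 * z ^ 3 + 54450 * z ^ 2 + 79113 * z + 108164) D +
    frac (1 / 900) (17470170 * z ^ 3 - 11428050 * z ^ 2 + 2081551 * z - 108077) (D ^ 2)

/-- First order, modulo 6. -/
noncomputable def gfH1Mod6 : ℚ⟦X⟧ :=
  let z : ℚ⟦X⟧ := PowerSeries.X
  let D : ℚ⟦X⟧ := 720 * z ^ 5 - 1800 * z ^ 4 + 1200 * z ^ 3 - 300 * z ^ 2 + 30 * z - 1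
  PowerSeries.C (1 / 360) * (10 * z - 37) +
    frac (1 / 2160)
      (1419408 * z ^ 4 + 903312 * z ^ 3 + 1797924 * z ^ 2 + 2950002 * z + 4780681) D +
    frac (1 / 2160)
      (5581246248 * z ^ 4 - 4906594848 * z ^ 3 + 1347715644 * z ^ 2 - 140481648 * z + 4780903)
      (D ^ 2)

/-- Second order, modulo 2. -/
noncomputable def gfH2Mod2 : ℚ⟦X⟧ :=
  let z : ℚ⟦X⟧ := PowerSeries.X
  frac 1 (z * (1 - 3 * z + 9 * z ^ 2 - 8 * z ^ 3)) ((1 - 4 * z) ^ 2)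

/-- Second order, modulo 2, in partial fractions. -/
noncomputable def gfH2Mod2PF : ℚ⟦X⟧ :=
  let z : ℚ⟦X⟧ := PowerSeries.X
  PowerSeries.C (5 / 16) * z - PowerSeries.C (1 / 2) * z ^ 2 +
    frac (11 / 64) 1 ((1 - 4 * z) ^ 2) - frac (11 / 64) 1 (1 - 4 * z)

/-- Second order, modulo 3. -/
noncomputable def gfH2Mod3 : ℚ⟦X⟧ :=
  let z : ℚ⟦X⟧ := PowerSeries.X
  frac 1
    (z * (1 - 61 * z + 1339 * z ^ 2 - 13106 * z ^ 3 + 62284 * z ^ 4 - 144264 * z ^ 5 +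
      151776 * z ^ 6 - 124416 * z ^ 7 + 41472 * z ^ 8))
    ((1 - 6 * z) ^ 3 * (1 - 24 * z + 36 * z ^ 2) ^ 2)

/-- Second order, modulo 3, in partial fractions. -/
noncomputable def gfH2Mod3PF : ℚ⟦X⟧ :=
  let z : ℚ⟦X⟧ := PowerSeries.X
  PowerSeries.C (-13 / 324) + PowerSeries.C (14 / 81) * z - PowerSeries.C (4 / 27) * z ^ 2 +
    frac (25 / 1944) 1 ((-1 + 6 * z) ^ 3) + frac (115 / 1944) 1 ((-1 + 6 * z) ^ 2) +
    frac (5 / 162) 1 (-1 + 6 * z) +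
    frac (1 / 216) (-787 + 17624 * z) ((1 - 24 * z + 36 * z ^ 2) ^ 2) +
    frac (1 / 648) (2377 + 3754 * z) (1 - 24 * z + 36 * z ^ 2)

/-- Third order, modulo 2. -/
noncomputable def gfH3Mod2 : ℚ⟦X⟧ :=
  let z : ℚ⟦X⟧ := PowerSeries.X
  frac 1 (z * (1 - 7 * z + 49 * z ^ 2 - 144 * z ^ 3 + 192 * z ^ 4)) ((1 - 8 * z) ^ 2)

/-- Third order, modulo 2, in partial fractions. -/
noncomputable def gfH3Mod2PF : ℚ⟦X⟧ :=
  let z : ℚ⟦X⟧ := PowerSeries.X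
  PowerSeries.C (11 / 32) * z - PowerSeries.C (3 / 2) * z ^ 2 + 3 * z ^ 3 +
    frac (21 / 256) 1 ((1 - 8 * z) ^ 2) - frac (21 / 256) 1 (1 - 8 * z)

/-- Third order, modulo 3. -/
noncomputable def gfH3Mod3 : ℚ⟦X⟧ :=
  let z : ℚ⟦X⟧ := PowerSeries.X
  let D : ℚ⟦X⟧ := 1 - 108 * z + 216 * z ^ 2
  let E : ℚ⟦X⟧ := 1 - 36 * z + 216 * z ^ 2
  PowerSeries.C (-143 / 5832) + PowerSeries.C (625 / 2916) * z -
    PowerSeries.C (4 / 9) * z ^ 2 + PowerSeries.C (4 / 3) * z ^ 3 +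
    frac (115 / 93312) (-6719 + 711956 * z) (D ^ 2) +
    frac (1 / 93312) (774079 + 1459082 * z) D -
    frac (125 / 11664) (-11 + 312 * z) (E ^ 4) -
    frac (10 / 729) (1 + 306 * z) (E ^ 3) +
    frac (1 / 93312) (-20677 + 269268 * z) (E ^ 2) +
    frac (1 / 93312) (11851 + 89478 * z) E

/-- Denominator, second order, modulo 4. -/
noncomputable def den24 : ℤ[X] :=
  let z : ℤ[X] := Polynomial.X
  (-1 + 72 * z - 720 * z ^ 2 + 576 * z ^ 3) ^ 2 * (-1 + 36 * z - 288 * z ^ 2 + 576 * z ^ 3) ^ 3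

/-- Denominator, second order, modulo 5. -/
noncomputable def den25 : ℤ[X] :=
  let z : ℤ[X] := Polynomial.X
  (1 - 160 * z + 5040 * z ^ 2 - 28800 * z ^ 3 + 14400 * z ^ 4) ^ 2 *
    (1 - 120 * z + 4680 * z ^ 2 - 76800 * z ^ 3 + 561600 * z ^ 4 - 1728000 * z ^ 5 +
      1728000 * z ^ 6) ^ 3

/-- Denominator, third order, modulo 4. -/
noncomputable def den34 : ℤ[X] :=
  let z : ℤ[X] := Polynomial.X
  (1 - 24 * z) ^ 4 * (-1 + 504 * z - 17280 * z ^ 2 + 13824 * z ^ 3) ^ 2 *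
    (-1 + 144 * z - 5184 * z ^ 2 + 13824 * z ^ 3) ^ 4 *
    (-1 + 216 * z - 3456 * z ^ 2 + 13824 * z ^ 3) ^ 4

/-- Denominator, third order, modulo 5. -/
noncomputable def den35 : ℤ[X] :=
  let z : ℤ[X] := Polynomial.X
  (1 - 1520 * z + 273600 * z ^ 2 - 4320000 * z ^ 3 + 1728000 * z ^ 4) ^ 2 *
    (1 - 240 * z + 14400 * z ^ 2 - 288000 * z ^ 3 + 1728000 * z ^ 4) ^ 4 *
    (1 - 1680 * z + 1051200 * z ^ 2 - 319776000 * z ^ 3 + 51914304000 * z ^ 4 -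
      4764026880000 * z ^ 5 + 251795865600000 * z ^ 6 - 7537618944000000 * z ^ 7 +
      121956544512000000 * z ^ 8 - 998751928320000000 * z ^ 9 +
      4084826112000000000 * z ^ 10 - 7739670528000000000 * z ^ 11 +
      5159780352000000000 * z ^ 12) ^ 4

/-! ### Convergents of the continued fraction for the product sequences -/

section Convergents

variable {A : Type*} [CommRing A] (α R : A)

/-! Let F be the generating function of the products p_n(α, R). Everything rests on an explicit
remainder for its continued fraction: FQ_h F - FP_h equals α^h h! p_h(α, R) z^(2h) times a power
series over the coefficient ring (`convQ_mul_mk_genProd`). As FQ_h has constant term 1, dividing by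
it creates no denominators, so Conv_h has the coefficients p_n exactly for n < 2h and modulo h for
every n. Taking coefficients of powers of R gives the statements on Stirling numbers and triangles;
comparing coefficients before dividing gives the sums for first-order harmonic numbers.

For the quasi-polynomials, compare powers of R in FQ_h Conv_h = FP_h. The coefficient of R^m in
Conv_h is N_m / D^m, where D is FQ_h at R = 0, up to sign the reversal of `omegaPoly`
(`exists_numerator`). The latter is a Laguerre polynomial up to a constant. Its three-term
recurrence shows that all roots are positive reals (`exists_pos_of_aeval_omegaPoly_eq_zero`).
Distinct roots and exact degrees m - 1 require D to have simple roots at which N_m does not vanish.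
With Q_1 the R-linear part of FQ_h, one has N_(m+1) ≡ -Q_1 N_m modulo D, so it suffices to treat N_1
and Q_1. For N_1 this follows from the determinant formula for consecutive convergents; for Q_1,
together with simplicity, from the Kummer equation, its derivative in R and a monotone Wronskian
(`eval_mul_ne_zero_of_ode`). Partial fractions finish the argument (`exists_quasiPolynomial`).

The rational generating functions become finite computations. The coefficient combinations for
harmonic numbers are exponential polynomials of bounded order, so after multiplication by a
candidate denominator the tail obeys a monic linear recurrence of known order and vanishes once an
initial window does (`coeff_mul_mk_eq_zero`). The window is evaluated on integer lists: exactly in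
the small cases, and for the second- and third-order denominators with p = 4, 5 modulo a power of 3
that exceeds an a priori bound. Harmonic numbers are tied to Stirling numbers by Newton's
identities. Modulo 2 and 3 the factors R + j are periodic in j, and the closed forms for h = 2, 3
solve the recurrence of the convergent one power of R at a time. -/

theorem genProd_zero : genProd α R 0 = 1 := by simp [genProd]

theorem genProd_succ (n : ℕ) : genProd α R (n + 1) = genProd α R n * (R + n * α) := by
  simp [genProd, Finset.prod_range_succ]

theorem genProd_succ' (n : ℕ) : genProd α R (n + 1) = R * genProd α (R + α) n := by
  simp only [genProd, Finset.prod_range_succ']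
  rw [mul_comm]
  congr 1
  · simp
  · refine Finset.prod_congr rfl fun j _ => ?_
    push_cast
    ring

theorem choose_mul_succ_eq_left (n k : ℕ) :
    ((n + k).choose (k + 1) : A) * (k + 1) = (n + k).choose k * n := by
  have h := Nat.choose_succ_right_eq (n + k) k
  rw [Nat.add_sub_cancel] at h
  exact_mod_cast congrArg (Nat.cast : ℕ → A) h

/-- The coefficients of the denominators. -/
theorem coeff_convQ : ∀ h i : ℕ, (convQ α R h).coeff i =
    h.choose i * genProd α ((1 - (h : A)) * α - R) i
  | 0, 0 => by simp [convQ, genProd]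
  | 0, i + 1 => by simp [convQ, Polynomial.coeff_one]
  | 1, 0 => by simp [convQ, genProd]
  | 1, 1 => by simp [convQ, genProd, Polynomial.coeff_one]
  | 1, i + 2 => by
      simp [convQ, Polynomial.coeff_one, Nat.choose_eq_zero_of_lt]
  | h + 2, 0 => by simp [coeff_zero_convQ, genProd]
  | h + 2, 1 => by
      rw [convQ, sub_mul, one_mul, mul_assoc (Polynomial.C _), mul_assoc (Polynomial.C _), Polynomial.coeff_sub,
        Polynomial.coeff_sub, Polynomial.coeff_C_mul, Polynomial.coeff_C_mul,
        Polynomial.coeff_X_mul, Polynomial.coeff_X_pow_mul', coeff_zero_convQ, coeff_convQ (h + 1)]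
      simp [genProd]
      ring
  | h + 2, i + 2 => by
      rw [convQ, sub_mul, one_mul, mul_assoc (Polynomial.C _), mul_assoc (Polynomial.C _), Polynomial.coeff_sub,
        Polynomial.coeff_sub, Polynomial.coeff_C_mul, Polynomial.coeff_C_mul,
        Polynomial.coeff_X_mul, Polynomial.coeff_X_pow_mul, coeff_convQ (h + 1),
        coeff_convQ (h + 1), coeff_convQ h]
      -- All three products are reduced to the common factor belonging to h and i, so that only
      -- binomial identities remain.
      have e2 : genProd α ((1 - ((h + 2 : ℕ) : A)) * α - R) (i + 2) =
          (-((h : A) + 1) * α - R) * ((-(h : A) * α - R) *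
            genProd α ((1 - (h : A)) * α - R) i) := by
        rw [genProd_succ', genProd_succ']
        push_cast
        congr 2
        · ring
        · ring
        · congr 1; ring
      have e1 : genProd α ((1 - ((h + 1 : ℕ) : A)) * α - R) (i + 1) =
          (-(h : A) * α - R) * genProd α ((1 - (h : A)) * α - R) i := by
        rw [genProd_succ']
        push_cast
        congr 1
        · ring
        · congr 1; ring
      rw [genProd_succ _ _ (i + 1), e2, e1]
      have b1 : ((h + 2).choose (i + 2) : A) = (h + 1).choose (i + 1) + (h + 1).choose (i + 2) := by
        exact_mod_cast congrArg (Nat.cast : ℕ → A) (Nat.choose_succ_succ (h + 1) (i + 1))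
      have b2 : ((h : A) + 1) * h.choose i = (h + 1).choose (i + 1) * (i + 1) := by
        exact_mod_cast congrArg (Nat.cast : ℕ → A) (Nat.add_one_mul_choose_eq h i)
      -- The subtraction takes place in `A`; when h < i both binomials are zero, so its value is
      -- irrelevant.
      have b3 : ((h + 1).choose (i + 2) : A) * (i + 2) = (h + 1).choose (i + 1) * (h - i) := by
        rcases Nat.lt_or_ge h i with hi | hi
        · rw [Nat.choose_eq_zero_of_lt (by omega), Nat.choose_eq_zero_of_lt (by omega)]
          simp
        · have := Nat.choose_succ_right_eq (h + 1) (i + 1)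
          rw [show h + 1 - (i + 1) = h - i by omega] at this
          have := congrArg (Nat.cast : ℕ → A) this
          push_cast [Nat.cast_sub hi] at this
          linear_combination this
      rw [b1]
      push_cast
      generalize genProd α ((1 - (h : A)) * α - R) i = g
      linear_combination ((-(h : A) * α - R) * g * α) * b3 -
        (α * (R + α * h) * g) * b2

theorem coeff_convP_of_le : ∀ h n : ℕ, h ≤ n → (convP α R h).coeff n = 0
  | 0, n, _ => by simp [convP]
  | 1, n + 1, _ => by simp [convP, Polynomial.coeff_one]
  | h + 2, n + 2, hn => by
      rw [convP, sub_mul, one_mul, mul_assoc (Polynomial.C _), mul_assoc (Polynomial.C _), Polynomial.coeff_sub,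
        Polynomial.coeff_sub, Polynomial.coeff_C_mul, Polynomial.coeff_C_mul,
        Polynomial.coeff_X_mul, Polynomial.coeff_X_pow_mul, coeff_convP_of_le (h + 1) _ (by omega),
        coeff_convP_of_le (h + 1) _ (by omega), coeff_convP_of_le h _ (by omega)]
      simp
  | 1, 0, hn => by omega
  | h + 2, 0, hn => by omega
  | h + 2, 1, hn => by omega

/-- The series of the shifted products in the remainder of the `h`-th convergent. -/
noncomputable def convRem (h : ℕ) : A⟦X⟧ :=
  PowerSeries.mk fun n => ((n + h).choose h : A) * genProd α (R + h * α) n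

/-- This is the recurrence of FP and FQ with the scalar prefactors of the remainders divided out,
which is what lets the remainder formula be proved by induction. After removing a common product it
reduces to Pascal's rule and two absorption identities. -/
theorem convRem_rec (h : ℕ) :
    PowerSeries.C (α * (R + α * ((h : A) + 1)) * (h + 2)) * PowerSeries.X ^ 2 *
      convRem α R (h + 2) =
    (1 - PowerSeries.C (R + 2 * α * ((h : A) + 1)) * PowerSeries.X) * convRem α R (h + 1) -
      convRem α R h := by
  ext n
  rw [sub_mul, one_mul, mul_assoc (PowerSeries.C _), mul_assoc (PowerSeries.C _), map_sub, map_sub, PowerSeries.coeff_C_mul,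
    PowerSeries.coeff_C_mul]
  match n with
  | 0 => simp [convRem, genProd, PowerSeries.coeff_X_pow_mul']
  | 1 =>
    rw [PowerSeries.coeff_succ_X_mul, PowerSeries.coeff_X_pow_mul']
    simp [convRem, genProd, Nat.add_comm 1]
    ring
  | n + 2 =>
    rw [PowerSeries.coeff_succ_X_mul, PowerSeries.coeff_X_pow_mul]
    simp only [convRem, PowerSeries.coeff_mk]
    have e0 : genProd α (R + (h : A) * α) (n + 2) =
        (R + h * α) * ((R + (h + 1) * α) * genProd α (R + ((h + 2 : ℕ) : A) * α) n) := by
      rw [genProd_succ', genProd_succ']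
      push_cast
      congr 2
      · ring
      · congr 1; ring
    have e1 : genProd α (R + ((h + 1 : ℕ) : A) * α) (n + 1) =
        (R + (h + 1) * α) * genProd α (R + ((h + 2 : ℕ) : A) * α) n := by
      rw [genProd_succ']
      push_cast
      congr 2
      ring
    rw [genProd_succ _ _ (n + 1), e0, e1]
    generalize genProd α (R + ((h + 2 : ℕ) : A) * α) n = g
    have c1 : (n + 2 + (h + 1)).choose (h + 1) =
        (n + 2 + h).choose h + (n + 2 + h).choose (h + 1) := by
      rw [show n + 2 + (h + 1) = (n + 2 + h) + 1 by ring, Nat.choose_succ_succ]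
    have c2 : n + 1 + (h + 1) = n + 2 + h := by ring
    have c3 : n + (h + 2) = n + 2 + h := by ring
    have b1 : ((n + 2 + h).choose (h + 2) : A) * (h + 2) = (n + 2 + h).choose (h + 1) * (n + 1) := by
      have := choose_mul_succ_eq_left (A := A) (n + 1) (h + 1)
      rw [c2] at this
      push_cast at this
      linear_combination this
    have b2 := choose_mul_succ_eq_left (A := A) (n + 2) h
    rw [c1, c2, c3]
    push_cast at b2 ⊢
    linear_combination (α * (R + (h + 1) * α) * g) * (b1 + b2)

/-- The convergents approximate the ordinary generating function of the products: the error term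
of `FP_h - FQ_h · F` starts at `z^(2h)` and is divisible by `α^h h! p_h(α, R)`. -/
theorem convQ_mul_mk_genProd : ∀ h : ℕ,
    (convQ α R h : A⟦X⟧) * PowerSeries.mk (genProd α R) = (convP α R h : A⟦X⟧) +
      PowerSeries.C (α ^ h * h.factorial * genProd α R h) * PowerSeries.X ^ (2 * h) * convRem α R h
  | 0 => by
      simp [convQ, convP, convRem, genProd]
      rfl
  | 1 => by
      ext n
      simp only [convQ, convP, Polynomial.coe_sub, Polynomial.coe_one, Polynomial.coe_mul,
        Polynomial.coe_C, Polynomial.coe_X]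
      rw [sub_mul, one_mul, mul_assoc (PowerSeries.C _), mul_assoc (PowerSeries.C _), map_sub, map_add, PowerSeries.coeff_C_mul,
        PowerSeries.coeff_C_mul, mul_one, PowerSeries.coeff_one]
      match n with
      | 0 => simp [genProd, PowerSeries.coeff_X_pow_mul']
      | 1 =>
        rw [PowerSeries.coeff_succ_X_mul, PowerSeries.coeff_X_pow_mul']
        simp [genProd]
      | n + 2 =>
        rw [PowerSeries.coeff_succ_X_mul, PowerSeries.coeff_X_pow_mul]
        simp only [convRem, PowerSeries.coeff_mk]
        rw [genProd_succ _ _ (n + 1), genProd_succ']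
        simp [genProd_succ, genProd_zero]
        ring
  | h + 2 => by
      have h1 := convQ_mul_mk_genProd (h + 1)
      have h0 := convQ_mul_mk_genProd h
      have hr := convRem_rec α R h
      have e1 : PowerSeries.C (α ^ (h + 1) * ((h + 1).factorial : A) * genProd α R (h + 1)) =
          PowerSeries.C (α ^ h * (h.factorial : A) * genProd α R h) *
          PowerSeries.C (α * (R + α * (h : A)) * ((h : A) + 1)) := by
        rw [← map_mul, genProd_succ, Nat.factorial_succ]
        push_cast
        congr 1
        ring
      have e2 : PowerSeries.C (α ^ (h + 2) * ((h + 2).factorial : A) * genProd α R (h + 2)) =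
          PowerSeries.C (α ^ (h + 1) * ((h + 1).factorial : A) * genProd α R (h + 1)) *
          PowerSeries.C (α * (R + α * ((h : A) + 1)) * (h + 2)) := by
        rw [← map_mul, genProd_succ _ _ (h + 1), Nat.factorial_succ (h + 1)]
        push_cast
        congr 1
        ring
      rw [e2]
      rw [e1] at h1 ⊢
      simp only [convQ, convP, Polynomial.coe_sub, Polynomial.coe_one, Polynomial.coe_mul,
        Polynomial.coe_C, Polynomial.coe_X, Polynomial.coe_pow]
      rw [show 2 * (h + 2) = 2 * (h + 1) + 2 by ring, pow_add]
      rw [show 2 * (h + 1) = 2 * h + 2 by ring, pow_add] at h1 ⊢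
      -- The recurrence of FP and FQ is applied to the two previous identities; `hr` then merges
      -- their error terms into the next one.
      linear_combination (1 - PowerSeries.C (R + 2 * α * ((h : A) + 1)) * PowerSeries.X) * h1 -
        PowerSeries.C (α * (R + α * (h : A)) * ((h : A) + 1)) * PowerSeries.X ^ 2 * h0 -
        PowerSeries.C (α ^ h * (h.factorial : A) * genProd α R h) *
          PowerSeries.C (α * (R + α * (h : A)) * ((h : A) + 1)) *
          (PowerSeries.X ^ (2 * h) * PowerSeries.X ^ 2) * hr

/-- Divide the remainder formula by FQ_h, which is invertible over `A` itself. The factor h! gives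
the congruences, and the factor z^(2h) gives exactness below 2h. -/
theorem genProd_sub_coeff_convGF (h n : ℕ) : ∃ c : A,
    genProd α R n = PowerSeries.coeff n (convGF α R h) +
      α ^ h * h.factorial * genProd α R h * c ∧ (n < 2 * h → c = 0) := by
  refine ⟨PowerSeries.coeff n (PowerSeries.X ^ (2 * h) * (convRem α R h *
    PowerSeries.invOfUnit (convQ α R h : A⟦X⟧) 1)), ?_, fun hn => ?_⟩
  · have h1 : PowerSeries.constantCoeff (convQ α R h : A⟦X⟧) = ((1 : Aˣ) : A) := by
      rw [Polynomial.constantCoeff_coe, coeff_zero_convQ]; simp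
    have h2 := PowerSeries.mul_invOfUnit _ _ h1
    have h3 := convQ_mul_mk_genProd α R h
    have h4 : PowerSeries.mk (genProd α R) = convGF α R h +
      PowerSeries.C (α ^ h * h.factorial * genProd α R h) * (PowerSeries.X ^ (2 * h) *
        (convRem α R h * PowerSeries.invOfUnit (convQ α R h : A⟦X⟧) 1)) := by
      rw [convGF]
      linear_combination PowerSeries.invOfUnit (convQ α R h : A⟦X⟧) 1 * h3 -
        PowerSeries.mk (genProd α R) * h2
    have h5 := congrArg (PowerSeries.coeff n) h4
    rwa [PowerSeries.coeff_mk, map_add, PowerSeries.coeff_C_mul] at h5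
  · rw [PowerSeries.coeff_X_pow_mul', if_neg (by omega)]

theorem genProd_eq_coeff_convGF {h n : ℕ} (hn : n < 2 * h) :
    genProd α R n = PowerSeries.coeff n (convGF α R h) := by
  obtain ⟨c, h1, h2⟩ := genProd_sub_coeff_convGF α R h n
  rw [h1, h2 hn, mul_zero, add_zero]

theorem dvd_genProd_sub_coeff_convGF {h : ℕ} (hh : 1 ≤ h) (n : ℕ) :
    (h : A) ∣ genProd α R n - PowerSeries.coeff n (convGF α R h) := by
  obtain ⟨c, h1, -⟩ := genProd_sub_coeff_convGF α R h n
  rw [h1, add_sub_cancel_left]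
  have : (h : A) ∣ (h.factorial : A) := Nat.cast_dvd_cast (Nat.dvd_factorial hh le_rfl)
  exact ((this.mul_left _).mul_right _).mul_right _

/-- The coefficients of the convergents satisfy a linear recurrence. -/
theorem sum_coeff_convQ_mul_coeff_convGF (h n : ℕ) :
    ∑ k ∈ Finset.range (n + 1), (convQ α R h).coeff k * PowerSeries.coeff (n - k) (convGF α R h) =
      (convP α R h).coeff n := by
  have := congrArg (PowerSeries.coeff n) (convQ_mul_convGF α R h)
  rw [PowerSeries.coeff_mul, Finset.Nat.sum_antidiagonal_eq_sum_range_succ_mk,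
    Polynomial.coeff_coe] at this
  simpa only [Polynomial.coeff_coe] using this

end Convergents

/-! ### Stirling numbers and factorial triangles -/

theorem convCoeff_modEq {h : ℕ} (hh : 1 ≤ h) (α : ℤ) (ρ : ℤ[X]) (n m : ℕ) :
    (genProd (Polynomial.C α) ρ n).coeff m ≡ convCoeff h α ρ n m [ZMOD h] := by
  obtain ⟨c, hc⟩ := dvd_genProd_sub_coeff_convGF (Polynomial.C α) ρ hh n
  refine (Int.modEq_iff_dvd.2 ⟨c.coeff m, ?_⟩).symm
  rw [convCoeff, ← Polynomial.coeff_sub, hc, ← Polynomial.C_eq_natCast, Polynomial.coeff_C_mul]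

theorem convCoeff_eq {h n : ℕ} (hn : n < 2 * h) (α : ℤ) (ρ : ℤ[X]) (m : ℕ) :
    (genProd (Polynomial.C α) ρ n).coeff m = convCoeff h α ρ n m := by
  rw [convCoeff, genProd_eq_coeff_convGF _ _ hn]

theorem stirlingFirst_eq_coeff_genProd (n m : ℕ) :
    (n.stirlingFirst m : ℤ) = (genProd (1 : ℤ[X]) Polynomial.X n).coeff m := by
  induction n generalizing m with
  | zero => cases m <;> simp [genProd, Polynomial.coeff_one]
  | succ n ih =>
    rw [genProd_succ, mul_add, Polynomial.coeff_add, mul_one,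
      ← Polynomial.C_eq_natCast, Polynomial.coeff_mul_C]
    cases m with
    | zero =>
      rw [Polynomial.mul_coeff_zero, ← ih]
      cases n <;> simp
    | succ m =>
      rw [Polynomial.coeff_mul_X, ← ih, ← ih, Nat.stirlingFirst_succ_succ]
      push_cast
      ring

theorem stirlingFirst_eq_stirlingConv {h n : ℕ} (hn : n < 2 * h) (m : ℕ) :
    (n.stirlingFirst m : ℤ) = stirlingConv h n m := by
  rw [stirlingFirst_eq_coeff_genProd, stirlingConv, ← convCoeff_eq hn, Polynomial.C_1]

theorem stirlingFirst_modEq_stirlingConv {h : ℕ} (hh : 1 ≤ h) (n m : ℕ) :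
    (n.stirlingFirst m : ℤ) ≡ stirlingConv h n m [ZMOD h] := by
  have := convCoeff_modEq hh 1 Polynomial.X n m
  rwa [Polynomial.C_1, ← stirlingFirst_eq_coeff_genProd] at this

theorem alphaTriangle_eq (α : ℤ) (n m : ℕ) : alphaTriangle α (n + 1) (m + 1) =
    (genProd (Polynomial.C α) (Polynomial.X + 1) n).coeff m := by
  induction n generalizing m with
  | zero => cases m <;> simp [alphaTriangle, genProd, Polynomial.coeff_one]
  | succ n ih =>
    have e : (Polynomial.X + 1 + (n : ℤ[X]) * Polynomial.C α) =
        Polynomial.X + Polynomial.C (1 + n * α) := by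
      simp [add_assoc]
    rw [alphaTriangle, genProd_succ, ih, e, mul_add (genProd _ _ _), Polynomial.coeff_add, Polynomial.coeff_mul_C]
    cases m with
    | zero =>
      rw [Polynomial.mul_coeff_zero]
      simp [alphaTriangle]
      ring
    | succ m =>
      rw [Polynomial.coeff_mul_X, ih]
      push_cast
      ring

/-! ### Coefficients of R^m in the convergent as rational functions of z -/

theorem coe_polynomial_sum {A ι : Type*} [CommRing A] (s : Finset ι) (f : ι → A[X]) :
    ((∑ i ∈ s, f i : A[X]) : A⟦X⟧) = ∑ i ∈ s, (f i : A⟦X⟧) :=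
  map_sum Polynomial.coeToPowerSeries.ringHom f s

/-- The coefficient of `R^m` in a polynomial in `z` over `ℤ[R]`, as a polynomial in `z`. -/
noncomputable def zSlice (m : ℕ) (p : ℤ[X][X]) : ℤ[X] := (Polynomial.Bivariate.swap p).coeff m

theorem coeff_zSlice (m n : ℕ) (p : ℤ[X][X]) : (zSlice m p).coeff n = (p.coeff n).coeff m := by
  unfold zSlice
  induction p using Polynomial.induction_on' with
  | add p q hp hq => simp [hp, hq]
  | monomial i a =>
    induction a using Polynomial.induction_on' with
    | add p q hp hq => rw [map_add, map_add, Polynomial.coeff_add, Polynomial.coeff_add, hp, hq,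
        Polynomial.coeff_add, Polynomial.coeff_add]
    | monomial j a =>
      rw [Polynomial.Bivariate.swap_monomial_monomial]
      simp only [Polynomial.coeff_monomial]
      split_ifs <;> simp_all [Polynomial.coeff_monomial]

theorem zSlice_sub (m : ℕ) (p q : ℤ[X][X]) : zSlice m (p - q) = zSlice m p - zSlice m q := by
  simp [zSlice]

theorem zSlice_mul (m : ℕ) (p q : ℤ[X][X]) :
    zSlice m (p * q) = ∑ x ∈ Finset.HasAntidiagonal.antidiagonal m, zSlice x.1 p * zSlice x.2 q := by
  simp [zSlice, Polynomial.coeff_mul]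

/-- The coefficient of `R^j` in `FP_h(1, R; z)`. -/
noncomputable def numSlice (h j : ℕ) : ℤ[X] := zSlice j (convP 1 Polynomial.X h)

/-- The coefficient of `R^j` in `FQ_h(1, R; z)`. -/
noncomputable def denSlice (h j : ℕ) : ℤ[X] := zSlice j (convQ 1 Polynomial.X h)

/-- The coefficient of `R^m` in `Conv_h(1, R; z)`. -/
noncomputable def convSlice (h m : ℕ) : ℤ⟦X⟧ := PowerSeries.mk fun n => stirlingConv h n m

/-- Comparing powers of R in FQ · Conv = FP gives a triangular system over the polynomials in z. Its
diagonal entry is always `denSlice h 0`, so no other denominator can occur. -/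
theorem sum_denSlice_mul_convSlice (h m : ℕ) :
    ∑ x ∈ Finset.HasAntidiagonal.antidiagonal m, (denSlice h x.1 : ℤ⟦X⟧) * convSlice h x.2 =
      (numSlice h m : ℤ⟦X⟧) := by
  ext n
  have key := congrArg (fun p => (PowerSeries.coeff n p).coeff m)
    (convQ_mul_convGF (1 : ℤ[X]) Polynomial.X h)
  simp only [PowerSeries.coeff_mul, Polynomial.finsetSum_coeff, Polynomial.coeff_mul,
    Polynomial.coeff_coe] at key
  rw [map_sum, Polynomial.coeff_coe, numSlice, coeff_zSlice, ← key, Finset.sum_comm]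
  refine Finset.sum_congr rfl fun x _ => ?_
  rw [PowerSeries.coeff_mul]
  refine Finset.sum_congr rfl fun y _ => ?_
  simp [denSlice, coeff_zSlice, convSlice, stirlingConv, convCoeff]

theorem coeff_denSlice (h j i : ℕ) : (denSlice h j).coeff i =
    h.choose i * (genProd 1 (1 - (h : ℤ[X]) - Polynomial.X) i).coeff j := by
  rw [denSlice, coeff_zSlice, coeff_convQ, mul_one, ← Polynomial.C_eq_natCast,
    Polynomial.coeff_C_mul]

theorem coeff_zero_genProd (α R : ℤ[X]) (n : ℕ) :
    (genProd α R n).coeff 0 = genProd (α.coeff 0) (R.coeff 0) n := by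
  simp only [genProd, Polynomial.coeff_zero_eq_eval_zero, Polynomial.eval_prod]
  simp

theorem coeff_denSlice_zero (h i : ℕ) : (denSlice h 0).coeff i =
    h.choose i * genProd 1 (1 - (h : ℤ)) i := by
  rw [coeff_denSlice, coeff_zero_genProd]
  simp

theorem genProd_one_neg (s i : ℕ) : genProd 1 (-(s : ℤ)) i = (-1) ^ i * s.descFactorial i := by
  induction i with
  | zero => simp [genProd]
  | succ i ih =>
    rw [genProd_succ, ih, Nat.descFactorial_succ, mul_one]
    rcases Nat.lt_or_ge s i with h | h
    · rw [Nat.descFactorial_of_lt h]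
      simp
    · push_cast [Nat.cast_sub h]
      ring

theorem natDegree_denSlice_le (h j : ℕ) : (denSlice h j).natDegree ≤ h := by
  refine Polynomial.natDegree_le_iff_coeff_eq_zero.2 fun n hn => ?_
  rw [coeff_denSlice, Nat.choose_eq_zero_of_lt hn]
  simp

/-- At R = 0 the product starting at -s meets the factor 0 after s steps, so the degree is one less
than that of FQ. -/
theorem natDegree_denSlice_zero_le (s : ℕ) : (denSlice (s + 1) 0).natDegree ≤ s := by
  refine Polynomial.natDegree_le_iff_coeff_eq_zero.2 fun n hn => ?_
  rw [coeff_denSlice_zero]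
  push_cast
  rw [show (1 - ((s : ℤ) + 1)) = -(s : ℤ) by ring, genProd_one_neg, Nat.descFactorial_of_lt hn]
  simp

theorem natDegree_numSlice_le (h j : ℕ) : (numSlice h j).natDegree ≤ h := by
  refine Polynomial.natDegree_le_iff_coeff_eq_zero.2 fun n hn => ?_
  rw [numSlice, coeff_zSlice, coeff_convP_of_le _ _ _ _ hn.le, Polynomial.coeff_zero]

theorem coeff_omegaPoly (h i : ℕ) : (omegaPoly (h + 1)).coeff i =
    (-1) ^ i * (h.choose i * ((h + 1).factorial / (i + 1).factorial) : ℕ) := by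
  simp only [omegaPoly, Polynomial.finsetSum_coeff, Polynomial.coeff_C_mul,
    neg_pow (Polynomial.X : ℤ[X]), Nat.add_sub_cancel]
  simp only [← Polynomial.C_1, ← Polynomial.C_neg, ← Polynomial.C_pow, Polynomial.coeff_C_mul,
    Polynomial.coeff_X_pow]
  rw [Finset.sum_eq_single i]
  · simp
    ring
  · intro j _ hj
    simp [Ne.symm hj]
  · intro hi
    rw [Nat.choose_eq_zero_of_lt (by simpa using hi)]
    simp

theorem natDegree_omegaPoly (h : ℕ) : (omegaPoly (h + 1)).natDegree = h := by
  refine le_antisymm (Polynomial.natDegree_le_iff_coeff_eq_zero.2 fun n hn => ?_)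
    (Polynomial.le_natDegree_of_ne_zero ?_)
  · rw [coeff_omegaPoly, Nat.choose_eq_zero_of_lt hn]
    simp
  · rw [coeff_omegaPoly, Nat.div_self (Nat.factorial_pos _)]
    simp

theorem coeff_denSlice_zero_eq {h k : ℕ} (hk : k ≤ h) :
    (denSlice (h + 1) 0).coeff k = (-1) ^ h * (omegaPoly (h + 1)).coeff (h - k) := by
  rw [coeff_denSlice_zero, coeff_omegaPoly]
  rw [show (1 - ((h + 1 : ℕ) : ℤ)) = -(h : ℤ) by push_cast; ring, genProd_one_neg, Nat.choose_symm hk,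
    show h - k + 1 = h + 1 - k by omega, ← Nat.descFactorial_eq_div (by omega : k ≤ h + 1),
    Nat.descFactorial_eq_factorial_mul_choose, Nat.descFactorial_eq_factorial_mul_choose]
  have : (-1 : ℤ) ^ h * (-1) ^ (h - k) = (-1) ^ k := by
    rw [← pow_add, show h + (h - k) = k + 2 * (h - k) by omega, pow_add, pow_mul]
    simp
  push_cast
  rw [← this]
  ring

theorem denSlice_zero_eq (h : ℕ) :
    denSlice (h + 1) 0 = (-1) ^ h * (omegaPoly (h + 1)).reverse := by
  ext k
  rw [← Polynomial.C_1, ← Polynomial.C_neg, ← Polynomial.C_pow, Polynomial.coeff_C_mul,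
    Polynomial.coeff_reverse, natDegree_omegaPoly]
  rcases Nat.lt_or_ge h k with hk | hk
  · rw [Polynomial.coeff_eq_zero_of_natDegree_lt ((natDegree_denSlice_zero_le h).trans_lt hk),
      Polynomial.revAt_eq_self_of_lt hk,
      Polynomial.coeff_eq_zero_of_natDegree_lt (by rwa [natDegree_omegaPoly]), mul_zero]
  · rw [Polynomial.revAt_le hk, coeff_denSlice_zero_eq hk]

/-- The determinant formula for consecutive convergents: each step of the recurrence multiplies the
determinant by its last coefficient. -/
theorem convP_mul_convQ_sub {A : Type*} [CommRing A] (α R : A) (h : ℕ) :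
    convP α R (h + 1) * convQ α R h - convP α R h * convQ α R (h + 1) =
      Polynomial.C (α ^ h * h.factorial * genProd α R h) * Polynomial.X ^ (2 * h) := by
  induction h with
  | zero => simp [convP, convQ, genProd]
  | succ h ih =>
    have e1 : Polynomial.C (α ^ (h + 1) * ((h + 1).factorial : A) * genProd α R (h + 1)) =
        Polynomial.C (α ^ h * (h.factorial : A) * genProd α R h) *
          Polynomial.C (α * (R + α * (h : A)) * ((h : A) + 1)) := by
      rw [← map_mul, genProd_succ, Nat.factorial_succ]
      push_cast
      congr 1
      ring
    rw [e1, convP, convQ, show 2 * (h + 1) = 2 * h + 2 by ring, pow_add]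
    linear_combination Polynomial.C (α * (R + α * (h : A)) * ((h : A) + 1)) *
      Polynomial.X ^ 2 * ih

theorem coeff_zero_one_genProd (h : ℕ) :
    (genProd (1 : ℤ[X]) Polynomial.X (h + 1)).coeff 0 = 0 ∧
      (genProd (1 : ℤ[X]) Polynomial.X (h + 1)).coeff 1 = h.factorial := by
  rw [← stirlingFirst_eq_coeff_genProd, ← stirlingFirst_eq_coeff_genProd,
    Nat.stirlingFirst_one_right]
  simp

/-- The error term carries the factor p_h(1, R), which is divisible by R; at R = 0 the convergent
therefore equals the full series, whose coefficients are p_n(1, 0) = [n = 0]. -/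
theorem convSlice_zero {h : ℕ} (hh : 1 ≤ h) : convSlice h 0 = 1 := by
  have hu : ∀ n, (PowerSeries.coeff n (convSlice h 0)) = if n = 0 then 1 else 0 := by
    intro n
    rw [convSlice, PowerSeries.coeff_mk, stirlingConv, convCoeff, Polynomial.C_1]
    obtain ⟨c, hc, -⟩ := genProd_sub_coeff_convGF (1 : ℤ[X]) Polynomial.X h n
    have h0 : (genProd (1 : ℤ[X]) Polynomial.X h).coeff 0 = 0 := by
      obtain ⟨s, rfl⟩ : ∃ s, h = s + 1 := ⟨h - 1, by omega⟩
      exact (coeff_zero_one_genProd s).1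
    have := congrArg (fun p : ℤ[X] => p.coeff 0) hc
    simp only [Polynomial.coeff_add, Polynomial.mul_coeff_zero, h0, mul_zero, zero_mul,
      add_zero] at this
    rw [← this, ← stirlingFirst_eq_coeff_genProd]
    cases n <;> simp
  ext n
  rw [hu, PowerSeries.coeff_one]

theorem numSlice_zero {h : ℕ} (hh : 1 ≤ h) : numSlice h 0 = denSlice h 0 := by
  have := sum_denSlice_mul_convSlice h 0
  simp only [Finset.Nat.antidiagonal_zero, Finset.sum_singleton, convSlice_zero hh, mul_one] at this
  exact (Polynomial.coe_injective ℤ this).symm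

/-- The numerator of the coefficient of `R` in `Conv_h(1, R; z)` modulo the denominator. -/
theorem numSlice_one_sub_denSlice_one {h : ℕ} (hh : 1 ≤ h) :
    (numSlice (h + 1) 1 - denSlice (h + 1) 1) * denSlice h 0 -
      (numSlice h 1 - denSlice h 1) * denSlice (h + 1) 0 =
      Polynomial.C ((h.factorial : ℤ) * (h - 1).factorial) * Polynomial.X ^ (2 * h) := by
  have key := congrArg (zSlice 1) (convP_mul_convQ_sub (1 : ℤ[X]) Polynomial.X h)
  rw [zSlice_sub, zSlice_mul, zSlice_mul] at key
  have h1 : zSlice 1 (Polynomial.C ((1 : ℤ[X]) ^ h * (h.factorial : ℤ[X]) *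
      genProd 1 Polynomial.X h) * Polynomial.X ^ (2 * h)) =
      Polynomial.C ((h.factorial : ℤ) * (h - 1).factorial) * Polynomial.X ^ (2 * h) := by
    ext n
    rw [coeff_zSlice, Polynomial.coeff_C_mul_X_pow, Polynomial.coeff_C_mul_X_pow]
    split_ifs
    · obtain ⟨s, rfl⟩ : ∃ s, h = s + 1 := ⟨h - 1, by omega⟩
      rw [one_pow, one_mul, ← Polynomial.C_eq_natCast, Polynomial.coeff_C_mul,
        (coeff_zero_one_genProd s).2]
      simp
    · simp
  rw [h1] at key
  rw [← key, Finset.Nat.antidiagonal_succ]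
  simp only [Finset.Nat.antidiagonal_zero, Finset.map_singleton, Finset.sum_cons, Finset.sum_singleton,
    Function.Embedding.prodMap, Function.Embedding.coeFn_mk, Prod.map]
  change _ = numSlice (h + 1) 0 * denSlice h 1 + numSlice (h + 1) 1 * denSlice h 0 -
    (numSlice h 0 * denSlice (h + 1) 1 + numSlice h 1 * denSlice (h + 1) 0)
  -- FP and FQ agree at R = 0, so the four products of the R-linear part regroup into the
  -- differences of numerator and denominator slices.
  rw [numSlice_zero hh, numSlice_zero (by omega : 1 ≤ h + 1)]
  ring

/-- The coefficients of `R^m` in `Conv_h(1, R; z)` as rational functions. -/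
theorem exists_numerator (s : ℕ) : ∃ N : ℕ → ℤ[X],
    (∀ m, 1 ≤ m → (denSlice (s + 1) 0 : ℤ⟦X⟧) ^ m * convSlice (s + 1) m = (N m : ℤ⟦X⟧) ∧
      (N m).natDegree ≤ m * (s + 1)) ∧
    N 1 = numSlice (s + 1) 1 - denSlice (s + 1) 1 ∧
    ∀ m, 1 ≤ m → denSlice (s + 1) 0 ∣ N (m + 1) + denSlice (s + 1) 1 * N m := by
  set D := denSlice (s + 1) 0 with hD
  have hrec : ∀ m, (D : ℤ⟦X⟧) * convSlice (s + 1) (m + 1) = (numSlice (s + 1) (m + 1) : ℤ⟦X⟧) -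
      (denSlice (s + 1) (m + 1) : ℤ⟦X⟧) -
      ∑ j ∈ Finset.range m, (denSlice (s + 1) (j + 1) : ℤ⟦X⟧) * convSlice (s + 1) (m - j) := by
    intro m
    have := sum_denSlice_mul_convSlice (s + 1) (m + 1)
    rw [Finset.Nat.sum_antidiagonal_eq_sum_range_succ_mk, Finset.sum_range_succ,
      Finset.sum_range_succ'] at this
    simp only [Nat.sub_self, convSlice_zero (Nat.le_add_left 1 s), mul_one, Nat.sub_zero,
      Nat.add_sub_add_right] at this
    linear_combination this
  have hdegQ := natDegree_denSlice_le (s + 1)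
  have hdegP := natDegree_numSlice_le (s + 1)
  have hdegD : D.natDegree ≤ s := natDegree_denSlice_zero_le s
  have hex : ∀ m, ∃ N : ℤ[X], (D : ℤ⟦X⟧) ^ m * convSlice (s + 1) m = (N : ℤ⟦X⟧) ∧
      N.natDegree ≤ m * (s + 1) := by
    intro m
    induction m using Nat.strong_induction_on with
    | _ m ih =>
      match m with
      | 0 => exact ⟨1, by simp [convSlice_zero (Nat.le_add_left 1 s)], by simp⟩
      | m + 1 =>
        choose! N hN hdeg using ih
        refine ⟨D ^ m * (numSlice (s + 1) (m + 1) - denSlice (s + 1) (m + 1)) -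
          ∑ j ∈ Finset.range m, D ^ j * denSlice (s + 1) (j + 1) * N (m - j), ?_, ?_⟩
        · simp only [Polynomial.coe_sub, Polynomial.coe_mul, Polynomial.coe_pow]
          rw [pow_succ, mul_assoc, hrec, mul_sub]
          congr 1
          rw [coe_polynomial_sum, Finset.mul_sum]
          refine Finset.sum_congr rfl fun j hj => ?_
          have hj := Finset.mem_range.1 hj
          simp only [Polynomial.coe_mul, Polynomial.coe_pow]
          rw [← hN (m - j) (by omega)]
          rw [show (D : ℤ⟦X⟧) ^ m = (D : ℤ⟦X⟧) ^ j * (D : ℤ⟦X⟧) ^ (m - j) by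
            rw [← pow_add]; congr 1; omega]
          ring
        -- The bound m(s + 1) exceeds the bound ms for the degree of D^m by m. This surplus limits
        -- the polynomial part of the quotient, which is why the later formulas start at n > m.
        · refine (Polynomial.natDegree_sub_le _ _).trans (max_le ?_ ?_)
          · refine Polynomial.natDegree_mul_le.trans ?_
            have h1 := Polynomial.natDegree_pow_le_of_le m hdegD
            have h2 := (Polynomial.natDegree_sub_le (numSlice (s + 1) (m + 1))
              (denSlice (s + 1) (m + 1))).trans (max_le (hdegP _) (hdegQ _))
            nlinarith
          · refine Polynomial.natDegree_sum_le_of_forall_le _ _ fun j hj => ?_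
            have hj := Finset.mem_range.1 hj
            refine Polynomial.natDegree_mul_le.trans ?_
            have h1 := Polynomial.natDegree_pow_le_of_le j hdegD
            have h2 := hdegQ (j + 1)
            have h3 := hdeg (m - j) (by omega)
            have h4 := Polynomial.natDegree_mul_le (p := D ^ j) (q := denSlice (s + 1) (j + 1))
            obtain ⟨k, rfl⟩ : ∃ k, m = j + k := ⟨m - j, by omega⟩
            rw [Nat.add_sub_cancel_left] at h3 ⊢
            nlinarith
  choose N hN hdeg using hex
  refine ⟨N, fun m _ => ⟨hN m, hdeg m⟩, ?_, fun m hm => ?_⟩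
  · refine Polynomial.coe_injective ℤ ?_
    rw [← hN 1, pow_one, hrec 0]
    simp
  · obtain ⟨k, rfl⟩ : ∃ k, m = k + 1 := ⟨m - 1, by omega⟩
    -- In the recursion for the numerators only the term with the R-linear part of FQ lacks a factor
    -- D; the cofactor given here collects all the others.
    refine ⟨D ^ k * (numSlice (s + 1) (k + 2) - denSlice (s + 1) (k + 2)) -
      ∑ j ∈ Finset.range k, D ^ j * denSlice (s + 1) (j + 2) * N (k - j), ?_⟩
    refine Polynomial.coe_injective ℤ ?_
    simp only [Polynomial.coe_sub, Polynomial.coe_mul, Polynomial.coe_pow, Polynomial.coe_add]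
    rw [← hN (k + 1 + 1), ← hN (k + 1), pow_succ _ (k + 1), mul_assoc, hrec,
      Finset.sum_range_succ', coe_polynomial_sum]
    simp only [mul_sub, mul_add, Finset.mul_sum, Polynomial.coe_mul, Polynomial.coe_pow, Nat.add_sub_add_right, Nat.sub_zero]
    have : ∀ j ∈ Finset.range k, (D : ℤ⟦X⟧) ^ (k + 1) * ((denSlice (s + 1) (j + 1 + 1) : ℤ⟦X⟧) *
        convSlice (s + 1) (k - j)) = (D : ℤ⟦X⟧) * ((D : ℤ⟦X⟧) ^ j *
        (denSlice (s + 1) (j + 2) : ℤ⟦X⟧) * (N (k - j) : ℤ⟦X⟧)) := by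
      intro j hj
      have hj := Finset.mem_range.1 hj
      rw [← hN (k - j), show (D : ℤ⟦X⟧) ^ (k + 1) = (D : ℤ⟦X⟧) * ((D : ℤ⟦X⟧) ^ j *
        (D : ℤ⟦X⟧) ^ (k - j)) by rw [← pow_add, ← pow_succ']; congr 1; omega]
      ring
    rw [Finset.sum_congr rfl this]
    ring

/-! ### Location and simplicity of the roots of `omegaPoly` -/

theorem convQ_map {A B : Type*} [CommRing A] [CommRing B] (f : A →+* B) (α R : A) :
    ∀ h, (convQ α R h).map f = convQ (f α) (f R) h
  | 0 => by simp [convQ]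
  | 1 => by simp [convQ]
  | h + 2 => by
      have h2 : f 2 = 2 := map_ofNat f 2
      simp [convQ, convQ_map f α R h, convQ_map f α R (h + 1), h2]

theorem denSlice_zero_eq_convQ (h : ℕ) : denSlice h 0 = convQ 1 0 h := by
  ext i
  rw [coeff_denSlice_zero, coeff_convQ, mul_one, sub_zero]

theorem aeval_omegaPoly {K : Type*} [Field K] {w : K} (hw : w ≠ 0) (s : ℕ) :
    Polynomial.aeval w (omegaPoly (s + 1)) =
      (-1) ^ s * (w ^ s * Polynomial.aeval w⁻¹ (denSlice (s + 1) 0)) := by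
  let _ := invertibleOfNonzero hw
  have := Polynomial.eval₂_reverse_mul_pow (algebraMap ℤ K) w (omegaPoly (s + 1))
  rw [natDegree_omegaPoly, ← Polynomial.aeval_def, ← Polynomial.aeval_def, invOf_eq_inv] at this
  rw [← this, denSlice_zero_eq, map_mul, map_pow, map_neg, map_one]
  rw [show (-1 : K) ^ s * (w ^ s * ((-1) ^ s * Polynomial.aeval w⁻¹ (omegaPoly (s + 1)).reverse)) =
    ((-1) * (-1)) ^ s * (Polynomial.aeval w⁻¹ (omegaPoly (s + 1)).reverse * w ^ s) by
      rw [mul_pow]; ring]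
  simp

theorem aeval_omegaPoly_zero_ne (s : ℕ) {K : Type*} [Field K] [CharZero K] :
    Polynomial.aeval (0 : K) (omegaPoly (s + 1)) ≠ 0 := by
  rw [Polynomial.aeval_def, Polynomial.eval₂_at_zero, coeff_omegaPoly]
  simpa using (Nat.factorial_pos (s + 1)).ne'

/-- The reflected denominators at `R = 0`. -/
noncomputable def reflDen {K : Type*} [Field K] (w : K) (h : ℕ) : K :=
  w ^ h * (convQ (1 : K) 0 h).eval w⁻¹

/-- A three-term recurrence of orthogonal-polynomial type. Real coefficients and h(h + 1) ≥ 0 are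
what the two positivity arguments use. -/
theorem reflDen_rec {K : Type*} [Field K] {w : K} (hw : w ≠ 0) (h : ℕ) :
    reflDen w (h + 2) = (w - 2 * (h + 1)) * reflDen w (h + 1) - h * (h + 1) * reflDen w h := by
  simp only [reflDen, convQ]
  simp
  field_simp
  ring

theorem reflDen_eq {K : Type*} [Field K] {w : K} (hw : w ≠ 0) (s : ℕ) :
    reflDen w (s + 1) = (-1) ^ s * (w * Polynomial.aeval w (omegaPoly (s + 1))) := by
  rw [aeval_omegaPoly hw, denSlice_zero_eq_convQ, reflDen, Polynomial.aeval_def,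
    ← Polynomial.eval_map, convQ_map]
  rw [show (-1 : K) ^ s * (w * ((-1) ^ s * (w ^ s * Polynomial.eval w⁻¹
    (convQ ((algebraMap ℤ K) 1) ((algebraMap ℤ K) 0) (s + 1))))) = ((-1) * (-1)) ^ s *
      (w ^ (s + 1) * Polynomial.eval w⁻¹
    (convQ ((algebraMap ℤ K) 1) ((algebraMap ℤ K) 0) (s + 1))) by rw [mul_pow]; ring]
  simp

/-- A Christoffel-Darboux positivity: multiplying the recurrence by the conjugate of the middle term
and taking imaginary parts adds a positive multiple of a squared norm at each step. It rules out
non-real roots. -/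
theorem reflDen_ne_zero_of_im {w : ℂ} (hw : w.im ≠ 0) (h : ℕ) :
    0 < w.im * (reflDen w (h + 1) * (starRingEnd ℂ) (reflDen w h)).im := by
  have hw0 : w ≠ 0 := fun h => hw (by simp [h])
  induction h with
  | zero =>
    have : reflDen w 1 = w := by simp [reflDen, convQ]
    have h0 : reflDen w 0 = 1 := by simp [reflDen, convQ]
    simp only [this, h0, zero_add, map_one, mul_one]
    exact mul_self_pos.2 hw
  | succ h ih =>
    have hne : reflDen w (h + 1) ≠ 0 := fun h0 => by simp [h0] at ih
    have hpos : 0 < Complex.normSq (reflDen w (h + 1)) := Complex.normSq_pos.2 hne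
    have key : (reflDen w (h + 1 + 1) * (starRingEnd ℂ) (reflDen w (h + 1))).im =
        w.im * Complex.normSq (reflDen w (h + 1)) +
          h * (h + 1) * (reflDen w (h + 1) * (starRingEnd ℂ) (reflDen w h)).im := by
      rw [reflDen_rec hw0]
      simp [Complex.normSq_apply]
      ring
    rw [key]
    have h1 : 0 < w.im ^ 2 := by positivity
    have h2 : (0 : ℝ) ≤ h * (h + 1) := by positivity
    nlinarith [mul_pos h1 hpos, mul_nonneg h2 ih.le]

/-- On the negative axis the signs alternate, which rules out negative roots. The growth estimate in
the second conjunct is needed to absorb the negative term h(h + 1) in the induction. -/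
theorem reflDen_ne_zero_of_neg {x : ℝ} (hx : x < 0) (h : ℕ) :
    0 < (-1) ^ h * reflDen x h ∧
      h * ((-1) ^ h * reflDen x h) < (-1) ^ (h + 1) * reflDen x (h + 1) := by
  induction h with
  | zero => simpa [reflDen, convQ] using hx
  | succ h ih =>
    obtain ⟨h1, h2⟩ := ih
    have h3 : 0 < (-1) ^ (h + 1) * reflDen x (h + 1) :=
      lt_of_le_of_lt (mul_nonneg (Nat.cast_nonneg h) h1.le) h2
    refine ⟨h3, ?_⟩
    rw [reflDen_rec hx.ne]
    have e : (-1) ^ (h + 1 + 1) * ((x - 2 * ((h : ℝ) + 1)) * reflDen x (h + 1) -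
        h * (h + 1) * reflDen x h) = (-x + 2 * (h + 1)) * ((-1) ^ (h + 1) * reflDen x (h + 1)) -
        (h + 1) * (h * ((-1) ^ h * reflDen x h)) := by ring
    rw [e]
    push_cast
    have h4 : (0 : ℝ) < h + 1 := by positivity
    nlinarith [mul_lt_mul_of_pos_left h2 h4, mul_pos (neg_pos.2 hx) h3]

/-- The roots of `omegaPoly` are positive reals. -/
theorem exists_pos_of_aeval_omegaPoly_eq_zero {s : ℕ} {w : ℂ}
    (hw : Polynomial.aeval w (omegaPoly (s + 1)) = 0) :
    ∃ r : ℝ, 0 < r ∧ w = r ∧ Polynomial.aeval r (omegaPoly (s + 1)) = 0 := by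
  have hw0 : w ≠ 0 := fun h => aeval_omegaPoly_zero_ne s (h ▸ hw)
  have him : w.im = 0 := by
    by_contra him
    have h1 := reflDen_ne_zero_of_im him s
    rw [reflDen_eq hw0, hw] at h1
    simp at h1
  have hre : w = (w.re : ℂ) := Complex.ext rfl (by simp [him])
  have hr : Polynomial.aeval w.re (omegaPoly (s + 1)) = 0 := by
    rw [hre] at hw
    have := Polynomial.aeval_algebraMap_apply ℂ w.re (omegaPoly (s + 1))
    rw [Complex.coe_algebraMap, hw] at this
    exact_mod_cast this.symm
  have hne : w.re ≠ 0 := fun h => hw0 (by rw [hre, h]; simp)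
  refine ⟨w.re, ?_, hre, hr⟩
  by_contra hle
  have hlt : w.re < 0 := lt_of_le_of_ne (not_lt.1 hle) hne
  have h1 := (reflDen_ne_zero_of_neg hlt (s + 1)).1
  rw [reflDen_eq hne, hr] at h1
  simp at h1

/-- The derivative in `R` of the reflected denominator at `R = 0`, up to sign. -/
noncomputable def reflDenDeriv (s : ℕ) : ℤ[X] :=
  (-1) ^ s * (denSlice (s + 1) 1).reflect (s + 1)

/-- The ratio of consecutive coefficients of the reflected denominator, with R still an
indeterminate. It is the coefficient form of Kummer's equation w y'' + (R - w) y' + (s + 1) y = 0.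
-/
theorem genProd_descend (s j : ℕ) (hj : j < s + 1) :
    ((j : ℤ[X]) + 1) * ((j : ℤ[X]) + Polynomial.X) * (((s + 1).choose (j + 1) : ℤ[X]) *
      genProd 1 (1 - ((s + 1 : ℕ) : ℤ[X]) - Polynomial.X) (s + 1 - (j + 1))) +
    ((s : ℤ[X]) + 1 - (j : ℤ[X])) * (((s + 1).choose j : ℤ[X]) *
      genProd 1 (1 - ((s + 1 : ℕ) : ℤ[X]) - Polynomial.X) (s + 1 - j)) = 0 := by
  obtain ⟨k, rfl⟩ : ∃ k, s = j + k := ⟨s - j, by omega⟩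
  rw [show j + k + 1 - j = k + 1 by omega, show j + k + 1 - (j + 1) = k by omega, genProd_succ]
  have := congrArg (Nat.cast : ℕ → ℤ[X]) (Nat.choose_succ_right_eq (j + k + 1) j)
  rw [show j + k + 1 - j = k + 1 by omega] at this
  push_cast at this ⊢
  linear_combination ((j : ℤ[X]) + Polynomial.X) * genProd 1 (1 - ((j : ℤ[X]) + (k : ℤ[X]) + 1) - Polynomial.X) k *
    this

theorem denSlice_descend (s j : ℕ) (hj : j < s + 1) :
    ((j : ℤ) + 1) * j * (denSlice (s + 1) 0).coeff (s + 1 - (j + 1)) +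
      (s + 1 - j) * (denSlice (s + 1) 0).coeff (s + 1 - j) = 0 ∧
    ((j : ℤ) + 1) * j * (denSlice (s + 1) 1).coeff (s + 1 - (j + 1)) +
      (j + 1) * (denSlice (s + 1) 0).coeff (s + 1 - (j + 1)) +
      (s + 1 - j) * (denSlice (s + 1) 1).coeff (s + 1 - j) = 0 := by
  have key := genProd_descend s j hj
  have e : ((j : ℤ[X]) + 1) * ((j : ℤ[X]) + Polynomial.X) * (((s + 1).choose (j + 1) : ℤ[X]) *
      genProd 1 (1 - ((s + 1 : ℕ) : ℤ[X]) - Polynomial.X) (s + 1 - (j + 1))) +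
    ((s : ℤ[X]) + 1 - (j : ℤ[X])) * (((s + 1).choose j : ℤ[X]) *
      genProd 1 (1 - ((s + 1 : ℕ) : ℤ[X]) - Polynomial.X) (s + 1 - j)) =
    Polynomial.C (((j : ℤ) + 1) * j * (s + 1).choose (j + 1)) *
      genProd 1 (1 - ((s + 1 : ℕ) : ℤ[X]) - Polynomial.X) (s + 1 - (j + 1)) +
    Polynomial.C (((j : ℤ) + 1) * (s + 1).choose (j + 1)) *
      genProd 1 (1 - ((s + 1 : ℕ) : ℤ[X]) - Polynomial.X) (s + 1 - (j + 1)) * Polynomial.X +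
    Polynomial.C (((s : ℤ) + 1 - j) * (s + 1).choose j) *
      genProd 1 (1 - ((s + 1 : ℕ) : ℤ[X]) - Polynomial.X) (s + 1 - j) := by
    simp only [map_mul, map_add, map_sub, map_natCast, map_one]
    ring
  rw [e] at key
  have hs : ∀ k, k ≤ s + 1 → ((s + 1).choose (s + 1 - k) : ℤ) = (s + 1).choose k := fun k hk => by
    rw [Nat.choose_symm hk]
  have h0 := congrArg (fun p : ℤ[X] => p.coeff 0) key
  have h1 := congrArg (fun p : ℤ[X] => p.coeff 1) key
  simp only [Polynomial.coeff_add, Polynomial.coeff_C_mul, Polynomial.coeff_mul_X_zero,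
    Polynomial.coeff_zero] at h0
  simp only [Polynomial.coeff_add, Polynomial.coeff_C_mul, Polynomial.coeff_mul_X,
    Polynomial.coeff_zero] at h1
  simp only [coeff_denSlice, hs (j + 1) (by omega), hs j (by omega)]
  constructor
  · linear_combination h0
  · linear_combination h1

theorem coeff_X_mul_omegaPoly (s j : ℕ) (hj : j ≤ s + 1) :
    (Polynomial.X * omegaPoly (s + 1)).coeff j =
      (-1) ^ s * (denSlice (s + 1) 0).coeff (s + 1 - j) := by
  cases j with
  | zero =>
    rw [Polynomial.mul_coeff_zero, Polynomial.coeff_eq_zero_of_natDegree_lt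
      ((natDegree_denSlice_zero_le s).trans_lt (by omega))]
    simp
  | succ j =>
    rw [Polynomial.coeff_X_mul, coeff_denSlice_zero_eq (by omega), ← mul_assoc, ← mul_pow,
      show s - (s + 1 - (j + 1)) = j by omega]
    simp

theorem coeff_reflDenDeriv (s j : ℕ) (hj : j ≤ s + 1) :
    (reflDenDeriv s).coeff j = (-1) ^ s * (denSlice (s + 1) 1).coeff (s + 1 - j) := by
  rw [reflDenDeriv, ← Polynomial.C_1, ← Polynomial.C_neg, ← Polynomial.C_pow,
    Polynomial.coeff_C_mul, Polynomial.coeff_reflect, Polynomial.revAt_le hj]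

theorem coeff_X_mul_omegaPoly_of_lt (s j : ℕ) (hj : s + 1 < j) :
    (Polynomial.X * omegaPoly (s + 1)).coeff j = 0 :=
  Polynomial.coeff_eq_zero_of_natDegree_lt (lt_of_le_of_lt (Polynomial.natDegree_mul_le.trans
    (by rw [natDegree_omegaPoly, Polynomial.natDegree_X, add_comm])) hj)

theorem coeff_reflDenDeriv_of_lt (s j : ℕ) (hj : s + 1 < j) : (reflDenDeriv s).coeff j = 0 := by
  rw [reflDenDeriv, ← Polynomial.C_1, ← Polynomial.C_neg, ← Polynomial.C_pow,
    Polynomial.coeff_C_mul, Polynomial.coeff_reflect, Polynomial.revAt_eq_self_of_lt hj,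
    Polynomial.coeff_eq_zero_of_natDegree_lt ((natDegree_denSlice_le _ _).trans_lt hj), mul_zero]

theorem ode_coeff (s j : ℕ) :
    ((j : ℤ) + 1) * j * (Polynomial.X * omegaPoly (s + 1)).coeff (j + 1) +
      (s + 1 - j) * (Polynomial.X * omegaPoly (s + 1)).coeff j = 0 ∧
    ((j : ℤ) + 1) * j * (reflDenDeriv s).coeff (j + 1) +
      (j + 1) * (Polynomial.X * omegaPoly (s + 1)).coeff (j + 1) +
      (s + 1 - j) * (reflDenDeriv s).coeff j = 0 := by
  rcases lt_trichotomy j (s + 1) with hj | rfl | hj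
  · obtain ⟨h0, h1⟩ := denSlice_descend s j hj
    rw [coeff_X_mul_omegaPoly s _ hj, coeff_X_mul_omegaPoly s _ hj.le, coeff_reflDenDeriv s _ hj,
      coeff_reflDenDeriv s _ hj.le]
    constructor
    · linear_combination (-1) ^ s * h0
    · linear_combination (-1) ^ s * h1
  · rw [coeff_X_mul_omegaPoly_of_lt s _ (Nat.lt_succ_self _),
      coeff_reflDenDeriv_of_lt s _ (Nat.lt_succ_self _)]
    push_cast
    simp
  · rw [coeff_X_mul_omegaPoly_of_lt s _ (by omega), coeff_X_mul_omegaPoly_of_lt s _ (by omega),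
      coeff_reflDenDeriv_of_lt s _ (by omega), coeff_reflDenDeriv_of_lt s _ (by omega)]
    simp

/-- Kummer's equation at R = 0, with one factor w cancelled. -/
theorem ode_omegaPoly (s : ℕ) :
    (Polynomial.X * omegaPoly (s + 1)).derivative.derivative =
      (Polynomial.X * omegaPoly (s + 1)).derivative -
        Polynomial.C ((s : ℤ) + 1) * omegaPoly (s + 1) := by
  ext i
  have h := (ode_coeff s (i + 1)).1
  rw [Polynomial.coeff_sub, Polynomial.coeff_derivative, Polynomial.coeff_derivative,
    Polynomial.coeff_derivative, Polynomial.coeff_C_mul]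
  rw [Polynomial.coeff_X_mul (n := i)] at h ⊢
  push_cast at h ⊢
  linear_combination h

/-- Kummer's equation differentiated in R at R = 0; the extra first derivative comes from the term R
y'. -/
theorem ode_reflDenDeriv (s : ℕ) :
    Polynomial.X * (reflDenDeriv s).derivative.derivative =
      Polynomial.X * (reflDenDeriv s).derivative -
        (Polynomial.X * omegaPoly (s + 1)).derivative -
        Polynomial.C ((s : ℤ) + 1) * reflDenDeriv s := by
  ext i
  have h := (ode_coeff s i).2
  rw [Polynomial.coeff_sub, Polynomial.coeff_sub, Polynomial.coeff_derivative,
    Polynomial.coeff_C_mul]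
  cases i with
  | zero =>
    rw [Polynomial.mul_coeff_zero, Polynomial.mul_coeff_zero]
    simp at h ⊢
    linear_combination h
  | succ i =>
    simp only [Polynomial.coeff_X_mul, Polynomial.coeff_derivative] at h ⊢
    push_cast at h ⊢
    linear_combination h

/-- Hellmann-Feynman type argument: at a positive root of `U`, neither the derivative of `X U`
nor the perturbation `V` vanishes. -/
theorem eval_mul_ne_zero_of_ode {U V : ℝ[X]} {c : ℝ} (hU : U ≠ 0)
    (h1 : (Polynomial.X * U).derivative.derivative = (Polynomial.X * U).derivative -
      Polynomial.C c * U)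
    (h2 : Polynomial.X * V.derivative.derivative = Polynomial.X * V.derivative -
      (Polynomial.X * U).derivative - Polynomial.C c * V)
    {r : ℝ} (hr : 0 < r) (hUr : U.eval r = 0) :
    (Polynomial.X * U).derivative.eval r * V.eval r ≠ 0 := by
  intro h0
  set Y := Polynomial.X * U with hY
  -- The two equations make the Wronskian W of V and Y satisfy W' - W = -U Y', which contains the
  -- indefinite term -X U U'. The correction X U² / 2 cancels it and leaves -U² (1 + X) / 2, of
  -- constant sign on the positive axis.
  set p := V.derivative * Y - Y.derivative * V + Polynomial.C (1 / 2) * Polynomial.X * U ^ 2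
    with hp
  have hdY : Y.derivative = U + Polynomial.X * U.derivative := by simp [hY]
  have hhalf : Polynomial.C (1 / 2 : ℝ) * 2 = 1 := by
    rw [← Polynomial.C_ofNat, ← Polynomial.C_mul]; norm_num
  have hdp : p.derivative - p = -(Polynomial.C (1 / 2) * U ^ 2 * (1 + Polynomial.X)) := by
    have : p.derivative = V.derivative.derivative * Y - Y.derivative.derivative * V +
        Polynomial.C (1 / 2) * U ^ 2 + Polynomial.X * U * U.derivative := by
      rw [hp]
      simp only [Polynomial.derivative_add, Polynomial.derivative_sub, Polynomial.derivative_mul,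
        Polynomial.derivative_C, Polynomial.derivative_X, Polynomial.derivative_pow]
      simp only [Nat.cast_ofNat, Nat.add_one_sub_one, pow_one, map_ofNat]
      linear_combination (Polynomial.X * U * U.derivative) * hhalf
    rw [this, hp]
    linear_combination U * h2 - V * h1 + (V.derivative.derivative - V.derivative) * hY -
      U * hdY + U ^ 2 * hhalf
  have hg : ∀ x, HasDerivAt (fun x => p.eval x / Real.exp x)
      ((p.derivative - p).eval x / Real.exp x) x := by
    intro x
    refine ((p.hasDerivAt x).div (Real.hasDerivAt_exp x) (Real.exp_pos x).ne').congr_deriv ?_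
    rw [Polynomial.eval_sub]
    field_simp
  -- The derivative of p / exp is (p' - p) / exp, so the sign just found gives monotonicity.
  have hanti : AntitoneOn (fun x => p.eval x / Real.exp x) (Set.Ici r) := by
    refine antitoneOn_of_deriv_nonpos (convex_Ici r)
      (fun x _ => (hg x).continuousAt.continuousWithinAt)
      (fun x _ => (hg x).differentiableAt.differentiableWithinAt) fun x hx => ?_
    rw [interior_Ici] at hx
    have hx0 : 0 < x := hr.trans hx
    rw [(hg x).deriv, hdp]
    refine div_nonpos_of_nonpos_of_nonneg ?_ (Real.exp_pos x).le
    simp only [Polynomial.eval_neg, Polynomial.eval_mul, Polynomial.eval_C, Polynomial.eval_pow,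
      Polynomial.eval_add, Polynomial.eval_one, Polynomial.eval_X, neg_nonpos]
    positivity
  have hpr : p.eval r = 0 := by
    rw [hp]
    simp [hUr, hY] at h0 ⊢
    tauto
  have hlim := Polynomial.tendsto_div_exp_atTop p
  -- The quotient decreases from 0 at r, by the assumed vanishing, to the limit 0 at infinity; hence
  -- it is constantly 0 in between.
  have hzero : ∀ x ∈ Set.Ici r, p.eval x = 0 := by
    intro x hx
    have hle : p.eval x / Real.exp x ≤ 0 := by
      simpa [hpr] using hanti (Set.mem_Ici.2 le_rfl) hx hx
    have hge : 0 ≤ p.eval x / Real.exp x := by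
      refine le_of_tendsto hlim (Filter.eventually_atTop.2 ⟨x, fun y hy => ?_⟩)
      exact hanti hx (Set.mem_Ici.2 (le_trans hx hy)) hy
    have := le_antisymm hle hge
    simpa [Real.exp_ne_zero] using this
  have hp0 : p = 0 := Polynomial.eq_zero_of_infinite_isRoot p
    ((Set.Ici_infinite r).mono fun x hx => hzero x hx)
  rw [hp0] at hdp
  simp only [Polynomial.derivative_zero, sub_zero] at hdp
  have hX : (1 + Polynomial.X : ℝ[X]) ≠ 0 := by
    intro h
    simpa using congrArg (Polynomial.eval 0) h
  have hC : Polynomial.C (1 / 2 : ℝ) ≠ 0 := by simp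
  exact neg_ne_zero.2 (mul_ne_zero (mul_ne_zero hC (pow_ne_zero 2 hU)) hX) hdp.symm

theorem aeval_reflDenDeriv {K : Type*} [Field K] {w : K} (hw : w ≠ 0) (s : ℕ) :
    Polynomial.aeval w (reflDenDeriv s) =
      (-1) ^ s * (w ^ (s + 1) * Polynomial.aeval w⁻¹ (denSlice (s + 1) 1)) := by
  let _ := invertibleOfNonzero (inv_ne_zero hw)
  have := Polynomial.eval₂_reflect_mul_pow (algebraMap ℤ K) w⁻¹ (s + 1) (denSlice (s + 1) 1)
    (natDegree_denSlice_le _ _)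
  rw [← Polynomial.aeval_def, ← Polynomial.aeval_def, invOf_eq_inv, inv_inv] at this
  rw [← this, reflDenDeriv, map_mul, map_pow, map_neg, map_one, inv_pow, mul_comm (w ^ (s + 1)),
    inv_mul_cancel_right₀ (pow_ne_zero _ hw)]

theorem omegaPoly_ne_zero (s : ℕ) : omegaPoly (s + 1) ≠ 0 := fun h =>
  aeval_omegaPoly_zero_ne (K := ℂ) s (by rw [h, map_zero])

/-- Every root is a positive real r, where (X U)'(r) = r U'(r) and V(r) is a nonzero multiple of the
R-linear denominator at 1/r. The non-vanishing of the product therefore gives both claims at once.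
-/
theorem aeval_omegaPoly_root {s : ℕ} {w : ℂ} (hw : Polynomial.aeval w (omegaPoly (s + 1)) = 0) :
    Polynomial.aeval w (omegaPoly (s + 1)).derivative ≠ 0 ∧
      Polynomial.aeval w⁻¹ (denSlice (s + 1) 1) ≠ 0 := by
  obtain ⟨r, hr, rfl, hr0⟩ := exists_pos_of_aeval_omegaPoly_eq_zero hw
  have hc : ∀ p : ℤ[X], Polynomial.aeval (r : ℂ) p = (Polynomial.aeval r p : ℝ) := fun p =>
    Polynomial.aeval_algebraMap_apply ℂ r p
  have key := eval_mul_ne_zero_of_ode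
    (U := (omegaPoly (s + 1)).map (algebraMap ℤ ℝ)) (V := (reflDenDeriv s).map (algebraMap ℤ ℝ))
    (c := (s : ℝ) + 1) ?_ ?_ ?_ hr ?_
  · rw [← Polynomial.map_X (algebraMap ℤ ℝ), ← Polynomial.map_mul, Polynomial.derivative_map,
      Polynomial.eval_map, Polynomial.eval_map, ← Polynomial.aeval_def, ← Polynomial.aeval_def,
      Polynomial.derivative_mul, Polynomial.derivative_X, map_add, one_mul, map_mul, hr0,
      zero_add] at key
    constructor
    · intro h
      rw [hc] at h
      exact key (by rw [Complex.ofReal_eq_zero.1 h]; simp)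
    · intro h
      have h2 := aeval_reflDenDeriv (w := (r : ℂ)) (by simpa using hr.ne') s
      rw [h, mul_zero, mul_zero, hc] at h2
      exact key (by rw [Complex.ofReal_eq_zero.1 h2]; simp)
  · exact (Polynomial.map_ne_zero_iff (algebraMap ℤ ℝ).injective_int).2 (omegaPoly_ne_zero s)
  · have := congrArg (Polynomial.map (algebraMap ℤ ℝ)) (ode_omegaPoly s)
    simpa [Polynomial.derivative_map] using this
  · have := congrArg (Polynomial.map (algebraMap ℤ ℝ)) (ode_reflDenDeriv s)
    simpa [Polynomial.derivative_map] using this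
  · rw [Polynomial.eval_map, ← Polynomial.aeval_def, hr0]

theorem aeval_denSlice_zero_of_root {s : ℕ} {w : ℂ}
    (hw : Polynomial.aeval w (omegaPoly (s + 1)) = 0) :
    w ≠ 0 ∧ Polynomial.aeval w⁻¹ (denSlice (s + 1) 0) = 0 := by
  have hw0 : w ≠ 0 := fun h => aeval_omegaPoly_zero_ne s (h ▸ hw)
  refine ⟨hw0, ?_⟩
  rw [aeval_omegaPoly hw0] at hw
  simpa [hw0] using hw

/-- At the inverse of a root the R-linear part of the determinant formula keeps only the term with
this factor, while its right side is a nonzero multiple of a power of 1/w. -/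
theorem aeval_numSlice_sub_root {s : ℕ} (hs : 1 ≤ s) {w : ℂ}
    (hw : Polynomial.aeval w (omegaPoly (s + 1)) = 0) :
    Polynomial.aeval w⁻¹ (numSlice (s + 1) 1 - denSlice (s + 1) 1) ≠ 0 := by
  obtain ⟨hw0, hD⟩ := aeval_denSlice_zero_of_root hw
  intro h
  have key := congrArg (Polynomial.aeval w⁻¹) (numSlice_one_sub_denSlice_one hs)
  rw [map_sub, map_mul, map_mul, h, hD] at key
  simp [hw0, Nat.factorial_ne_zero] at key

/-! ### Partial fractions and exponential polynomials -/

section QuasiPolynomials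

/-- The polynomial `n ↦ C(n + t, t)`. -/
noncomputable def binPoly (t : ℕ) : ℂ[X] :=
  Polynomial.C ((t.factorial : ℂ)⁻¹) * (ascPochhammer ℂ t).comp (Polynomial.X + Polynomial.C 1)

theorem eval_binPoly (t n : ℕ) : (binPoly t).eval (n : ℂ) = ((n + t).choose t : ℂ) := by
  have h := ascPochhammer_nat_eq_natCast_ascFactorial ℂ (n + 1) t
  rw [Nat.ascFactorial_eq_factorial_mul_choose] at h
  rw [binPoly, Polynomial.eval_mul, Polynomial.eval_C, Polynomial.eval_comp]
  simp only [Polynomial.eval_add, Polynomial.eval_X, Polynomial.eval_C]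
  push_cast at h
  rw [h, inv_mul_cancel_left₀ (by exact_mod_cast t.factorial_ne_zero)]

theorem natDegree_binPoly (t : ℕ) : (binPoly t).natDegree = t := by
  rw [binPoly, Polynomial.natDegree_C_mul (by simpa using t.factorial_ne_zero),
    Polynomial.natDegree_comp, ascPochhammer_natDegree, Polynomial.natDegree_X_add_C, mul_one]

theorem coeff_binPoly_ne_zero (t : ℕ) : (binPoly t).coeff t ≠ 0 := by
  have h : binPoly t ≠ 0 := fun h => by
    have := eval_binPoly t 0
    rw [h] at this
    simp at this
  have := Polynomial.leadingCoeff_ne_zero.2 h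
  rwa [Polynomial.leadingCoeff, natDegree_binPoly] at this

/-- The inverse of `X - ω⁻¹`. -/
noncomputable def invXSub (ω : ℂ) : ℂ⟦X⟧ := PowerSeries.C (-ω) * PowerSeries.mk fun n => ω ^ n

theorem invXSub_mul {ω : ℂ} (hω : ω ≠ 0) :
    invXSub ω * ((Polynomial.X - Polynomial.C ω⁻¹ : ℂ[X]) : ℂ⟦X⟧) = 1 := by
  rw [invXSub, mul_assoc]
  ext n
  rw [Polynomial.coe_sub, Polynomial.coe_X, Polynomial.coe_C, PowerSeries.coeff_C_mul, mul_sub,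
    map_sub, PowerSeries.coeff_mul_C, PowerSeries.coeff_one]
  cases n with
  | zero => simp [hω]
  | succ n =>
    rw [PowerSeries.coeff_succ_mul_X]
    simp only [PowerSeries.coeff_mk, pow_succ]
    field_simp
    simp

theorem coeff_invXSub_pow (ω : ℂ) (t n : ℕ) : PowerSeries.coeff n (invXSub ω ^ (t + 1)) =
    (-ω) ^ (t + 1) * ((binPoly t).eval (n : ℂ) * ω ^ n) := by
  have h : (PowerSeries.mk fun n => ω ^ n) = PowerSeries.rescale ω (PowerSeries.mk 1) := by
    ext n
    simp
  rw [invXSub, h, mul_pow, ← map_pow, ← map_pow, PowerSeries.mk_one_pow_eq_mk_choose_add,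
    PowerSeries.coeff_C_mul, PowerSeries.coeff_rescale, PowerSeries.coeff_mk, eval_binPoly,
    add_comm n t]
  ring

/-- Partial fractions: a pole of order t + 1 at 1/ω contributes a polynomial of degree t in n times
ω^n, and the polynomial part affects only the indices n ≤ d. The degree is maximal where the
numerator does not cancel the pole of full order m. -/
theorem exists_quasiPolynomial {ι : Type*} [Fintype ι] [DecidableEq ι] {ω : ι → ℂ}
    (hinj : Function.Injective ω) (h0 : ∀ i, ω i ≠ 0) {m d : ℕ} (hm : 1 ≤ m) {f : ℂ⟦X⟧} {N : ℂ[X]}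
    (hN : ((∏ i, (Polynomial.X - Polynomial.C (ω i)⁻¹) ^ m : ℂ[X]) : ℂ⟦X⟧) * f = (N : ℂ⟦X⟧))
    (hdeg : N.natDegree ≤ d + m * Fintype.card ι) :
    ∃ q : ι → ℂ[X], (∀ i, (q i).natDegree ≤ m - 1) ∧
      (∀ i, N.eval (ω i)⁻¹ ≠ 0 → (q i).degree = ((m - 1 : ℕ) : WithBot ℕ)) ∧
      ∀ n, d < n → PowerSeries.coeff n f = ∑ i, (q i).eval (n : ℂ) * ω i ^ n := by
  have hm0 : ¬m = 0 := by omega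
  set g : ι → ℂ[X] := fun i => Polynomial.X - Polynomial.C (ω i)⁻¹ with hg
  have hmon : ∀ i ∈ Finset.univ, (g i).Monic := fun i _ => Polynomial.monic_X_sub_C _
  obtain ⟨Q, r, hr, hNr⟩ := Polynomial.eq_quo_mul_prod_pow_add_sum_rem_mul_prod_pow N hmon
    (fun i _ j _ hij => Polynomial.pairwise_coprime_X_sub_C
      (inv_injective.comp hinj) hij) (fun _ => m)
  have hrC : ∀ i j, r i j = Polynomial.C ((r i j).coeff 0) := fun i j =>
    Polynomial.eq_C_of_degree_le_zero (Nat.WithBot.lt_one_iff_le_zero.1 (by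
      simpa [hg, Polynomial.degree_X_sub_C] using hr i (Finset.mem_univ i) j))
  set ρ : ι → Fin m → ℂ := fun i j => (r i j).coeff 0 with hρ
  have hgdeg : ∀ i, (g i).natDegree = 1 := fun i => Polynomial.natDegree_X_sub_C _
  have hPmon : (∏ i, g i ^ m).Monic := Polynomial.monic_prod_of_monic _ _ fun i hi =>
    (hmon i hi).pow m
  have hPdeg : (∏ i, g i ^ m).natDegree = m * Fintype.card ι := by
    rw [Polynomial.natDegree_prod_of_monic _ _ fun i hi => (hmon i hi).pow m]
    simp [hgdeg, Polynomial.natDegree_pow, mul_comm]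
  -- The product of the linear factors is monic, so a quotient of larger degree would raise the
  -- degree of N above the assumed bound.
  have hQ : Q.natDegree ≤ d := by
    have hsum : (∑ i, ∑ j, r i j * g i ^ (j : ℕ) * ∏ k ∈ Finset.univ.erase i, g k ^ m).natDegree ≤
        m * Fintype.card ι := by
      refine Polynomial.natDegree_sum_le_of_forall_le _ _ fun i hi =>
        Polynomial.natDegree_sum_le_of_forall_le _ _ fun j _ => ?_
      refine Polynomial.natDegree_mul_le.trans ?_
      have h1 : (r i j * g i ^ (j : ℕ)).natDegree ≤ m := by
        refine Polynomial.natDegree_mul_le.trans ?_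
        rw [hrC, Polynomial.natDegree_C, Polynomial.natDegree_pow, hgdeg]
        omega
      have h2 : (∏ k ∈ Finset.univ.erase i, g k ^ m).natDegree = m * (Fintype.card ι - 1) := by
        rw [Polynomial.natDegree_prod_of_monic _ _ fun i _ => (hmon i (Finset.mem_univ i)).pow m]
        simp [hgdeg, Polynomial.natDegree_pow, mul_comm, Finset.card_erase_of_mem]
      rw [h2]
      have : 1 ≤ Fintype.card ι := Fintype.card_pos_iff.2 ⟨i⟩
      obtain ⟨c, hc⟩ : ∃ c, Fintype.card ι = c + 1 := ⟨Fintype.card ι - 1, by omega⟩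
      rw [hc, Nat.add_sub_cancel, mul_add, mul_one]
      omega
    by_contra hlt
    have hQ0 : Q ≠ 0 := fun h => hlt (by simp [h])
    have h1 : (Q * ∏ i, g i ^ m).natDegree = Q.natDegree + m * Fintype.card ι := by
      rw [mul_comm, hPmon.natDegree_mul' hQ0, hPdeg, add_comm]
    have h2 : Q * ∏ i, g i ^ m = N - ∑ i, ∑ j, r i j * g i ^ (j : ℕ) *
        ∏ k ∈ Finset.univ.erase i, g k ^ m := by
      rw [eq_sub_iff_add_eq]
      exact hNr.symm
    have h3 := Polynomial.natDegree_sub_le N (∑ i, ∑ j, r i j * g i ^ (j : ℕ) *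
        ∏ k ∈ Finset.univ.erase i, g k ^ m)
    rw [← h2, h1] at h3
    have := h3.trans (max_le hdeg (hsum.trans (by omega)))
    omega
  have hf : f = (Q : ℂ⟦X⟧) + ∑ i, ∑ j : Fin m, PowerSeries.C (ρ i j) *
      invXSub (ω i) ^ (m - (j : ℕ) - 1 + 1) := by
    have hP0 : ((∏ i, g i ^ m : ℂ[X]) : ℂ⟦X⟧) ≠ 0 := fun h =>
      hPmon.ne_zero (Polynomial.coe_injective ℂ (by rw [h, Polynomial.coe_zero]))
    refine mul_left_cancel₀ hP0 ?_
    rw [hN, hNr, Polynomial.coe_add, Polynomial.coe_mul, mul_add, mul_comm (Q : ℂ⟦X⟧)]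
    congr 1
    simp only [coe_polynomial_sum, Finset.mul_sum]
    refine Finset.sum_congr rfl fun i _ => Finset.sum_congr rfl fun j _ => ?_
    rw [← Finset.mul_prod_erase Finset.univ (fun k => g k ^ m) (Finset.mem_univ i)]
    simp only [Polynomial.coe_mul, Polynomial.coe_pow]
    rw [hrC i j, Polynomial.coe_C]
    have h1 := invXSub_mul (h0 i)
    have h2 : (g i : ℂ⟦X⟧) ^ m * invXSub (ω i) ^ (m - (j : ℕ) - 1 + 1) = (g i : ℂ⟦X⟧) ^ (j : ℕ) := by
      have hj := j.2
      rw [show m - (j : ℕ) - 1 + 1 = m - j by omega]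
      nth_rewrite 1 [show m = j + (m - j) by omega]
      rw [pow_add, mul_assoc, ← mul_pow, mul_comm _ (invXSub _), h1, one_pow, mul_one]
    rw [← h2]
    ring
  refine ⟨fun i => ∑ j : Fin m, Polynomial.C (ρ i j * (-ω i) ^ (m - (j : ℕ) - 1 + 1)) *
    binPoly (m - (j : ℕ) - 1), ?_, ?_, ?_⟩
  · intro i
    refine Polynomial.natDegree_sum_le_of_forall_le _ _ fun j _ => ?_
    refine (Polynomial.natDegree_C_mul_le _ _).trans ?_
    rw [natDegree_binPoly]
    omega
  · intro i hi
    refine Polynomial.degree_eq_of_le_of_coeff_ne_zero ?_ ?_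
    · refine Polynomial.degree_le_of_natDegree_le
        (Polynomial.natDegree_sum_le_of_forall_le _ _ fun j _ => ?_)
      refine (Polynomial.natDegree_C_mul_le _ _).trans ?_
      rw [natDegree_binPoly]
      omega
    -- The index j = 0 belongs to the pole of full order m; it is the only summand that reaches
    -- degree m - 1.
    · rw [Polynomial.finsetSum_coeff, Finset.sum_eq_single (⟨0, hm⟩ : Fin m)]
      · rw [Polynomial.coeff_C_mul]
        refine mul_ne_zero (mul_ne_zero ?_ (pow_ne_zero _ (neg_ne_zero.2 (h0 i))))
          (coeff_binPoly_ne_zero _)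
        intro hz
        -- If that coefficient vanished, evaluating the decomposition at 1/ω_i would kill every
        -- term, and N with it.
        refine hi ?_
        have hgi : (g i).eval (ω i)⁻¹ = 0 := by simp [hg]
        rw [hNr, Polynomial.eval_add, Polynomial.eval_mul, Polynomial.eval_prod,
          Finset.prod_eq_zero (Finset.mem_univ i) (by simp [hgi, hm0]), mul_zero,
          zero_add, Polynomial.eval_finsetSum]
        refine Finset.sum_eq_zero fun k _ => ?_
        rw [Polynomial.eval_finsetSum]
        refine Finset.sum_eq_zero fun j _ => ?_
        rw [Polynomial.eval_mul, Polynomial.eval_prod]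
        by_cases hk : k = i
        · subst hk
          by_cases hj : j = ⟨0, hm⟩
          · subst hj
            have : r k ⟨0, hm⟩ = 0 := by rw [hrC, ← Polynomial.C_0]; exact congrArg _ hz
            simp [this]
          · have : (j : ℕ) ≠ 0 := fun h => hj (Fin.ext h)
            simp [hgi, this]
        · rw [Finset.prod_eq_zero (Finset.mem_erase.2 ⟨Ne.symm hk, Finset.mem_univ i⟩)
            (by simp [hgi, hm0]), mul_zero]
      · intro j _ hj
        have : (j : ℕ) ≠ 0 := fun h => hj (Fin.ext h)
        have hj2 := j.2
        rw [Polynomial.coeff_C_mul, Polynomial.coeff_eq_zero_of_natDegree_lt, mul_zero]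
        rw [natDegree_binPoly]
        omega
      · simp
  · intro n hn
    rw [hf, map_add, Polynomial.coeff_coe,
      Polynomial.coeff_eq_zero_of_natDegree_lt (hQ.trans_lt hn), zero_add, map_sum]
    refine Finset.sum_congr rfl fun i _ => ?_
    rw [map_sum, Polynomial.eval_finsetSum, Finset.sum_mul]
    refine Finset.sum_congr rfl fun j _ => ?_
    rw [PowerSeries.coeff_C_mul, coeff_invXSub_pow, Polynomial.eval_mul, Polynomial.eval_C]
    ring

end QuasiPolynomials

theorem exists_omegaPoly_roots (s : ℕ) : ∃ ω : Fin s → ℂ, Function.Injective ω ∧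
    Set.range ω = {w : ℂ | Polynomial.aeval w (omegaPoly (s + 1)) = 0} := by
  set p := (omegaPoly (s + 1)).map (algebraMap ℤ ℂ) with hp
  have hp0 : p ≠ 0 :=
    (Polynomial.map_ne_zero_iff (algebraMap ℤ ℂ).injective_int).2 (omegaPoly_ne_zero s)
  have hroot : ∀ w, p.IsRoot w ↔ Polynomial.aeval w (omegaPoly (s + 1)) = 0 := fun w => by
    rw [Polynomial.IsRoot, hp, Polynomial.eval_map, Polynomial.aeval_def]
  have hnodup : p.roots.Nodup := by
    rw [Multiset.nodup_iff_count_le_one]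
    intro w
    rw [Polynomial.count_roots]
    by_contra hlt
    obtain ⟨h1, h2⟩ := (Polynomial.one_lt_rootMultiplicity_iff_isRoot hp0).1 (not_le.1 hlt)
    refine (aeval_omegaPoly_root ((hroot w).1 h1)).1 ?_
    rw [Polynomial.IsRoot, hp, Polynomial.derivative_map, Polynomial.eval_map] at h2
    rwa [Polynomial.aeval_def]
  have hcard : p.roots.toFinset.card = s := by
    rw [Multiset.toFinset_card_of_nodup hnodup, IsAlgClosed.card_roots_eq_natDegree, hp,
      Polynomial.natDegree_map_eq_of_injective (algebraMap ℤ ℂ).injective_int, natDegree_omegaPoly]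
  have e := (Finset.equivFinOfCardEq hcard).symm
  refine ⟨fun i => e i, Subtype.val_injective.comp e.injective, ?_⟩
  ext w
  constructor
  · rintro ⟨i, rfl⟩
    have := (e i).2
    rw [Multiset.mem_toFinset, Polynomial.mem_roots hp0] at this
    exact (hroot _).1 this
  · intro hw
    have hw' : w ∈ p.roots.toFinset := by
      rw [Multiset.mem_toFinset, Polynomial.mem_roots hp0]
      exact (hroot w).2 hw
    exact ⟨e.symm ⟨w, hw'⟩, by simp⟩

/-- The s distinct linear factors are coprime, so their product divides a nonzero polynomial of
degree at most s; the cofactor has to be constant. -/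
theorem map_denSlice_zero {s : ℕ} {ω : Fin s → ℂ} (hinj : Function.Injective ω)
    (hω : Set.range ω = {w : ℂ | Polynomial.aeval w (omegaPoly (s + 1)) = 0}) :
    ∃ c : ℂ, c ≠ 0 ∧ (denSlice (s + 1) 0).map (algebraMap ℤ ℂ) =
      Polynomial.C c * ∏ i, (Polynomial.X - Polynomial.C (ω i)⁻¹) := by
  have hroot : ∀ i, Polynomial.aeval (ω i) (omegaPoly (s + 1)) = 0 := fun i =>
    hω.subset (Set.mem_range_self i)
  set D := (denSlice (s + 1) 0).map (algebraMap ℤ ℂ) with hD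
  have hdvd : ∏ i, (Polynomial.X - Polynomial.C (ω i)⁻¹) ∣ D := by
    refine Finset.prod_dvd_of_coprime (fun i _ j _ hij => Polynomial.pairwise_coprime_X_sub_C
      (inv_injective.comp hinj) hij) fun i _ => ?_
    rw [Polynomial.dvd_iff_isRoot, Polynomial.IsRoot, hD, Polynomial.eval_map,
      ← Polynomial.aeval_def]
    exact (aeval_denSlice_zero_of_root (hroot i)).2
  obtain ⟨E, hE⟩ := hdvd
  have hD0 : D.coeff 0 = 1 := by
    rw [hD, Polynomial.coeff_map, denSlice_zero_eq_convQ, coeff_zero_convQ, map_one]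
  have hE0 : E ≠ 0 := fun h => by
    rw [h, mul_zero] at hE
    simp [hE] at hD0
  have hmon : (∏ i, (Polynomial.X - Polynomial.C (ω i)⁻¹)).Monic :=
    Polynomial.monic_prod_of_monic _ _ fun i _ => Polynomial.monic_X_sub_C _
  have hdeg : D.natDegree = s + E.natDegree := by
    rw [hE, hmon.natDegree_mul' hE0,
      Polynomial.natDegree_prod_of_monic _ _ fun i _ => Polynomial.monic_X_sub_C _]
    simp
  have hle : D.natDegree ≤ s := Polynomial.natDegree_map_le.trans (natDegree_denSlice_zero_le s)
  have hEC := Polynomial.eq_C_of_natDegree_eq_zero (by omega : E.natDegree = 0)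
  refine ⟨E.coeff 0, fun h => hE0 (by rw [hEC, h, Polynomial.C_0]), ?_⟩
  rw [← hEC, hE, mul_comm]

/-- Exactness of the degree needs N_m nonzero at each inverse root. This propagates from N_1 through
N_(m+1) ≡ -Q_1 N_m modulo D, as Q_1 does not vanish there either. -/
theorem exists_quasiPolynomial_stirlingConv {s : ℕ} (hs : 1 ≤ s) {ω : Fin s → ℂ}
    (hinj : Function.Injective ω)
    (hω : Set.range ω = {w : ℂ | Polynomial.aeval w (omegaPoly (s + 1)) = 0}) {m : ℕ}
    (hm : 1 ≤ m) : ∃ q : Fin s → ℂ[X], (∀ i, (q i).degree = ((m - 1 : ℕ) : WithBot ℕ)) ∧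
      ∀ n : ℕ, m < n → (stirlingConv (s + 1) n m : ℂ) = ∑ i, (q i).eval (n : ℂ) * ω i ^ n := by
  obtain ⟨c, hc, hD⟩ := map_denSlice_zero hinj hω
  obtain ⟨N, hN, hN1, hNr⟩ := exists_numerator s
  have hroot : ∀ i, Polynomial.aeval (ω i) (omegaPoly (s + 1)) = 0 := fun i =>
    hω.subset (Set.mem_range_self i)
  have hNne : ∀ i m, 1 ≤ m → Polynomial.aeval (ω i)⁻¹ (N m) ≠ 0 := by
    intro i m hm
    induction m, hm using Nat.le_induction with
    | base => rw [hN1]; exact aeval_numSlice_sub_root hs (hroot i)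
    | succ m hm ih =>
      obtain ⟨k, hk⟩ := hNr m hm
      have := congrArg (Polynomial.aeval (ω i)⁻¹) hk
      rw [map_mul, (aeval_denSlice_zero_of_root (hroot i)).2, zero_mul, map_add, map_mul] at this
      intro h
      rw [h, zero_add] at this
      exact mul_ne_zero (aeval_omegaPoly_root (hroot i)).2 ih this
  obtain ⟨h1, h2⟩ := hN m hm
  have h3 := congrArg (PowerSeries.map (algebraMap ℤ ℂ)) h1
  rw [map_mul, map_pow, ← Polynomial.polynomial_map_coe, ← Polynomial.polynomial_map_coe, hD] at h3
  have h4 : ((∏ i, (Polynomial.X - Polynomial.C (ω i)⁻¹) ^ m : ℂ[X]) : ℂ⟦X⟧) *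
      (convSlice (s + 1) m).map (algebraMap ℤ ℂ) =
      (Polynomial.C (c⁻¹ ^ m) * (N m).map (algebraMap ℤ ℂ) : ℂ[X]) := by
    rw [Polynomial.coe_mul, ← h3, Finset.prod_pow, Polynomial.coe_pow, Polynomial.coe_mul, mul_pow,
      Polynomial.coe_C, Polynomial.coe_C, ← map_pow, ← mul_assoc, ← mul_assoc, ← map_mul,
      ← mul_pow, inv_mul_cancel₀ hc, one_pow, map_one, one_mul]
  have h5 : (Polynomial.C (c⁻¹ ^ m) * (N m).map (algebraMap ℤ ℂ)).natDegree ≤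
      m + m * Fintype.card (Fin s) := by
    refine (Polynomial.natDegree_C_mul_le _ _).trans (Polynomial.natDegree_map_le.trans
      (h2.trans ?_))
    rw [Fintype.card_fin, mul_add, mul_one, add_comm]
  obtain ⟨q, -, hq, hqn⟩ := exists_quasiPolynomial hinj
    (fun i => (aeval_denSlice_zero_of_root (hroot i)).1) hm h4 h5
  refine ⟨q, fun i => hq i ?_, fun n hn => ?_⟩
  · rw [Polynomial.eval_mul, Polynomial.eval_C, Polynomial.eval_map, ← Polynomial.aeval_def]
    exact mul_ne_zero (pow_ne_zero _ (inv_ne_zero hc)) (hNne i m hm)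
  · rw [← hqn n hn, PowerSeries.coeff_map, convSlice, PowerSeries.coeff_mk, eq_intCast]

/-! ### Evaluation of the convergents by integer lists -/

/-- The coefficient of `z^n` in `Conv_h(1, R; z)`. -/
noncomputable def convRow (h n : ℕ) : ℤ[X] :=
  PowerSeries.coeff n (convGF (1 : ℤ[X]) Polynomial.X h)

theorem stirlingConv_eq (h n m : ℕ) : stirlingConv h n m = (convRow h n).coeff m := by
  rw [stirlingConv, convCoeff, convRow, Polynomial.C_1]

/-- From index h on the numerator FP_h contributes nothing, so FQ_h alone drives the sequence. -/
theorem convRow_rec (h n : ℕ) : convRow h (n + h) = -∑ i ∈ Finset.range h,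
    (h.choose (i + 1) : ℤ[X]) * genProd 1 (1 - (h : ℤ[X]) - Polynomial.X) (i + 1) *
      convRow h (n + h - 1 - i) := by
  have key := sum_coeff_convQ_mul_coeff_convGF (1 : ℤ[X]) Polynomial.X h (n + h)
  rw [coeff_convP_of_le _ _ _ _ (Nat.le_add_left _ _), Finset.sum_range_succ',
    coeff_zero_convQ, one_mul, Nat.sub_zero] at key
  have hsub : ∑ k ∈ Finset.range h, (convQ (1 : ℤ[X]) Polynomial.X h).coeff (k + 1) *
      PowerSeries.coeff (n + h - (k + 1)) (convGF (1 : ℤ[X]) Polynomial.X h) =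
      ∑ k ∈ Finset.range (n + h), (convQ (1 : ℤ[X]) Polynomial.X h).coeff (k + 1) *
      PowerSeries.coeff (n + h - (k + 1)) (convGF (1 : ℤ[X]) Polynomial.X h) := by
    refine Finset.sum_subset (Finset.range_mono (Nat.le_add_left _ _)) fun k _ hk => ?_
    rw [coeff_convQ, Nat.choose_eq_zero_of_lt (by simpa using hk)]
    simp
  rw [← hsub] at key
  rw [convRow, eq_neg_iff_add_eq_zero, add_comm, ← key]
  congr 1
  refine Finset.sum_congr rfl fun i _ => ?_
  rw [coeff_convQ, mul_one, convRow, Nat.sub_sub, add_comm 1 i]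

theorem convRow_zero {h : ℕ} (hh : 1 ≤ h) : convRow h 0 = 1 := by
  rw [convRow, ← genProd_eq_coeff_convGF _ _ (by omega), genProd_zero]

theorem convRow_succ {h n : ℕ} (hn : n + 1 < h) :
    convRow h (n + 1) = (Polynomial.C (n : ℤ) + Polynomial.X) * convRow h n := by
  rw [convRow, convRow, ← genProd_eq_coeff_convGF _ _ (by omega),
    ← genProd_eq_coeff_convGF _ _ (by omega), genProd_succ, mul_comm, mul_one,
    map_natCast, add_comm Polynomial.X]

/-- Strict evaluation of an integer. -/
def forceInt {β : Type} (x : ℤ) (k : ℤ → β) : β :=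
  match x with
  | Int.ofNat 0 => k (Int.ofNat 0)
  | Int.ofNat (Nat.succ n) => k (Int.ofNat (Nat.succ n))
  | Int.negSucc 0 => k (Int.negSucc 0)
  | Int.negSucc (Nat.succ n) => k (Int.negSucc (Nat.succ n))

/-- The case split makes evaluation reduce `x` before continuing; it leaves the value unchanged, so
proofs can erase it. -/
theorem forceInt_eq {β : Type} (x : ℤ) (k : ℤ → β) : forceInt x k = k x := by
  unfold forceInt
  split <;> rfl

/-- Strict evaluation of a list of integers. -/
def forceList {β : Type} : List ℤ → (List ℤ → β) → β
  | [], k => k []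
  | x :: l, k => forceInt x fun x => forceList l fun l => k (x :: l)

theorem forceList_eq {β : Type} (l : List ℤ) (k : List ℤ → β) : forceList l k = k l := by
  induction l generalizing k with
  | nil => rfl
  | cons x l ih => rw [forceList, forceInt_eq, ih]

/-- The coefficients of `p` from `k` to `k + M - 1`. -/
noncomputable def coeffsFrom (p : ℤ[X]) : ℕ → ℕ → List ℤ
  | _, 0 => []
  | k, M + 1 => p.coeff k :: coeffsFrom p (k + 1) M

/-- The coefficients of `(c - X) * p`, where `prev` is the coefficient of `p` before the list. -/
def mulLin (c : ℤ) : ℤ → List ℤ → List ℤ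
  | _, [] => []
  | prev, a :: l => (c * a - prev) :: mulLin c a l

/-- The coefficients of `c * p + q`. -/
def mulAdd (c : ℤ) : List ℤ → List ℤ → List ℤ
  | a :: l, b :: l' => (c * a + b) :: mulAdd c l l'
  | _, _ => []

theorem mulLin_coeffsFrom_succ (c : ℤ) (p : ℤ[X]) (k M : ℕ) :
    mulLin c (p.coeff k) (coeffsFrom p (k + 1) M) =
      coeffsFrom ((Polynomial.C c - Polynomial.X) * p) (k + 1) M := by
  induction M generalizing k with
  | zero => rfl
  | succ M ih =>
    rw [coeffsFrom, mulLin, ih, coeffsFrom, sub_mul, Polynomial.coeff_sub, Polynomial.coeff_C_mul,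
      Polynomial.coeff_X_mul]

theorem mulLin_coeffsFrom (c : ℤ) (p : ℤ[X]) (M : ℕ) :
    mulLin c 0 (coeffsFrom p 0 M) = coeffsFrom ((Polynomial.C c - Polynomial.X) * p) 0 M := by
  cases M with
  | zero => rfl
  | succ M =>
    rw [coeffsFrom, mulLin, mulLin_coeffsFrom_succ, coeffsFrom, sub_mul, Polynomial.coeff_sub,
      Polynomial.coeff_C_mul, Polynomial.mul_coeff_zero, Polynomial.coeff_X_zero, zero_mul]

theorem mulAdd_coeffsFrom (c : ℤ) (p q : ℤ[X]) (k M : ℕ) :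
    mulAdd c (coeffsFrom p k M) (coeffsFrom q k M) =
      coeffsFrom (Polynomial.C c * p + q) k M := by
  induction M generalizing k with
  | zero => rfl
  | succ M ih =>
    rw [coeffsFrom, coeffsFrom, mulAdd, ih, coeffsFrom, Polynomial.coeff_add,
      Polynomial.coeff_C_mul]

theorem coeffsFrom_zero (k M : ℕ) : coeffsFrom 0 k M = List.replicate M 0 := by
  induction M generalizing k with
  | zero => rfl
  | succ M ih => rw [coeffsFrom, ih, List.replicate_succ, Polynomial.coeff_zero]

/-- The values `a (n - 1), …, a 0`. -/
def valuesBelow (a : ℕ → ℤ) : ℕ → List ℤ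
  | 0 => []
  | n + 1 => a n :: valuesBelow a n

/-- The polynomial with the given list of coefficients. -/
noncomputable def listPoly : List ℤ → ℤ[X]
  | [] => 0
  | x :: l => Polynomial.C x + Polynomial.X * listPoly l

/-- The dot product of two lists, the longer one truncated. -/
def listDot : List ℤ → List ℤ → ℤ
  | x :: d, a :: l => x * a + listDot d l
  | _, _ => 0

theorem coeff_listPoly (d : List ℤ) (k : ℕ) : (listPoly d).coeff k = d.getD k 0 := by
  induction d generalizing k with
  | nil => simp [listPoly]
  | cons x d ih =>
    rw [listPoly, Polynomial.coeff_add]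
    cases k with
    | zero => simp
    | succ k => rw [Polynomial.coeff_X_mul, ih, Polynomial.coeff_C_succ]; simp

theorem natDegree_listPoly_le (d : List ℤ) {L : ℕ} (hd : d.length ≤ L + 1) :
    (listPoly d).natDegree ≤ L := by
  refine Polynomial.natDegree_le_iff_coeff_eq_zero.2 fun n hn => ?_
  rw [coeff_listPoly, List.getD_eq_default]
  omega

/-- Values are stored newest first, so a coefficient of the Cauchy product is a plain dot product.
-/
theorem coeff_listPoly_mul_mk (d : List ℤ) (a : ℕ → ℤ) (n : ℕ) :
    PowerSeries.coeff n ((listPoly d : ℤ⟦X⟧) * PowerSeries.mk a) =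
      listDot d (valuesBelow a (n + 1)) := by
  induction d generalizing n with
  | nil => simp [listPoly, listDot]
  | cons x d ih =>
    rw [listPoly, Polynomial.coe_add, Polynomial.coe_mul, Polynomial.coe_C, Polynomial.coe_X,
      add_mul, mul_assoc, map_add, PowerSeries.coeff_C_mul, PowerSeries.coeff_mk, valuesBelow,
      listDot]
    congr 1
    cases n with
    | zero => cases d <;> simp [valuesBelow, listDot]
    | succ n => rw [PowerSeries.coeff_succ_X_mul, ih]

/-- The product of the polynomials given by two lists. -/
def listMul : List ℤ → List ℤ → List ℤ
  | [], _ => []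
  | x :: l, l' => forceList (listMul l l') fun m => listAdd (l'.map (x * ·)) (0 :: m)
where
  /-- The sum of the polynomials given by two lists. -/
  listAdd : List ℤ → List ℤ → List ℤ
  | [], l => l
  | l, [] => l
  | x :: l, y :: l' => (x + y) :: listAdd l l'

theorem listPoly_listAdd (l l' : List ℤ) :
    listPoly (listMul.listAdd l l') = listPoly l + listPoly l' := by
  fun_induction listMul.listAdd l l' with
  | case1 => simp [listPoly]
  | case2 => simp [listPoly]
  | case3 x l y l' ih =>
    simp only [listPoly, ih, Polynomial.C_add]
    ring

theorem listPoly_map_mul (x : ℤ) (l : List ℤ) :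
    listPoly (l.map (x * ·)) = Polynomial.C x * listPoly l := by
  induction l with
  | nil => simp [listPoly]
  | cons y l ih =>
    rw [List.map_cons, listPoly, listPoly, ih, Polynomial.C_mul]
    ring

theorem listPoly_listMul (l l' : List ℤ) :
    listPoly (listMul l l') = listPoly l * listPoly l' := by
  induction l with
  | nil => simp [listMul, listPoly]
  | cons x l ih =>
    rw [listMul, forceList_eq, listPoly_listAdd, listPoly_map_mul, listPoly, listPoly, ih]
    simp
    ring

/-- Strict evaluation of a natural number. -/
def forceNat {β : Type} (n : ℕ) (k : ℕ → β) : β :=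
  match n with
  | 0 => k 0
  | Nat.succ n => k (Nat.succ n)

theorem forceNat_eq {β : Type} (n : ℕ) (k : ℕ → β) : forceNat n k = k n := by
  cases n <;> rfl

/-- Strict evaluation of the dot product modulo `P`. -/
def listDotAcc (P : ℤ) : ℤ → List ℤ → List ℤ → ℤ
  | acc, x :: d, a :: l => forceInt ((acc + x * a) % P) fun acc => listDotAcc P acc d l
  | acc, _, _ => acc

/-- Congruence of lists. -/
abbrev ListModEq (P : ℤ) : List ℤ → List ℤ → Prop := List.Forall₂ (Int.ModEq P)

theorem listDotAcc_modEq {P : ℤ} (acc : ℤ) (d : List ℤ) {l l' : List ℤ} (h : ListModEq P l l') :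
    listDotAcc P acc d l ≡ acc + listDot d l' [ZMOD P] := by
  induction d generalizing acc l l' with
  | nil => simp [listDotAcc, listDot]
  | cons x d ih =>
    cases h with
    | nil => simp [listDotAcc, listDot]
    | @cons a b l l' hab hl =>
      rw [listDotAcc, forceInt_eq, listDot, ← add_assoc]
      refine (ih _ hl).trans (Int.ModEq.add_right _ ?_)
      exact (Int.mod_modEq _ _).trans (Int.ModEq.add_left _ (Int.ModEq.mul_left _ hab))

theorem listModEq_map_emod (P : ℤ) {l l' : List ℤ} (h : ListModEq P l l') :
    ListModEq P (l.map (· % P)) l' := by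
  induction h with
  | nil => exact List.Forall₂.nil
  | cons hab _ ih => exact List.Forall₂.cons ((Int.mod_modEq _ _).trans hab) ih

theorem listModEq_mulLin {P : ℤ} (c : ℤ) {x y : ℤ} (hxy : x ≡ y [ZMOD P]) {l l' : List ℤ}
    (h : ListModEq P l l') : ListModEq P (mulLin c x l) (mulLin c y l') := by
  induction h generalizing x y with
  | nil => exact List.Forall₂.nil
  | cons hab _ ih => exact List.Forall₂.cons ((hab.mul_left _).sub hxy) (ih hab)

theorem listModEq_mulAdd {P : ℤ} (c : ℤ) {l l' m m' : List ℤ} (h : ListModEq P l l')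
    (hm : ListModEq P m m') : ListModEq P (mulAdd c l m) (mulAdd c l' m') := by
  induction h generalizing m m' with
  | nil => cases hm <;> exact List.Forall₂.nil
  | cons hab _ ih =>
    cases hm with
    | nil => exact List.Forall₂.nil
    | cons h1 h2 => exact List.Forall₂.cons ((hab.mul_left _).add h1) (ih h2)

theorem ListModEq.refl (P : ℤ) (l : List ℤ) : ListModEq P l l :=
  List.forall₂_refl l

/-- Horner evaluation of the recurrence of the convergents modulo `P`. -/
def hornerRow (P : ℤ) (h M : ℕ) : ℕ → ℕ → List (List ℤ) → List ℤ
  | k + 1, t, r :: rs =>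
      forceList ((mulAdd (h.choose (t + 1)) r (hornerRow P h M k (t + 1) rs)).map (· % P)) fun l =>
        mulLin ((t : ℤ) + 1 - h) 0 l
  | _, _, _ => List.replicate M 0

/-- The rows `n - 1, …, 0`, scaled by `u`. -/
noncomputable def rowsBelow (u : ℤ) (h M : ℕ) : ℕ → List (List ℤ)
  | 0 => []
  | n + 1 => coeffsFrom (Polynomial.C u * convRow h n) 0 M :: rowsBelow u h M n

/-- The products in the recurrence are nested: each extends the previous one by the linear factor t
+ 1 - h - X. Factoring it out at every stage is Horner's scheme; `p` is the tail of the sum with the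
first t factors removed. -/
theorem hornerRow_modEq {P u : ℤ} {h M : ℕ} (k t n : ℕ) (hk : k ≤ n) {rows : List (List ℤ)}
    (hrows : List.Forall₂ (ListModEq P) rows (rowsBelow u h M n)) : ∃ p : ℤ[X],
    ListModEq P (hornerRow P h M k t rows) (coeffsFrom p 0 M) ∧
      genProd 1 (1 - (h : ℤ[X]) - Polynomial.X) t * p = ∑ i ∈ Finset.range k,
        (h.choose (t + i + 1) : ℤ[X]) * genProd 1 (1 - (h : ℤ[X]) - Polynomial.X) (t + i + 1) *
          (Polynomial.C u * convRow h (n - 1 - i)) := by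
  induction k generalizing t n rows with
  | zero =>
    refine ⟨0, ?_, by simp⟩
    rw [hornerRow, coeffsFrom_zero]
    · exact ListModEq.refl _ _
    · simp
  | succ k ih =>
    obtain ⟨n, rfl⟩ : ∃ n', n = n' + 1 := ⟨n - 1, by omega⟩
    rw [rowsBelow] at hrows
    cases hrows with
    | @cons r _ rs _ hr hrs =>
    obtain ⟨p, hp, hp'⟩ := ih (t + 1) n (by omega) hrs
    refine ⟨(Polynomial.C ((t : ℤ) + 1 - h) - Polynomial.X) *
      (Polynomial.C (h.choose (t + 1) : ℤ) * (Polynomial.C u * convRow h n) + p), ?_, ?_⟩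
    · rw [hornerRow, forceList_eq, ← mulLin_coeffsFrom, ← mulAdd_coeffsFrom]
      exact listModEq_mulLin _ rfl (listModEq_map_emod _ (listModEq_mulAdd _ hr hp))
    · have e : genProd 1 (1 - (h : ℤ[X]) - Polynomial.X) t *
          ((Polynomial.C ((t : ℤ) + 1 - h) - Polynomial.X) *
          (Polynomial.C (h.choose (t + 1) : ℤ) * (Polynomial.C u * convRow h n) + p)) =
          genProd 1 (1 - (h : ℤ[X]) - Polynomial.X) (t + 1) *
          ((h.choose (t + 1) : ℤ[X]) * (Polynomial.C u * convRow h n)) +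
          genProd 1 (1 - (h : ℤ[X]) - Polynomial.X) (t + 1) * p := by
        rw [genProd_succ]
        simp only [map_sub, map_add, map_natCast, map_one]
        ring
      rw [e, hp', Finset.sum_range_succ', add_comm]
      congr 1
      · refine Finset.sum_congr rfl fun i _ => ?_
        rw [show t + 1 + i + 1 = t + (i + 1) + 1 by ring,
          show n + 1 - 1 - (i + 1) = n - 1 - i by omega]
      · rw [Nat.add_sub_cancel, Nat.sub_zero, add_zero]
        ring

/-- The row following the rows `n - 1, …, 0`. -/
def nextRow (P : ℤ) (h M n : ℕ) (rows : List (List ℤ)) : List ℤ :=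
  if n < h then
    match rows with
    | [] => []
    | r :: _ => mulAdd (-1) (mulLin (1 - (n : ℤ)) 0 r) (List.replicate M 0)
  else mulAdd (-1) (hornerRow P h M h 0 rows) (List.replicate M 0)

theorem nextRow_modEq {P u : ℤ} {h M n : ℕ} (hn : 1 ≤ n) {rows : List (List ℤ)}
    (hrows : List.Forall₂ (ListModEq P) rows (rowsBelow u h M n)) :
    ListModEq P (nextRow P h M n rows) (coeffsFrom (Polynomial.C u * convRow h n) 0 M) := by
  unfold nextRow
  rw [← coeffsFrom_zero 0]
  split_ifs with hh
  · obtain ⟨n, rfl⟩ : ∃ n', n = n' + 1 := ⟨n - 1, by omega⟩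
    rw [rowsBelow] at hrows
    cases hrows with
    | @cons r _ rs _ hr hrs =>
    have e : Polynomial.C u * convRow h (n + 1) = Polynomial.C (-1) *
        ((Polynomial.C (1 - ((n + 1 : ℕ) : ℤ)) - Polynomial.X) *
          (Polynomial.C u * convRow h n)) + 0 := by
      rw [convRow_succ hh]
      push_cast
      simp only [map_sub, map_add, map_neg, map_one]
      ring
    rw [e, ← mulAdd_coeffsFrom, ← mulLin_coeffsFrom]
    exact listModEq_mulAdd _ (listModEq_mulLin _ rfl hr) (ListModEq.refl _ _)
  · obtain ⟨p, hp, hp'⟩ := hornerRow_modEq h 0 n (not_lt.1 hh) hrows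
    have e : Polynomial.C u * convRow h n = Polynomial.C (-1) * p + 0 := by
      obtain ⟨d, rfl⟩ : ∃ d, n = d + h := ⟨n - h, by omega⟩
      simp only [genProd_zero, one_mul, zero_add] at hp'
      rw [convRow_rec, hp', mul_neg, Finset.mul_sum, map_neg, map_one, neg_one_mul, add_zero]
      congr 1
      refine Finset.sum_congr rfl fun i _ => ?_
      ring
    rw [e, ← mulAdd_coeffsFrom]
    exact listModEq_mulAdd _ hp (ListModEq.refl _ _)

/-- Checks that the product of the polynomial `d` and the series with coefficients
`f (row (n + 1))` has the coefficients `N` modulo `P`, where `none` allows any coefficient and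
all values are scaled by `v`. -/
def checkSeries (P v : ℤ) (h M : ℕ) (f : List ℤ → ℤ) (d : List ℤ) :
    ℕ → ℕ → List (List ℤ) → List ℤ → List (Option ℤ) → Bool
  | 0, _, _, _, _ => true
  | k + 1, n, rows, as, N =>
    forceNat n fun n => forceList ((nextRow P h M n rows).map (· % P)) fun r =>
      forceInt (f r % P) fun a =>
      match N with
      | none :: N => checkSeries P v h M f d k (n + 1) (r :: rows) (a :: as) N
      | some x :: N =>
          (forceInt (listDotAcc P 0 d (a :: as)) fun b => decide ((b - v * x) % P = 0)) &&
          checkSeries P v h M f d k (n + 1) (r :: rows) (a :: as) N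
      | [] => (forceInt (listDotAcc P 0 d (a :: as)) fun b => decide (b % P = 0)) &&
          checkSeries P v h M f d k (n + 1) (r :: rows) (a :: as) []

/-- The loop invariant is that the stored rows and values are congruent to the true ones. The value
a n is read from row n + 1, so the list of rows is one longer than the list of values. -/
theorem checkSeries_sound {P u v : ℤ} {h M : ℕ} {f : List ℤ → ℤ} {d : List ℤ} {a : ℕ → ℤ}
    (hf : ∀ l l', ListModEq P l l' → f l ≡ f l' [ZMOD P])
    (ha : ∀ n, f (coeffsFrom (Polynomial.C u * convRow h (n + 1)) 0 M) = v * a n) (k n : ℕ)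
    {rows : List (List ℤ)} {as : List ℤ}
    (hrows : List.Forall₂ (ListModEq P) rows (rowsBelow u h M (n + 1)))
    (has : ListModEq P as (valuesBelow (fun n => v * a n) n)) (N : List (Option ℤ))
    (hc : checkSeries P v h M f d k (n + 1) rows as N = true)
    (i : ℕ) (hi : i < k) (x : ℤ) (hx : N.getD i (some 0) = some x) :
    v * PowerSeries.coeff (n + i) ((listPoly d : ℤ⟦X⟧) * PowerSeries.mk a) ≡ v * x [ZMOD P] := by
  induction k generalizing n rows as N i with
  | zero => omega
  | succ k ih =>
    rw [checkSeries, forceNat_eq, forceList_eq, forceInt_eq] at hc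
    set r := (nextRow P h M (n + 1) rows).map (· % P)
    have hr : ListModEq P r (coeffsFrom (Polynomial.C u * convRow h (n + 1)) 0 M) :=
      listModEq_map_emod _ (nextRow_modEq (by omega) hrows)
    have hfr : f r % P ≡ v * a n [ZMOD P] :=
      (Int.mod_modEq _ _).trans ((hf _ _ hr).trans (by rw [ha]))
    have hrows' : List.Forall₂ (ListModEq P) (r :: rows) (rowsBelow u h M (n + 1 + 1)) :=
      List.Forall₂.cons hr hrows
    have has' : ListModEq P (f r % P :: as) (valuesBelow (fun n => v * a n) (n + 1)) :=
      List.Forall₂.cons hfr has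
    have hdot := listDotAcc_modEq 0 d has'
    have hcoeff : listDot d (valuesBelow (fun n => v * a n) (n + 1)) =
        v * PowerSeries.coeff n ((listPoly d : ℤ⟦X⟧) * PowerSeries.mk a) := by
      rw [← coeff_listPoly_mul_mk, ← PowerSeries.coeff_C_mul]
      congr 1
      rw [mul_left_comm]
      congr 1
      ext j
      rw [PowerSeries.coeff_C_mul, PowerSeries.coeff_mk, PowerSeries.coeff_mk]
    rw [zero_add, hcoeff] at hdot
    simp only [forceInt_eq] at hc
    have h2 : checkSeries P v h M f d k (n + 1 + 1) (r :: rows) (f r % P :: as) N.tail = true := by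
      match N with
      | none :: _ => exact hc
      | some y :: _ => exact ((Bool.and_eq_true _ _).mp hc).2
      | [] => exact ((Bool.and_eq_true _ _).mp hc).2
    cases i with
    | zero =>
      rw [add_zero]
      refine hdot.symm.trans ?_
      match N with
      | none :: _ => simp at hx
      | some y :: _ =>
        simp only [Bool.and_eq_true, decide_eq_true_eq] at hc
        simp only [List.getD_cons_zero, Option.some.injEq] at hx
        rw [← hx]
        exact (Int.modEq_iff_dvd.2 (Int.dvd_of_emod_eq_zero hc.1)).symm
      | [] =>
        simp only [Bool.and_eq_true, decide_eq_true_eq] at hc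
        simp only [List.getD_nil, Option.some.injEq] at hx
        rw [← hx, mul_zero]
        exact Int.modEq_zero_iff_dvd.2 (Int.dvd_of_emod_eq_zero hc.1)
    | succ i =>
      rw [show n + (i + 1) = n + 1 + i by ring]
      refine ih (n + 1) hrows' has' N.tail h2 i (by omega) ?_
      rw [← hx]
      cases N <;> simp

/-- The check started at the first row. -/
def checkSeriesStart (P u v : ℤ) (h M : ℕ) (f : List ℤ → ℤ) (d : List ℤ) (k : ℕ)
    (N : List (Option ℤ)) : Bool :=
  forceInt P fun P => forceInt u fun u => forceInt v fun v => forceList d fun d =>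
    checkSeries P v h M f d k 1 [(List.range M).map fun i => if i = 0 then u else 0] [] N

theorem coeffsFrom_C (u : ℤ) (M k : ℕ) :
    coeffsFrom (Polynomial.C u) k M = (List.range M).map fun i => if k + i = 0 then u else 0 := by
  induction M generalizing k with
  | zero => rfl
  | succ M ih =>
    rw [coeffsFrom, ih, List.range_succ_eq_map, List.map_cons, List.map_map, Polynomial.coeff_C,
      add_zero]
    congr 1
    refine List.map_congr_left fun i _ => ?_
    simp [add_assoc, add_comm 1 i]

/-- The scale `v` cancels because it is coprime to `P`. The choice P = 0 and v = 1 is allowed: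
congruence modulo 0 is equality, which serves the exact checks. -/
theorem checkSeriesStart_sound {P u v : ℤ} {h M : ℕ} (hh : 1 ≤ h) {f : List ℤ → ℤ} {d : List ℤ}
    {a : ℕ → ℤ} (hv : IsCoprime P v) (hf : ∀ l l', ListModEq P l l' → f l ≡ f l' [ZMOD P])
    (ha : ∀ n, f (coeffsFrom (Polynomial.C u * convRow h (n + 1)) 0 M) = v * a n) {k : ℕ}
    {N : List (Option ℤ)} (hc : checkSeriesStart P u v h M f d k N = true) (i : ℕ) (hi : i < k)
    (x : ℤ) (hx : N.getD i (some 0) = some x) :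
    PowerSeries.coeff i ((listPoly d : ℤ⟦X⟧) * PowerSeries.mk a) ≡ x [ZMOD P] := by
  rw [checkSeriesStart, forceInt_eq, forceInt_eq, forceInt_eq, forceList_eq] at hc
  have hrows : List.Forall₂ (ListModEq P) [(List.range M).map fun i => if i = 0 then u else 0]
      (rowsBelow u h M (0 + 1)) := by
    refine List.Forall₂.cons ?_ List.Forall₂.nil
    have e := coeffsFrom_C u M 0
    simp only [zero_add] at e
    rw [convRow_zero hh, mul_one, e]
    exact ListModEq.refl _ _
  have key := checkSeries_sound (d := d) hf ha k 0 hrows List.Forall₂.nil N hc i hi x hx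
  rw [zero_add] at key
  refine (Int.modEq_iff_dvd.2 (hv.dvd_of_dvd_mul_left ?_)).symm
  rw [mul_sub]
  exact Int.modEq_iff_dvd.1 key.symm

/-! ### Exponential polynomials and the shift operator -/

section LinearRecurrences

/-- The shift of sequences. -/
noncomputable def seqShift : Module.End ℂ (ℕ → ℂ) where
  toFun e n := e (n + 1)
  map_add' _ _ := rfl
  map_smul' _ _ := rfl

theorem seqShift_pow_apply (k : ℕ) (e : ℕ → ℂ) (n : ℕ) : (seqShift ^ k) e n = e (n + k) := by
  induction k generalizing n with
  | zero => simp
  | succ k ih =>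
    rw [pow_succ', Module.End.mul_apply]
    change (seqShift ^ k) e (n + 1) = _
    rw [ih]
    congr 1
    ring

theorem aeval_seqShift_apply (p : ℂ[X]) (e : ℕ → ℂ) (n : ℕ) :
    Polynomial.aeval seqShift p e n =
      ∑ k ∈ Finset.range (p.natDegree + 1), p.coeff k * e (n + k) := by
  rw [Polynomial.aeval_eq_sum_range, LinearMap.sum_apply, Finset.sum_apply]
  refine Finset.sum_congr rfl fun k _ => ?_
  rw [LinearMap.smul_apply, Pi.smul_apply, seqShift_pow_apply, smul_eq_mul]

theorem eq_zero_of_aeval_seqShift {p : ℂ[X]} (hp : p.Monic) {e : ℕ → ℂ}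
    (he : Polynomial.aeval seqShift p e = 0) (h0 : ∀ i < p.natDegree, e i = 0) : e = 0 := by
  funext n
  induction n using Nat.strong_induction_on with
  | _ n ih =>
    rcases Nat.lt_or_ge n p.natDegree with hn | hn
    · exact h0 n hn
    · have h1 := congrFun he (n - p.natDegree)
      rw [aeval_seqShift_apply, Finset.sum_range_succ, Finset.sum_eq_zero, zero_add,
        hp.coeff_natDegree, one_mul, Nat.sub_add_cancel hn] at h1
      · exact h1
      · intro k hk
        have hk := Finset.mem_range.1 hk
        rw [ih _ (by omega)]
        simp

/-- Conjugation by c^n turns shift minus c into c times the forward difference. Hence the m-th power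
annihilates polynomials of degree below m times c^n. -/
theorem seqShift_sub_pow_apply (c : ℂ) (m : ℕ) (g : ℂ → ℂ) :
    ((seqShift - algebraMap ℂ (Module.End ℂ (ℕ → ℂ)) c) ^ m) (fun n : ℕ => g n * c ^ n) =
      fun n : ℕ => ((fwdDiff (1 : ℂ))^[m] g) (n : ℂ) * c ^ (n + m) := by
  induction m generalizing g with
  | zero => simp
  | succ m ih =>
    rw [pow_succ, Module.End.mul_apply]
    have h1 : (seqShift - algebraMap ℂ (Module.End ℂ (ℕ → ℂ)) c) (fun n : ℕ => g n * c ^ n) =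
        fun n : ℕ => (c * fwdDiff 1 g (n : ℂ)) * c ^ n := by
      funext n
      rw [LinearMap.sub_apply, Pi.sub_apply, Module.algebraMap_end_apply, Pi.smul_apply,
        smul_eq_mul]
      change g ((n + 1 : ℕ) : ℂ) * c ^ (n + 1) - _ = _
      rw [fwdDiff]
      push_cast
      ring
    rw [h1, ih (fun x => c * fwdDiff 1 g x)]
    funext n
    have h2 : ((fwdDiff (1 : ℂ))^[m] fun x => c * fwdDiff 1 g x) =
        c • (fwdDiff (1 : ℂ))^[m] (fwdDiff 1 g) :=
      fwdDiff_iter_const_smul 1 c (fwdDiff 1 g) m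
    rw [h2, Function.iterate_succ_apply, Pi.smul_apply, smul_eq_mul]
    ring

theorem aeval_seqShift_expPoly {c : ℂ} {m : ℕ} {P : ℂ[X]} (hP : P.natDegree < m) :
    Polynomial.aeval seqShift ((Polynomial.X - Polynomial.C c) ^ m)
      (fun n : ℕ => P.eval (n : ℂ) * c ^ n) = 0 := by
  rw [map_pow, map_sub, Polynomial.aeval_X, Polynomial.aeval_C,
    seqShift_sub_pow_apply c m (fun x => P.eval x)]
  funext n
  have := Polynomial.fwdDiff_iter_eq_zero_of_degree_lt hP
  rw [show (fun x => P.eval x) = P.eval from rfl, this]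
  simp

/-- If a sequence is eventually an exponential polynomial, then the product of its generating
function with a polynomial is a polynomial as soon as sufficiently many coefficients vanish. -/
theorem coeff_mul_mk_eq_zero {ι : Type*} [Fintype ι] {a : ℕ → ℤ} {b : ι → ℂ} {P : ι → ℂ[X]}
    {m c L : ℕ} (hP : ∀ i, (P i).natDegree < m)
    (ha : ∀ n, c ≤ n → (a n : ℂ) = ∑ i, (P i).eval (n : ℂ) * b i ^ n) {D : ℤ[X]}
    (hD : D.natDegree ≤ L)
    (h0 : ∀ i < m * Fintype.card ι,
      PowerSeries.coeff (L + c + i) ((D : ℤ⟦X⟧) * PowerSeries.mk a) = 0)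
    (n : ℕ) (hn : L + c ≤ n) : PowerSeries.coeff n ((D : ℤ⟦X⟧) * PowerSeries.mk a) = 0 := by
  classical
  set p : ℂ[X] := ∏ i, (Polynomial.X - Polynomial.C (b i)) ^ m with hp
  have hmon : p.Monic := Polynomial.monic_prod_of_monic _ _ fun i _ =>
    (Polynomial.monic_X_sub_C _).pow m
  have hdeg : p.natDegree = m * Fintype.card ι := by
    rw [hp, Polynomial.natDegree_prod_of_monic _ _ fun i _ => (Polynomial.monic_X_sub_C _).pow m]
    simp [Polynomial.natDegree_pow, mul_comm]
  set A : ℕ → ℂ := ∑ i, fun n : ℕ => (P i).eval (n : ℂ) * b i ^ n with hA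
  -- Each summand is killed by its own factor of p, which can be applied first since the factors
  -- commute.
  have hpA : Polynomial.aeval seqShift p A = 0 := by
    rw [hA, map_sum]
    refine Finset.sum_eq_zero fun i _ => ?_
    rw [hp, ← Finset.prod_erase_mul Finset.univ _ (Finset.mem_univ i), map_mul,
      Module.End.mul_apply, aeval_seqShift_expPoly (hP i), map_zero]
  set e : ℕ → ℂ := fun i =>
    (PowerSeries.coeff (L + c + i) ((D : ℤ⟦X⟧) * PowerSeries.mk a) : ℤ) with he
  -- Starting at index L + c, the convolution with D uses only values at indices at least c, where
  -- the exponential-polynomial form holds. The tail is thus a combination of shifts of A and obeys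
  -- the same recurrence.
  have heA : e = ∑ k ∈ Finset.range (L + 1), (D.coeff k : ℂ) • (seqShift ^ (L + c - k)) A := by
    funext i
    simp only [he]
    rw [PowerSeries.coeff_mul, Finset.Nat.sum_antidiagonal_eq_sum_range_succ_mk,
      Finset.sum_apply]
    simp only [Polynomial.coeff_coe, PowerSeries.coeff_mk]
    push_cast
    symm
    refine (Finset.sum_congr rfl fun k hk => ?_).trans (Finset.sum_subset
      (Finset.range_mono (by omega : L + 1 ≤ L + c + i + 1)) fun k _ hk => ?_)
    · have hk := Finset.mem_range.1 hk
      rw [Pi.smul_apply, seqShift_pow_apply, smul_eq_mul, ha _ (by omega), hA, Finset.sum_apply,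
        show i + (L + c - k) = L + c + i - k by omega]
    · rw [Polynomial.coeff_eq_zero_of_natDegree_lt]
      · simp
      · simp at hk
        omega
  have hpe : Polynomial.aeval seqShift p e = 0 := by
    rw [heA, map_sum]
    refine Finset.sum_eq_zero fun k _ => ?_
    have : Polynomial.aeval seqShift p ((seqShift ^ (L + c - k)) A) =
        (seqShift ^ (L + c - k)) (Polynomial.aeval seqShift p A) := by
      rw [← Module.End.mul_apply, ← Module.End.mul_apply]
      congr 1
      rw [← Polynomial.aeval_X (R := ℂ) seqShift, ← map_pow, Polynomial.aeval_X, ← map_mul,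
        ← map_mul, mul_comm]
    rw [map_smul, this, hpA, map_zero, smul_zero]
  have hz := eq_zero_of_aeval_seqShift hmon hpe fun i hi => by
    rw [he]
    simp only
    rw [h0 i (hdeg ▸ hi), Int.cast_zero]
  have := congrFun hz (n - (L + c))
  simp only [he, Pi.zero_apply, Int.cast_eq_zero] at this
  rwa [Nat.add_sub_cancel' hn] at this

end LinearRecurrences

theorem natDegree_comp_X_add_one_le (q : ℂ[X]) :
    (q.comp (Polynomial.X + Polynomial.C 1)).natDegree ≤ q.natDegree := by
  rw [Polynomial.natDegree_comp, Polynomial.natDegree_X_add_C, mul_one]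

theorem exists_expPoly_harmConv {s : ℕ} (hs : 1 ≤ s) :
    ∃ (ω : Fin s → ℂ) (q : ℕ → Fin s → ℂ[X]),
      (∀ m, 1 ≤ m → ∀ i, (q m i).natDegree ≤ m - 1) ∧
      ∀ m, 1 ≤ m → ∀ n, m ≤ n → (stirlingConv (s + 1) (n + 1) m : ℂ) =
        ∑ i, (q m i).eval (n : ℂ) * ω i ^ n := by
  obtain ⟨ω, hinj, hω⟩ := exists_omegaPoly_roots s
  have := fun m (hm : 1 ≤ m) => exists_quasiPolynomial_stirlingConv hs hinj hω hm
  choose! q hq hqn using this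
  refine ⟨ω, fun m i => Polynomial.C (ω i) * (q m i).comp (Polynomial.X + Polynomial.C 1),
    fun m hm i => ?_, fun m hm n hn => ?_⟩
  · refine (Polynomial.natDegree_C_mul_le _ _).trans ((natDegree_comp_X_add_one_le _).trans ?_)
    exact Polynomial.natDegree_le_of_degree_le (hq m hm i).le
  · rw [hqn m hm (n + 1) (by omega)]
    refine Finset.sum_congr rfl fun i _ => ?_
    rw [Polynomial.eval_mul, Polynomial.eval_C, Polynomial.eval_comp]
    simp only [Polynomial.eval_add, Polynomial.eval_X, Polynomial.eval_C]
    push_cast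
    ring

/-- Products of exponential polynomials have the pairwise products as bases. The degrees 1 + 1 and 0
+ 2 explain the bound 3; the products are indexed by all ordered pairs, without merging equal bases.
-/
theorem exists_expPoly_harmConv2 {s : ℕ} (hs : 1 ≤ s) :
    ∃ (b : Fin s × Fin s → ℂ) (P : Fin s × Fin s → ℂ[X]), (∀ i, (P i).natDegree < 3) ∧
      ∀ n, 4 ≤ n → (harmConv2 (s + 1) n : ℂ) = ∑ i, (P i).eval (n : ℂ) * b i ^ n := by
  obtain ⟨ω, q, hq, hqn⟩ := exists_expPoly_harmConv hs
  refine ⟨fun i => ω i.1 * ω i.2, fun i => q 2 i.1 * q 2 i.2 -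
    Polynomial.C 2 * (q 1 i.1 * q 3 i.2), fun i => ?_, fun n hn => ?_⟩
  · refine Nat.lt_succ_of_le ((Polynomial.natDegree_sub_le _ _).trans (max_le ?_ ?_))
    · have h1 := hq 2 (by norm_num) i.1
      have h2 := hq 2 (by norm_num) i.2
      exact Polynomial.natDegree_mul_le.trans (by omega)
    · have h1 := hq 1 le_rfl i.1
      have h2 := hq 3 (by norm_num) i.2
      exact (Polynomial.natDegree_C_mul_le _ _).trans
        (Polynomial.natDegree_mul_le.trans (by omega))
  · rw [harmConv2]
    push_cast
    rw [hqn 1 (by omega) n (by omega), hqn 2 (by omega) n (by omega),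
      hqn 3 (by omega) n (by omega), Fintype.sum_prod_type]
    generalize hx1 : (fun i => (q 1 i).eval (n : ℂ) * ω i ^ n) = x1
    generalize hx2 : (fun i => (q 2 i).eval (n : ℂ) * ω i ^ n) = x2
    generalize hx3 : (fun i => (q 3 i).eval (n : ℂ) * ω i ^ n) = x3
    have : ∀ i j, ((q 2 i * q 2 j - Polynomial.C 2 * (q 1 i * q 3 j)).eval (n : ℂ)) *
        (ω i * ω j) ^ n = x2 i * x2 j - 2 * (x1 i * x3 j) := by
      intro i j
      rw [← hx1, ← hx2, ← hx3, mul_pow]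
      simp only [Polynomial.eval_sub, Polynomial.eval_mul, Polynomial.eval_C]
      ring
    simp only [this, Finset.sum_sub_distrib, ← Finset.mul_sum, ← Finset.sum_mul]
    ring

/-- The same with triples: in each term the lower indices m sum to 6, so the degrees m - 1 sum to 3.
The coefficient with m = 4 forces the range n ≥ 4. -/
theorem exists_expPoly_harmConv3 {s : ℕ} (hs : 1 ≤ s) :
    ∃ (b : Fin s × Fin s × Fin s → ℂ) (P : Fin s × Fin s × Fin s → ℂ[X]),
      (∀ i, (P i).natDegree < 4) ∧
      ∀ n, 4 ≤ n → (harmConv3 (s + 1) n : ℂ) = ∑ i, (P i).eval (n : ℂ) * b i ^ n := by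
  obtain ⟨ω, q, hq, hqn⟩ := exists_expPoly_harmConv hs
  refine ⟨fun i => ω i.1 * (ω i.2.1 * ω i.2.2), fun i => q 2 i.1 * (q 2 i.2.1 * q 2 i.2.2) -
    Polynomial.C 3 * (q 1 i.1 * (q 2 i.2.1 * q 3 i.2.2)) +
    Polynomial.C 3 * (q 1 i.1 * (q 1 i.2.1 * q 4 i.2.2)), fun i => ?_, fun n hn => ?_⟩
  · have hmul : ∀ a b c, 1 ≤ a → 1 ≤ b → 1 ≤ c → a + b + c = 6 →
        (q a i.1 * (q b i.2.1 * q c i.2.2)).natDegree ≤ 3 := by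
      intro a b c ha hb hc habc
      have h1 := hq a ha i.1
      have h2 := hq b hb i.2.1
      have h3 := hq c hc i.2.2
      have h4 := Polynomial.natDegree_mul_le (p := q b i.2.1) (q := q c i.2.2)
      exact Polynomial.natDegree_mul_le.trans (by omega)
    refine Nat.lt_succ_of_le ((Polynomial.natDegree_add_le _ _).trans (max_le
      ((Polynomial.natDegree_sub_le _ _).trans (max_le (hmul 2 2 2 ?_ ?_ ?_ ?_)
        ((Polynomial.natDegree_C_mul_le _ _).trans (hmul 1 2 3 ?_ ?_ ?_ ?_))))
        ((Polynomial.natDegree_C_mul_le _ _).trans (hmul 1 1 4 ?_ ?_ ?_ ?_)))) <;> norm_num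
  · rw [harmConv3]
    push_cast
    rw [hqn 1 (by omega) n (by omega), hqn 2 (by omega) n (by omega),
      hqn 3 (by omega) n (by omega), hqn 4 (by omega) n (by omega), Fintype.sum_prod_type]
    simp only [Fintype.sum_prod_type]
    generalize hx1 : (fun i => (q 1 i).eval (n : ℂ) * ω i ^ n) = x1
    generalize hx2 : (fun i => (q 2 i).eval (n : ℂ) * ω i ^ n) = x2
    generalize hx3 : (fun i => (q 3 i).eval (n : ℂ) * ω i ^ n) = x3
    generalize hx4 : (fun i => (q 4 i).eval (n : ℂ) * ω i ^ n) = x4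
    have : ∀ i j k, ((q 2 i * (q 2 j * q 2 k) - Polynomial.C 3 * (q 1 i * (q 2 j * q 3 k)) +
        Polynomial.C 3 * (q 1 i * (q 1 j * q 4 k))).eval (n : ℂ)) *
        (ω i * (ω j * ω k)) ^ n = x2 i * (x2 j * x2 k) - 3 * (x1 i * (x2 j * x3 k)) +
          3 * (x1 i * (x1 j * x4 k)) := by
      intro i j k
      rw [← hx1, ← hx2, ← hx3, ← hx4, mul_pow, mul_pow]
      simp only [Polynomial.eval_sub, Polynomial.eval_add, Polynomial.eval_mul, Polynomial.eval_C]
      ring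
    simp only [this, Finset.sum_sub_distrib, Finset.sum_add_distrib, ← Finset.mul_sum,
      ← Finset.sum_mul]
    ring

/-! ### Rationality of the convergent approximations of harmonic numbers -/

theorem abs_coeff_linear_mul_le {p : ℤ[X]} {B : ℤ} (hp : ∀ j, |p.coeff j| ≤ B) (c : ℤ) (j : ℕ) :
    |((Polynomial.C c + Polynomial.X) * p).coeff j| ≤ (|c| + 1) * B := by
  have hB : 0 ≤ B := (abs_nonneg _).trans (hp 0)
  have h1 : |c * p.coeff j| ≤ |c| * B := by
    rw [abs_mul]
    exact mul_le_mul_of_nonneg_left (hp j) (abs_nonneg c)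
  rw [add_mul, Polynomial.coeff_add, Polynomial.coeff_C_mul]
  cases j with
  | zero =>
    rw [Polynomial.mul_coeff_zero, Polynomial.coeff_X_zero, zero_mul, add_zero]
    linarith
  | succ j =>
    rw [Polynomial.coeff_X_mul]
    linarith [abs_add_le (c * p.coeff (j + 1)) (p.coeff j), hp j]

/-- Up to sign each factor is c + X with c = h - 1 - t ≥ 0, which enlarges the coefficient bound by
at most h - t. -/
theorem abs_coeff_genProd_mul_le {p : ℤ[X]} {B : ℤ} (hp : ∀ j, |p.coeff j| ≤ B) {h t : ℕ}
    (ht : t ≤ h) (j : ℕ) :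
    |(genProd 1 (1 - (h : ℤ[X]) - Polynomial.X) t * p).coeff j| ≤ h.descFactorial t * B := by
  induction t generalizing j with
  | zero => simpa [genProd_zero] using hp j
  | succ t ih =>
    have e : genProd 1 (1 - (h : ℤ[X]) - Polynomial.X) (t + 1) * p =
        -((Polynomial.C ((h : ℤ) - 1 - t) + Polynomial.X) *
          (genProd 1 (1 - (h : ℤ[X]) - Polynomial.X) t * p)) := by
      rw [genProd_succ]
      simp only [map_sub, map_natCast, map_one]
      ring
    have h0 : (0 : ℤ) ≤ (h : ℤ) - 1 - t := by omega
    have h2 : (((h - t : ℕ) : ℤ)) = (h : ℤ) - 1 - t + 1 := by omega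
    rw [e, Polynomial.coeff_neg, abs_neg]
    refine (abs_coeff_linear_mul_le (ih (by omega)) _ j).trans (le_of_eq ?_)
    rw [abs_of_nonneg h0, Nat.descFactorial_succ, Nat.cast_mul, h2, mul_assoc]

theorem abs_coeff_convRow_le {h : ℕ} (hh : 1 ≤ h) (h5 : h ≤ 5) (n j : ℕ) :
    |(convRow h n).coeff j| ≤ 32 ^ n := by
  induction n using Nat.strong_induction_on generalizing j with
  | _ n ih =>
  rcases lt_or_ge n h with hn | hn
  · cases n with
    | zero =>
      rw [convRow_zero hh, Polynomial.coeff_one]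
      split_ifs <;> norm_num
    | succ n =>
      rw [convRow_succ hn]
      refine (abs_coeff_linear_mul_le (ih n (by omega)) _ j).trans ?_
      rw [Nat.abs_cast, pow_succ']
      exact mul_le_mul_of_nonneg_right (by omega) (by positivity)
  · obtain ⟨n, rfl⟩ : ∃ d, n = d + h := ⟨n - h, by omega⟩
    rw [convRow_rec, Polynomial.coeff_neg, abs_neg, Polynomial.finsetSum_coeff]
    refine (Finset.abs_sum_le_sum_abs _ _).trans ?_
    have hle : ∀ i ∈ Finset.range h, |((h.choose (i + 1) : ℤ[X]) *
        genProd 1 (1 - (h : ℤ[X]) - Polynomial.X) (i + 1) * convRow h (n + h - 1 - i)).coeff j| ≤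
        (h.choose (i + 1) * (h.descFactorial (i + 1) * 32 ^ (h - 1 - i))) * 32 ^ n := by
      intro i hi
      have hi := Finset.mem_range.1 hi
      rw [mul_assoc, ← Polynomial.C_eq_natCast, Polynomial.coeff_C_mul, abs_mul, Nat.abs_cast]
      have := abs_coeff_genProd_mul_le (ih (n + h - 1 - i) (by omega))
        (show i + 1 ≤ h by omega) j
      rw [show n + h - 1 - i = h - 1 - i + n by omega] at this ⊢
      rw [pow_add] at this
      calc _ ≤ (h.choose (i + 1) : ℤ) * _ := mul_le_mul_of_nonneg_left this (by positivity)
        _ = _ := by ring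
    refine (Finset.sum_le_sum hle).trans ?_
    rw [← Finset.sum_mul, add_comm n, pow_add]
    refine mul_le_mul_of_nonneg_right ?_ (by positivity)
    -- The base 32 is adequate up to h = 5: the weighted sum over the recurrence is at most 32^h.
    interval_cases h <;> decide

theorem abs_stirlingConv_le {h : ℕ} (hh : 1 ≤ h) (h5 : h ≤ 5) (n m : ℕ) :
    |stirlingConv h n m| ≤ 32 ^ n := by
  rw [stirlingConv_eq]
  exact abs_coeff_convRow_le hh h5 n m

theorem abs_mul_le_mul {a b A B : ℤ} (ha : |a| ≤ A) (hb : |b| ≤ B) : |a * b| ≤ A * B := by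
  rw [abs_mul]
  exact mul_le_mul ha hb (abs_nonneg _) ((abs_nonneg _).trans ha)

theorem abs_harmConv2_le {h : ℕ} (hh : 1 ≤ h) (h5 : h ≤ 5) (n : ℕ) :
    |harmConv2 h n| ≤ 7 * (32 ^ (n + 1)) ^ 2 := by
  have hb := abs_stirlingConv_le hh h5 (n + 1)
  have h1 := abs_mul_le_mul (hb 2) (hb 2)
  have h2 := abs_mul_le_mul (hb 1) (hb 3)
  have hB : (0 : ℤ) ≤ (32 ^ (n + 1)) ^ 2 := by positivity
  unfold harmConv2
  rw [abs_le] at *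
  constructor <;> nlinarith

theorem abs_harmConv3_le {h : ℕ} (hh : 1 ≤ h) (h5 : h ≤ 5) (n : ℕ) :
    |harmConv3 h n| ≤ 7 * (32 ^ (n + 1)) ^ 3 := by
  have hb := abs_stirlingConv_le hh h5 (n + 1)
  have h1 := abs_mul_le_mul (hb 2) (abs_mul_le_mul (hb 2) (hb 2))
  have h2 := abs_mul_le_mul (hb 1) (abs_mul_le_mul (hb 2) (hb 3))
  have h3 := abs_mul_le_mul (hb 1) (abs_mul_le_mul (hb 1) (hb 4))
  unfold harmConv3
  rw [abs_le] at *
  constructor <;> linarith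

theorem abs_listDot_le {a : ℕ → ℤ} {B : ℤ} (d : List ℤ) (n : ℕ) (ha : ∀ k < n, |a k| ≤ B)
    (hB : 0 ≤ B) : |listDot d (valuesBelow a n)| ≤ (d.map Int.natAbs).sum * B := by
  induction d generalizing n with
  | nil => simp [listDot]
  | cons x d ih =>
    cases n with
    | zero => simp only [valuesBelow, listDot, abs_zero]; positivity
    | succ n =>
      rw [valuesBelow, listDot, List.map_cons, List.sum_cons, Nat.cast_add, add_mul]
      refine (abs_add_le _ _).trans (add_le_add ?_ (ih n fun k hk => ha k (by omega)))
      rw [Int.natCast_natAbs]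
      exact abs_mul_le_mul le_rfl (ha n (by omega))

/-- An integer divisible by P and smaller than P in absolute value is zero, so a check modulo a
sufficiently large P proves exact vanishing. -/
theorem coeff_listPoly_mul_mk_eq_zero {a : ℕ → ℤ} {B P : ℤ} {d : List ℤ} {n : ℕ}
    (ha : ∀ k ≤ n, |a k| ≤ B) (hP : (d.map Int.natAbs).sum * B < P)
    (h0 : PowerSeries.coeff n ((listPoly d : ℤ⟦X⟧) * PowerSeries.mk a) ≡ 0 [ZMOD P]) :
    PowerSeries.coeff n ((listPoly d : ℤ⟦X⟧) * PowerSeries.mk a) = 0 := by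
  refine Int.eq_zero_of_abs_lt_dvd (Int.modEq_zero_iff_dvd.1 h0) (lt_of_le_of_lt ?_ hP)
  rw [coeff_listPoly_mul_mk]
  exact abs_listDot_le d _ (fun k hk => ha k (by omega))
    ((abs_nonneg _).trans (ha 0 (Nat.zero_le n)))

theorem exists_coe_polynomial_eq {A : Type*} [CommRing A] {f : A⟦X⟧} {c : ℕ}
    (hf : ∀ n, c ≤ n → PowerSeries.coeff n f = 0) : ∃ N : A[X], f = (N : A⟦X⟧) := by
  refine ⟨f.trunc c, PowerSeries.ext fun n => ?_⟩
  rw [Polynomial.coeff_coe, PowerSeries.coeff_trunc]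
  split_ifs with h
  · rfl
  · exact hf n (not_lt.1 h)

/-- `b^2 - 2 a c` for a row `[_, a, b, c]`. -/
def harmList2 : List ℤ → ℤ
  | [_, a, b, c] => b * b - 2 * a * c
  | _ => 0

/-- `b^3 - 3 a b c + 3 a^2 d` for a row `[_, a, b, c, d]`. -/
def harmList3 : List ℤ → ℤ
  | [_, a, b, c, d] => b * b * b - 3 * a * b * c + 3 * (a * a) * d
  | _ => 0

theorem harmList2_modEq {P : ℤ} (l l' : List ℤ) (h : ListModEq P l l') :
    harmList2 l ≡ harmList2 l' [ZMOD P] := by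
  cases h with
  | nil => rfl
  | cons h0 h =>
  cases h with
  | nil => rfl
  | cons h1 h =>
  cases h with
  | nil => rfl
  | cons h2 h =>
  cases h with
  | nil => rfl
  | cons h3 h =>
  cases h with
  | nil => exact (h2.mul h2).sub ((h1.mul_left 2).mul h3)
  | cons h4 h => rfl

theorem harmList3_modEq {P : ℤ} (l l' : List ℤ) (h : ListModEq P l l') :
    harmList3 l ≡ harmList3 l' [ZMOD P] := by
  cases h with
  | nil => rfl
  | cons h0 h =>
  cases h with
  | nil => rfl
  | cons h1 h =>
  cases h with
  | nil => rfl
  | cons h2 h =>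
  cases h with
  | nil => rfl
  | cons h3 h =>
  cases h with
  | nil => rfl
  | cons h4 h =>
  cases h with
  | nil =>
    exact (((h2.mul h2).mul h2).sub (((h1.mul_left 3).mul h2).mul h3)).add
      (((h1.mul h1).mul_left 3).mul h4)
  | cons h5 h => rfl

theorem harmList2_coeffsFrom (u : ℤ) (h n : ℕ) :
    harmList2 (coeffsFrom (Polynomial.C u * convRow h (n + 1)) 0 4) = u ^ 2 * harmConv2 h n := by
  simp only [coeffsFrom, harmList2, harmConv2, stirlingConv_eq, Polynomial.coeff_C_mul]
  ring

theorem harmList3_coeffsFrom (u : ℤ) (h n : ℕ) :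
    harmList3 (coeffsFrom (Polynomial.C u * convRow h (n + 1)) 0 5) = u ^ 3 * harmConv3 h n := by
  simp only [coeffsFrom, harmList3, harmConv3, stirlingConv_eq, Polynomial.coeff_C_mul]
  ring

theorem isCoprime_three_pow_five_pow (a b c : ℕ) : IsCoprime ((3 : ℤ) ^ a) (((5 : ℤ) ^ b) ^ c) :=
  IsCoprime.pow (IsCoprime.pow_right (by norm_num))

/-- The first L + 4 coefficients are free, as they form the numerator. The next 3s² are the full
order of the recurrence for the tail, so their vanishing is enough. -/
theorem exists_listPoly_mul_harmConv2 {s L a b : ℕ} (hs : 1 ≤ s) (h5 : s + 1 ≤ 5) {d : List ℤ}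
    (hd : d.length ≤ L + 1)
    (hP : ((d.map Int.natAbs).sum : ℤ) * (7 * (32 ^ (L + 4 + 3 * (s * s))) ^ 2) < 3 ^ a)
    (hc : checkSeriesStart (3 ^ a) (5 ^ b) ((5 ^ b) ^ 2) (s + 1) 4 harmList2 d
      (L + 4 + 3 * (s * s)) (List.replicate (L + 4) none) = true) :
    ∃ N : ℤ[X], (listPoly d : ℤ⟦X⟧) * PowerSeries.mk (harmConv2 (s + 1)) = (N : ℤ⟦X⟧) := by
  obtain ⟨w, q, hq, hw⟩ := exists_expPoly_harmConv2 hs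
  refine exists_coe_polynomial_eq (c := L + 4)
    (coeff_mul_mk_eq_zero hq hw (natDegree_listPoly_le d hd) fun i hi => ?_)
  simp only [Fintype.card_prod, Fintype.card_fin] at hi
  refine coeff_listPoly_mul_mk_eq_zero (fun k hk => (abs_harmConv2_le (by omega) h5 k).trans ?_) hP
    (checkSeriesStart_sound (by omega) (isCoprime_three_pow_five_pow a b 2) harmList2_modEq
      (harmList2_coeffsFrom _ _) hc _ (by omega) 0 ?_)
  · exact mul_le_mul_of_nonneg_left (pow_le_pow_left₀ (by positivity)
      (pow_le_pow_right₀ (by norm_num) (by omega)) _) (by norm_num)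
  -- Past the unconstrained entries the expected list defaults to `some 0`, which is the vanishing
  -- demanded of the window.
  · rw [List.getD_eq_default _ _ (by simp)]

theorem exists_listPoly_mul_harmConv3 {s L a b : ℕ} (hs : 1 ≤ s) (h5 : s + 1 ≤ 5) {d : List ℤ}
    (hd : d.length ≤ L + 1)
    (hP : ((d.map Int.natAbs).sum : ℤ) * (7 * (32 ^ (L + 4 + 4 * (s * (s * s)))) ^ 3) < 3 ^ a)
    (hc : checkSeriesStart (3 ^ a) (5 ^ b) ((5 ^ b) ^ 3) (s + 1) 5 harmList3 d
      (L + 4 + 4 * (s * (s * s))) (List.replicate (L + 4) none) = true) :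
    ∃ N : ℤ[X], (listPoly d : ℤ⟦X⟧) * PowerSeries.mk (harmConv3 (s + 1)) = (N : ℤ⟦X⟧) := by
  obtain ⟨w, q, hq, hw⟩ := exists_expPoly_harmConv3 hs
  refine exists_coe_polynomial_eq (c := L + 4)
    (coeff_mul_mk_eq_zero hq hw (natDegree_listPoly_le d hd) fun i hi => ?_)
  simp only [Fintype.card_prod, Fintype.card_fin] at hi
  refine coeff_listPoly_mul_mk_eq_zero (fun k hk => (abs_harmConv3_le (by omega) h5 k).trans ?_) hP
    (checkSeriesStart_sound (by omega) (isCoprime_three_pow_five_pow a b 3) harmList3_modEq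
      (harmList3_coeffsFrom _ _) hc _ (by omega) 0 ?_)
  · exact mul_le_mul_of_nonneg_left (pow_le_pow_left₀ (by positivity)
      (pow_le_pow_right₀ (by norm_num) (by omega)) _) (by norm_num)
  · rw [List.getD_eq_default _ _ (by simp)]

/-- One finite comparison does two jobs: its first L + c entries fix the numerator, and the
remaining k trigger the vanishing of the tail. -/
theorem mul_mk_eq_listPoly {a : ℕ → ℤ} {d N : List ℤ} {L c k : ℕ} (hN : N.length ≤ L + c)
    (h0 : ∀ i < L + c + k,
      PowerSeries.coeff i ((listPoly d : ℤ⟦X⟧) * PowerSeries.mk a) = N.getD i 0)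
    (hz : (∀ i < k, PowerSeries.coeff (L + c + i) ((listPoly d : ℤ⟦X⟧) * PowerSeries.mk a) = 0) →
      ∀ n, L + c ≤ n → PowerSeries.coeff n ((listPoly d : ℤ⟦X⟧) * PowerSeries.mk a) = 0) :
    (listPoly d : ℤ⟦X⟧) * PowerSeries.mk a = (listPoly N : ℤ⟦X⟧) := by
  have hz' := hz fun i hi => by rw [h0 _ (by omega), List.getD_eq_default _ _ (by omega)]
  refine PowerSeries.ext fun n => ?_
  rw [Polynomial.coeff_coe, coeff_listPoly]
  rcases lt_or_ge n (L + c) with h | h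
  · exact h0 n (by omega)
  · rw [hz' n h, List.getD_eq_default _ _ (by omega)]

theorem listPoly_mul_harmConv2 {s L : ℕ} (hs : 1 ≤ s) {d N : List ℤ} (hd : d.length ≤ L + 1)
    (hN : N.length ≤ L + 4)
    (hc : checkSeriesStart 0 1 1 (s + 1) 4 harmList2 d (L + 4 + 3 * (s * s)) (N.map some) = true) :
    (listPoly d : ℤ⟦X⟧) * PowerSeries.mk (harmConv2 (s + 1)) = (listPoly N : ℤ⟦X⟧) := by
  obtain ⟨w, q, hq, hw⟩ := exists_expPoly_harmConv2 hs
  refine mul_mk_eq_listPoly hN (fun i hi => ?_)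
    (coeff_mul_mk_eq_zero hq hw (natDegree_listPoly_le d hd))
  simp only [Fintype.card_prod, Fintype.card_fin] at hi
  exact Int.modEq_zero_iff.1 (checkSeriesStart_sound (by omega) isCoprime_one_right harmList2_modEq
    (fun n => (harmList2_coeffsFrom 1 _ n).trans (by rw [one_pow])) hc _ hi _ (by simp))

theorem listPoly_mul_harmConv3 {s L : ℕ} (hs : 1 ≤ s) {d N : List ℤ} (hd : d.length ≤ L + 1)
    (hN : N.length ≤ L + 4)
    (hc : checkSeriesStart 0 1 1 (s + 1) 5 harmList3 d (L + 4 + 4 * (s * (s * s)))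
      (N.map some) = true) :
    (listPoly d : ℤ⟦X⟧) * PowerSeries.mk (harmConv3 (s + 1)) = (listPoly N : ℤ⟦X⟧) := by
  obtain ⟨w, q, hq, hw⟩ := exists_expPoly_harmConv3 hs
  refine mul_mk_eq_listPoly hN (fun i hi => ?_)
    (coeff_mul_mk_eq_zero hq hw (natDegree_listPoly_le d hd))
  simp only [Fintype.card_prod, Fintype.card_fin] at hi
  exact Int.modEq_zero_iff.1 (checkSeriesStart_sound (by omega) isCoprime_one_right harmList3_modEq
    (fun n => (harmList3_coeffsFrom 1 _ n).trans (by rw [one_pow])) hc _ hi _ (by simp))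

/-- The power of a polynomial given by a list. -/
def listPow (l : List ℤ) : ℕ → List ℤ
  | 0 => [1]
  | n + 1 => listMul (listPow l n) l

theorem listPoly_listPow (l : List ℤ) (n : ℕ) : listPoly (listPow l n) = listPoly l ^ n := by
  induction n with
  | zero => simp [listPow, listPoly]
  | succ n ih => rw [listPow, listPoly_listMul, ih, pow_succ]

/-- The coefficients of `den24`. -/
def den24List : List ℤ :=
  listMul (listPow [-1, 72, -720, 576] 2) (listPow [-1, 36, -288, 576] 3)

/-- The coefficients of `den25`. -/
def den25List : List ℤ :=
  listMul (listPow [1, -160, 5040, -28800, 14400] 2)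
    (listPow [1, -120, 4680, -76800, 561600, -1728000, 1728000] 3)

/-- The coefficients of `den34`. -/
def den34List : List ℤ :=
  listMul (listMul (listMul (listPow [1, -24] 4) (listPow [-1, 504, -17280, 13824] 2))
    (listPow [-1, 144, -5184, 13824] 4)) (listPow [-1, 216, -3456, 13824] 4)

/-- The coefficients of `den35`. -/
def den35List : List ℤ :=
  listMul (listMul (listPow [1, -1520, 273600, -4320000, 1728000] 2)
    (listPow [1, -240, 14400, -288000, 1728000] 4))
    (listPow [1, -1680, 1051200, -319776000, 51914304000, -4764026880000, 251795865600000,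
      -7537618944000000, 121956544512000000, -998751928320000000, 4084826112000000000,
      -7739670528000000000, 5159780352000000000] 4)

theorem listPoly_three (a b c d : ℤ) : listPoly [a, b, c, d] =
    Polynomial.C a + Polynomial.C b * Polynomial.X + Polynomial.C c * Polynomial.X ^ 2 +
      Polynomial.C d * Polynomial.X ^ 3 := by
  simp only [listPoly]
  ring

theorem listPoly_four (a b c d e : ℤ) : listPoly [a, b, c, d, e] =
    Polynomial.C a + Polynomial.C b * Polynomial.X + Polynomial.C c * Polynomial.X ^ 2 +
      Polynomial.C d * Polynomial.X ^ 3 + Polynomial.C e * Polynomial.X ^ 4 := by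
  simp only [listPoly]
  ring

theorem listPoly_den24List : listPoly den24List = den24 := by
  simp only [den24List, den24, listPoly_listMul, listPoly_listPow, listPoly_three, map_neg,
    map_one, map_ofNat]
  ring

theorem listPoly_den25List : listPoly den25List = den25 := by
  have e : listPoly [1, -120, 4680, -76800, 561600, -1728000, 1728000] =
      1 - 120 * Polynomial.X + 4680 * Polynomial.X ^ 2 - 76800 * Polynomial.X ^ 3 +
        561600 * Polynomial.X ^ 4 - 1728000 * Polynomial.X ^ 5 + 1728000 * Polynomial.X ^ 6 := by
    simp only [listPoly, map_neg, map_one, map_ofNat]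
    ring
  simp only [den25List, den25, listPoly_listMul, listPoly_listPow, listPoly_four, e, map_neg,
    map_one, map_ofNat, neg_mul, ← sub_eq_add_neg]

theorem listPoly_den34List : listPoly den34List = den34 := by
  have e : listPoly [1, -24] = 1 - 24 * Polynomial.X := by
    simp only [listPoly, map_neg, map_one, map_ofNat]
    ring
  simp only [den34List, den34, listPoly_listMul, listPoly_listPow, listPoly_three, e, map_neg,
    map_one, map_ofNat, neg_mul, ← sub_eq_add_neg]

theorem listPoly_den35List : listPoly den35List = den35 := by
  have e : listPoly [1, -1680, 1051200, -319776000, 51914304000, -4764026880000, 251795865600000,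
      -7537618944000000, 121956544512000000, -998751928320000000, 4084826112000000000,
      -7739670528000000000, 5159780352000000000] =
      1 - 1680 * Polynomial.X + 1051200 * Polynomial.X ^ 2 - 319776000 * Polynomial.X ^ 3 +
      51914304000 * Polynomial.X ^ 4 - 4764026880000 * Polynomial.X ^ 5 +
      251795865600000 * Polynomial.X ^ 6 - 7537618944000000 * Polynomial.X ^ 7 +
      121956544512000000 * Polynomial.X ^ 8 - 998751928320000000 * Polynomial.X ^ 9 +
      4084826112000000000 * Polynomial.X ^ 10 - 7739670528000000000 * Polynomial.X ^ 11 +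
      5159780352000000000 * Polynomial.X ^ 12 := by
    simp only [listPoly, map_neg, map_one, map_ofNat]
    ring
  simp only [den35List, den35, listPoly_listMul, listPoly_listPow, listPoly_four, e, map_neg,
    map_one, map_ofNat, neg_mul, ← sub_eq_add_neg]

theorem exists_den24_mul_harmConv2 :
    ∃ N : ℤ[X], (den24 : ℤ⟦X⟧) * PowerSeries.mk (harmConv2 4) = (N : ℤ⟦X⟧) := by
  rw [← listPoly_den24List]
  -- Here L = 2 · 3 + 3 · 3 is the degree of the denominator, and 3^500 has only to exceed the size
  -- bound; the scale 5^200 is merely a unit modulo 3^500.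
  exact exists_listPoly_mul_harmConv2 (s := 3) (L := 15) (a := 500) (b := 200) (by norm_num)
    (by norm_num) (by decide +kernel) (by decide +kernel) (by decide +kernel)

theorem exists_den25_mul_harmConv2 :
    ∃ N : ℤ[X], (den25 : ℤ⟦X⟧) * PowerSeries.mk (harmConv2 5) = (N : ℤ⟦X⟧) := by
  rw [← listPoly_den25List]
  exact exists_listPoly_mul_harmConv2 (s := 4) (L := 26) (a := 800) (b := 400) (by norm_num)
    (by norm_num) (by decide +kernel) (by decide +kernel) (by decide +kernel)

theorem exists_den34_mul_harmConv3 :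
    ∃ N : ℤ[X], (den34 : ℤ⟦X⟧) * PowerSeries.mk (harmConv3 4) = (N : ℤ⟦X⟧) := by
  rw [← listPoly_den34List]
  exact exists_listPoly_mul_harmConv3 (s := 3) (L := 34) (a := 1800) (b := 1200) (by norm_num)
    (by norm_num) (by decide +kernel) (by decide +kernel) (by decide +kernel)

theorem checkSeriesStart_den35List : checkSeriesStart (3 ^ 4200) (5 ^ 2790) ((5 ^ 2790) ^ 3)
    (4 + 1) 5 harmList3 den35List (72 + 4 + 4 * (4 * (4 * 4))) (List.replicate (72 + 4) none) =
      true := by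
  decide +kernel

theorem sum_den35List_mul_lt : ((den35List.map Int.natAbs).sum : ℤ) *
    (7 * (32 ^ (72 + 4 + 4 * (4 * (4 * 4)))) ^ 3) < 3 ^ 4200 := by
  decide +kernel

theorem exists_den35_mul_harmConv3 :
    ∃ N : ℤ[X], (den35 : ℤ⟦X⟧) * PowerSeries.mk (harmConv3 5) = (N : ℤ⟦X⟧) := by
  have hd : den35List.length ≤ 72 + 1 := by decide +kernel
  rw [← listPoly_den35List]
  exact exists_listPoly_mul_harmConv3 (s := 4) (by norm_num) (by norm_num) hd
    sum_den35List_mul_lt checkSeriesStart_den35List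

/-! ### Exact generating functions -/

/-- The entry `b` of a row `[_, _, b]`. -/
def harmList1 : List ℤ → ℤ
  | [_, _, b] => b
  | _ => 0

theorem harmList1_modEq {P : ℤ} (l l' : List ℤ) (h : ListModEq P l l') :
    harmList1 l ≡ harmList1 l' [ZMOD P] := by
  cases h with
  | nil => rfl
  | cons h0 h =>
  cases h with
  | nil => rfl
  | cons h1 h =>
  cases h with
  | nil => rfl
  | cons h2 h =>
  cases h with
  | nil => exact h2
  | cons h3 h => rfl

theorem listPoly_mul_stirlingConv_two {s L : ℕ} (hs : 1 ≤ s) {d N : List ℤ}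
    (hd : d.length ≤ L + 1) (hN : N.length ≤ L + 2)
    (hc : checkSeriesStart 0 1 1 (s + 1) 3 harmList1 d (L + 2 + 2 * s) (N.map some) = true) :
    (listPoly d : ℤ⟦X⟧) * PowerSeries.mk (fun n => stirlingConv (s + 1) (n + 1) 2) =
      (listPoly N : ℤ⟦X⟧) := by
  obtain ⟨w, q, hq, hw⟩ := exists_expPoly_harmConv hs
  refine mul_mk_eq_listPoly (k := 2 * s) hN (fun i hi => ?_) fun h0 => ?_
  · refine Int.modEq_zero_iff.1 (checkSeriesStart_sound (by omega) isCoprime_one_right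
      harmList1_modEq (fun n => ?_) hc _ hi _ (by simp))
    simp only [coeffsFrom, harmList1, stirlingConv_eq, Polynomial.coeff_C_mul]
  · refine coeff_mul_mk_eq_zero (m := 2) (P := q 2) (b := w)
      (fun i => Nat.lt_succ_of_le (hq 2 (by norm_num) i)) (fun n hn => hw 2 (by norm_num) n hn)
      (natDegree_listPoly_le d hd) fun i hi => h0 i ?_
    rwa [Fintype.card_fin] at hi

theorem map_listPoly {K : Type*} [CommRing K] (ψ : ℤ⟦X⟧ →+* K) (d : List ℤ) :
    ψ (listPoly d : ℤ⟦X⟧) = d.foldr (fun (x : ℤ) (y : K) => (x : K) + ψ PowerSeries.X * y) 0 := by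
  induction d with
  | nil => simp [listPoly]
  | cons x d ih =>
    have e : PowerSeries.C x = ((x : ℤ) : ℤ⟦X⟧) := eq_intCast (PowerSeries.C (R := ℤ)) x
    rw [listPoly, Polynomial.coe_add, Polynomial.coe_mul, Polynomial.coe_C, Polynomial.coe_X,
      map_add, map_mul, ih, List.foldr_cons, e, map_intCast]

/-- Identities between rational series are proved in a field, where inverses of series become honest
divisions that can be cleared; injectivity carries them back. -/
theorem exists_embedding_field : ∃ (K : Type) (_ : Field K) (_ : CharZero K) (φ : ℚ⟦X⟧ →+* K),
    Function.Injective φ :=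
  ⟨FractionRing ℚ⟦X⟧, inferInstance,
    charZero_of_injective_algebraMap (algebraMap ℚ (FractionRing ℚ⟦X⟧)).injective,
    algebraMap _ _, IsFractionRing.injective ℚ⟦X⟧ (FractionRing ℚ⟦X⟧)⟩

theorem map_seriesC {K : Type*} [Field K] [CharZero K] (φ : ℚ⟦X⟧ →+* K) (c : ℚ) :
    φ (PowerSeries.C c) = (c : K) :=
  eq_ratCast (φ.comp PowerSeries.C) c

theorem map_series_ne_zero {K : Type*} [Field K] {φ : ℚ⟦X⟧ →+* K}
    (hφ : Function.Injective φ) {D : ℚ⟦X⟧} (hD : PowerSeries.constantCoeff D ≠ 0) : φ D ≠ 0 := by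
  rw [Ne, map_eq_zero_iff _ hφ]
  rintro rfl
  simp at hD

theorem map_frac {K : Type*} [Field K] [CharZero K] {φ : ℚ⟦X⟧ →+* K}
    (hφ : Function.Injective φ) (c : ℚ) (N : ℚ⟦X⟧) {D : ℚ⟦X⟧}
    (hD : PowerSeries.constantCoeff D ≠ 0) : φ (frac c N D) = c * φ N / φ D := by
  rw [frac, map_mul, map_mul, map_seriesC, eq_div_iff (map_series_ne_zero hφ hD), mul_assoc,
    ← map_mul, PowerSeries.inv_mul_cancel _ hD, map_one, mul_one]

/-- The series of an integer sequence over `ℚ`. -/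
noncomputable def ratSeries (a : ℕ → ℤ) : ℚ⟦X⟧ := PowerSeries.mk fun n => (a n : ℚ)

theorem map_mk_eq_ratSeries (a : ℕ → ℤ) :
    PowerSeries.map (Int.castRingHom ℚ) (PowerSeries.mk a) = ratSeries a := by
  ext n
  simp [ratSeries]

theorem map_map_listPoly {K : Type*} [CommRing K] (φ : ℚ⟦X⟧ →+* K) (d : List ℤ) :
    φ (PowerSeries.map (Int.castRingHom ℚ) (listPoly d : ℤ⟦X⟧)) =
      d.foldr (fun (x : ℤ) (y : K) => (x : K) + φ PowerSeries.X * y) 0 := by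
  have := map_listPoly (φ.comp (PowerSeries.map (Int.castRingHom ℚ))) d
  simpa only [RingHom.comp_apply, PowerSeries.map_X] using this

theorem map_listPoly_mul_ratSeries {K : Type*} [CommRing K] (φ : ℚ⟦X⟧ →+* K) {a : ℕ → ℤ}
    {d N : List ℤ} (h : (listPoly d : ℤ⟦X⟧) * PowerSeries.mk a = (listPoly N : ℤ⟦X⟧)) :
    φ (PowerSeries.map (Int.castRingHom ℚ) (listPoly d : ℤ⟦X⟧)) * φ (ratSeries a) =
      N.foldr (fun (x : ℤ) (y : K) => (x : K) + φ PowerSeries.X * y) 0 := by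
  rw [← map_map_listPoly, ← h, map_mul, map_mul, map_mk_eq_ratSeries]

/-- The certified identity denominator · series = numerator is transported to the field, and the
claim follows by clearing denominators. The other exact generating functions follow this pattern. -/
theorem gfH2Mod2_eq_ratSeries : gfH2Mod2 = ratSeries (harmConv2 2) := by
  obtain ⟨K, _, _, φ, hφ⟩ := exists_embedding_field
  apply hφ
  have h := map_listPoly_mul_ratSeries φ (listPoly_mul_harmConv2 (s := 1) (L := 2)
    (d := listPow [1, -4] 2)
    (N := [0, 1, -3, 9, -8])
    (by norm_num) (by decide +kernel) (by decide +kernel) (by decide +kernel))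
  have h0 : φ (1 - 4 * PowerSeries.X) ≠ 0 := map_series_ne_zero hφ (by simp)
  rw [gfH2Mod2, map_frac hφ _ _ (by simp)]
  simp only [listPoly_listPow, Polynomial.coe_pow,
    map_map_listPoly, List.foldr, map_mul, map_sub, map_add, map_pow,
    map_ofNat, map_one] at h h0 ⊢
  push_cast at h ⊢
  generalize φ PowerSeries.X = x at *
  generalize hD : 1 - 4 * x = D at *
  field_simp
  subst hD
  linear_combination -h

theorem gfH2Mod2_eq : gfH2Mod2 = gfH2Mod2PF := by
  obtain ⟨K, _, _, φ, hφ⟩ := exists_embedding_field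
  apply hφ
  have h0 : φ (1 - 4 * PowerSeries.X) ≠ 0 := map_series_ne_zero hφ (by simp)
  simp only [gfH2Mod2, gfH2Mod2PF, map_add φ, map_sub φ]
  rw [map_frac hφ _ _ (by simp), map_frac hφ _ _ (by simp), map_frac hφ _ _ (by simp)]
  simp only [map_mul, map_sub, map_add, map_pow,
    map_ofNat, map_one, map_seriesC] at h0 ⊢
  push_cast
  generalize φ PowerSeries.X = x at *
  generalize hD : 1 - 4 * x = D at *
  field_simp
  subst hD
  ring

theorem gfH2Mod3_eq_ratSeries : gfH2Mod3 = ratSeries (harmConv2 3) := by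
  obtain ⟨K, _, _, φ, hφ⟩ := exists_embedding_field
  apply hφ
  have h := map_listPoly_mul_ratSeries φ (listPoly_mul_harmConv2 (s := 2) (L := 7)
    (d := listMul (listPow [1, -6] 3) (listPow [1, -24, 36] 2))
    (N := [0, 1, -61, 1339, -13106, 62284, -144264, 151776, -124416, 41472])
    (by norm_num) (by decide +kernel) (by decide +kernel) (by decide +kernel))
  have h0 : φ (1 - 6 * PowerSeries.X) ≠ 0 := map_series_ne_zero hφ (by simp)
  have h1 : φ (1 - 24 * PowerSeries.X + 36 * PowerSeries.X ^ 2) ≠ 0 := map_series_ne_zero hφ (by simp)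
  rw [gfH2Mod3, map_frac hφ _ _ (by simp)]
  simp only [listPoly_listMul, listPoly_listPow, Polynomial.coe_mul, Polynomial.coe_pow,
    map_map_listPoly, List.foldr, map_mul, map_sub, map_add, map_pow,
    map_ofNat, map_one] at h h0 h1 ⊢
  push_cast at h ⊢
  generalize φ PowerSeries.X = x at *
  generalize hD : 1 - 6 * x = D at *
  generalize hE : 1 - 24 * x + 36 * x ^ 2 = E at *
  field_simp
  subst hD
  subst hE
  linear_combination -h

theorem gfH2Mod3_eq : gfH2Mod3 = gfH2Mod3PF := by
  obtain ⟨K, _, _, φ, hφ⟩ := exists_embedding_field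
  apply hφ
  have h0 : φ (1 - 6 * PowerSeries.X) ≠ 0 := map_series_ne_zero hφ (by simp)
  have h1 : φ (1 - 24 * PowerSeries.X + 36 * PowerSeries.X ^ 2) ≠ 0 := map_series_ne_zero hφ (by simp)
  simp only [gfH2Mod3, gfH2Mod3PF, map_add φ, map_sub φ]
  rw [map_frac hφ _ _ (by simp), map_frac hφ _ _ (by simp), map_frac hφ _ _ (by simp), map_frac hφ _ _ (by simp), map_frac hφ _ _ (by simp), map_frac hφ _ _ (by simp)]
  simp only [map_mul, map_sub, map_add, map_pow,
    map_ofNat, map_one, map_neg, map_seriesC] at h0 h1 ⊢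
  push_cast
  generalize φ PowerSeries.X = x at *
  rw [show -1 + 6 * x = -(1 - 6 * x) by ring]
  generalize hD : 1 - 6 * x = D at *
  generalize hE : 1 - 24 * x + 36 * x ^ 2 = E at *
  field_simp
  subst hD
  subst hE
  ring

theorem gfH3Mod2_eq_ratSeries : gfH3Mod2 = ratSeries (harmConv3 2) := by
  obtain ⟨K, _, _, φ, hφ⟩ := exists_embedding_field
  apply hφ
  have h := map_listPoly_mul_ratSeries φ (listPoly_mul_harmConv3 (s := 1) (L := 2)
    (d := listPow [1, -8] 2)
    (N := [0, 1, -7, 49, -144, 192])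
    (by norm_num) (by decide +kernel) (by decide +kernel) (by decide +kernel))
  have h0 : φ (1 - 8 * PowerSeries.X) ≠ 0 := map_series_ne_zero hφ (by simp)
  rw [gfH3Mod2, map_frac hφ _ _ (by simp)]
  simp only [listPoly_listPow, Polynomial.coe_pow,
    map_map_listPoly, List.foldr, map_mul, map_sub, map_add, map_pow,
    map_ofNat, map_one] at h h0 ⊢
  push_cast at h ⊢
  generalize φ PowerSeries.X = x at *
  generalize hD : 1 - 8 * x = D at *
  field_simp
  subst hD
  linear_combination -h

theorem gfH3Mod2_eq : gfH3Mod2 = gfH3Mod2PF := by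
  obtain ⟨K, _, _, φ, hφ⟩ := exists_embedding_field
  apply hφ
  have h0 : φ (1 - 8 * PowerSeries.X) ≠ 0 := map_series_ne_zero hφ (by simp)
  simp only [gfH3Mod2, gfH3Mod2PF, map_add φ, map_sub φ]
  rw [map_frac hφ _ _ (by simp), map_frac hφ _ _ (by simp), map_frac hφ _ _ (by simp)]
  simp only [map_mul, map_sub, map_add, map_pow,
    map_ofNat, map_one, map_seriesC] at h0 ⊢
  push_cast
  generalize φ PowerSeries.X = x at *
  generalize hD : 1 - 8 * x = D at *
  field_simp
  subst hD
  ring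

theorem gfH3Mod3_eq_ratSeries : gfH3Mod3 = ratSeries (harmConv3 3) := by
  obtain ⟨K, _, _, φ, hφ⟩ := exists_embedding_field
  apply hφ
  have h := map_listPoly_mul_ratSeries φ (listPoly_mul_harmConv3 (s := 2) (L := 12)
    (d := listMul (listPow [1, -108, 216] 2) (listPow [1, -36, 216] 4))
    (N := [0, 1, -351, 48851, -3542176, 150385456, -3955064256, 66063530880, -706258745856,
      4853588594688, -21672367423488, 64777575591936, -141792698990592, 247456615956480,
      -270826551115776, 135413275557888])
    (by norm_num) (by decide +kernel) (by decide +kernel) (by decide +kernel))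
  have h0 : φ (1 - 108 * PowerSeries.X + 216 * PowerSeries.X ^ 2) ≠ 0 := map_series_ne_zero hφ (by simp)
  have h1 : φ (1 - 36 * PowerSeries.X + 216 * PowerSeries.X ^ 2) ≠ 0 := map_series_ne_zero hφ (by simp)
  simp only [gfH3Mod3, map_add φ, map_sub φ]
  rw [map_frac hφ _ _ (by simp), map_frac hφ _ _ (by simp), map_frac hφ _ _ (by simp), map_frac hφ _ _ (by simp), map_frac hφ _ _ (by simp), map_frac hφ _ _ (by simp)]
  simp only [listPoly_listMul, listPoly_listPow, Polynomial.coe_mul, Polynomial.coe_pow,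
    map_map_listPoly, List.foldr, map_mul, map_sub, map_add, map_pow,
    map_ofNat, map_one, map_neg, map_seriesC] at h h0 h1 ⊢
  push_cast at h ⊢
  generalize φ PowerSeries.X = x at *
  generalize hD : 1 - 108 * x + 216 * x ^ 2 = D at *
  generalize hE : 1 - 36 * x + 216 * x ^ 2 = E at *
  field_simp
  subst hD
  subst hE
  -- The constant is, up to sign, a common denominator of the rational coefficients of the partial
  -- fractions.
  linear_combination -364318593289782755328 * h

theorem gfH1Mod4A_eq : gfH1Mod4A =
    PowerSeries.X * ratSeries (fun n => stirlingConv 4 (n + 1) 2) := by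
  obtain ⟨K, _, _, φ, hφ⟩ := exists_embedding_field
  apply hφ
  have h := map_listPoly_mul_ratSeries φ (listPoly_mul_stirlingConv_two (s := 3) (L := 6)
    (d := listPow [-1, 12, -36, 24] 2)
    (N := [0, 1, -21, 155, -478, 586, -156, 36])
    (by norm_num) (by decide +kernel) (by decide +kernel) (by decide +kernel))
  have h0 : φ (24 * PowerSeries.X ^ 3 - 36 * PowerSeries.X ^ 2 + 12 * PowerSeries.X - 1) ≠ 0 := map_series_ne_zero hφ (by simp)
  simp only [gfH1Mod4A, map_add φ]
  rw [map_frac hφ _ _ (by simp), map_frac hφ _ _ (by simp)]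
  simp only [listPoly_listPow, Polynomial.coe_pow,
    map_map_listPoly, List.foldr, map_mul, map_sub, map_add, map_pow,
    map_ofNat, map_one, map_seriesC] at h h0 ⊢
  push_cast at h ⊢
  generalize φ PowerSeries.X = x at *
  generalize hD : 24 * x ^ 3 - 36 * x ^ 2 + 12 * x - 1 = D at *
  field_simp
  subst hD
  linear_combination -165888 * x * h

theorem gfH1Mod4B_eq : gfH1Mod4B = ratSeries (fun n => stirlingConv 4 (n + 1) 2) := by
  obtain ⟨K, _, _, φ, hφ⟩ := exists_embedding_field
  apply hφ
  have h := map_listPoly_mul_ratSeries φ (listPoly_mul_stirlingConv_two (s := 3) (L := 6)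
    (d := listPow [-1, 12, -36, 24] 2)
    (N := [0, 1, -21, 155, -478, 586, -156, 36])
    (by norm_num) (by decide +kernel) (by decide +kernel) (by decide +kernel))
  have h0 : φ (24 * PowerSeries.X ^ 3 - 36 * PowerSeries.X ^ 2 + 12 * PowerSeries.X - 1) ≠ 0 := map_series_ne_zero hφ (by simp)
  simp only [gfH1Mod4B, map_add φ]
  rw [map_frac hφ _ _ (by simp), map_frac hφ _ _ (by simp)]
  simp only [listPoly_listPow, Polynomial.coe_pow,
    map_map_listPoly, List.foldr, map_mul, map_sub, map_add, map_pow,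
    map_ofNat, map_one, map_seriesC] at h h0 ⊢
  push_cast at h ⊢
  generalize φ PowerSeries.X = x at *
  generalize hD : 24 * x ^ 3 - 36 * x ^ 2 + 12 * x - 1 = D at *
  field_simp
  subst hD
  linear_combination -4608 * h

/-- Multiplying by z avoids dividing the series by z, and matches the reading of coefficient n - 1
for n ≥ 1. -/
theorem X_mul_gfH1Mod4C : PowerSeries.X * gfH1Mod4C =
    ratSeries (fun n => stirlingConv 4 (n + 1) 2) := by
  obtain ⟨K, _, _, φ, hφ⟩ := exists_embedding_field
  apply hφ
  have h := map_listPoly_mul_ratSeries φ (listPoly_mul_stirlingConv_two (s := 3) (L := 6)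
    (d := listPow [-1, 12, -36, 24] 2)
    (N := [0, 1, -21, 155, -478, 586, -156, 36])
    (by norm_num) (by decide +kernel) (by decide +kernel) (by decide +kernel))
  have h0 : φ (24 * PowerSeries.X ^ 3 - 36 * PowerSeries.X ^ 2 + 12 * PowerSeries.X - 1) ≠ 0 := map_series_ne_zero hφ (by simp)
  simp only [gfH1Mod4C, map_mul φ, map_add φ]
  rw [map_frac hφ _ _ (by simp), map_frac hφ _ _ (by simp)]
  simp only [listPoly_listPow, Polynomial.coe_pow,
    map_map_listPoly, List.foldr, map_mul, map_sub, map_add, map_pow,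
    map_ofNat, map_one, map_neg, map_seriesC] at h h0 ⊢
  push_cast at h ⊢
  generalize φ PowerSeries.X = x at *
  generalize hD : 24 * x ^ 3 - 36 * x ^ 2 + 12 * x - 1 = D at *
  field_simp
  subst hD
  linear_combination -18432 * h

theorem gfH1Mod5_eq : gfH1Mod5 = ratSeries (fun n => stirlingConv 5 (n + 1) 2) := by
  obtain ⟨K, _, _, φ, hφ⟩ := exists_embedding_field
  apply hφ
  have h := map_listPoly_mul_ratSeries φ (listPoly_mul_stirlingConv_two (s := 4) (L := 8)
    (d := listPow [1, -20, 120, -240, 120] 2)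
    (N := [0, 1, -37, 531, -3750, 13714, -24956, 19708, -3696, 576])
    (by norm_num) (by decide +kernel) (by decide +kernel) (by decide +kernel))
  have h0 : φ (120 * PowerSeries.X ^ 4 - 240 * PowerSeries.X ^ 3 + 120 * PowerSeries.X ^ 2 - 20 * PowerSeries.X + 1) ≠ 0 := map_series_ne_zero hφ (by simp)
  simp only [gfH1Mod5, map_add φ]
  rw [map_frac hφ _ _ (by simp), map_frac hφ _ _ (by simp)]
  simp only [listPoly_listPow, Polynomial.coe_pow,
    map_map_listPoly, List.foldr, map_mul, map_sub, map_add, map_pow,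
    map_ofNat, map_one, map_seriesC] at h h0 ⊢
  push_cast at h ⊢
  generalize φ PowerSeries.X = x at *
  generalize hD : 120 * x ^ 4 - 240 * x ^ 3 + 120 * x ^ 2 - 20 * x + 1 = D at *
  field_simp
  subst hD
  linear_combination -270000 * h

theorem gfH1Mod6_eq : gfH1Mod6 = ratSeries (fun n => stirlingConv 6 (n + 1) 2) := by
  obtain ⟨K, _, _, φ, hφ⟩ := exists_embedding_field
  apply hφ
  have h := map_listPoly_mul_ratSeries φ (listPoly_mul_stirlingConv_two (s := 5) (L := 10)
    (d := listPow [-1, 30, -300, 1200, -1800, 720] 2)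
    (N := [0, 1, -57, 1331, -16510, 118174, -496716, 1194708, -1524336, 877536, -125280, 14400])
    (by norm_num) (by decide +kernel) (by decide +kernel) (by decide +kernel))
  have h0 : φ (720 * PowerSeries.X ^ 5 - 1800 * PowerSeries.X ^ 4 + 1200 * PowerSeries.X ^ 3 - 300 * PowerSeries.X ^ 2 + 30 * PowerSeries.X - 1) ≠ 0 := map_series_ne_zero hφ (by simp)
  simp only [gfH1Mod6, map_add φ]
  rw [map_frac hφ _ _ (by simp), map_frac hφ _ _ (by simp)]
  simp only [listPoly_listPow, Polynomial.coe_pow,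
    map_map_listPoly, List.foldr, map_mul, map_sub, map_add, map_pow,
    map_ofNat, map_one, map_seriesC] at h h0 ⊢
  push_cast at h ⊢
  generalize φ PowerSeries.X = x at *
  generalize hD : 720 * x ^ 5 - 1800 * x ^ 4 + 1200 * x ^ 3 - 300 * x ^ 2 + 30 * x - 1 = D at *
  field_simp
  subst hD
  linear_combination -777600 * h

/-! ### Harmonic numbers -/

theorem congrMod_of_modEq {K : Type*} [Field K] {p : ℕ} {a b : ℤ} (h : a ≡ b [ZMOD p]) :
    CongrMod p (a : K) (b : K) := by
  obtain ⟨k, hk⟩ := h.symm.dvd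
  refine ⟨k, ?_⟩
  rw [← Int.cast_sub, hk, mul_comm]
  push_cast
  rfl

theorem congrMod_stirlingFirst {K : Type*} [Field K] {p n m : ℕ} {b : ℤ}
    (h : (n.stirlingFirst m : ℤ) ≡ b [ZMOD p]) : CongrMod p (n.stirlingFirst m : K) (b : K) := by
  simpa using congrMod_of_modEq (K := K) h

theorem scaledHarmonic_zero (r : ℕ) : scaledHarmonic r 0 = 0 := by
  simp [scaledHarmonic, genHarmonic]

theorem scaledHarmonic_succ (r n : ℕ) : scaledHarmonic r (n + 1) =
    ((n : ℚ) + 1) ^ r * scaledHarmonic r n + (n.factorial : ℚ) ^ r := by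
  have hn : (n : ℚ) + 1 ≠ 0 := by positivity
  rw [scaledHarmonic, scaledHarmonic, genHarmonic, genHarmonic, Finset.sum_Icc_succ_top (by omega),
    Nat.factorial_succ]
  push_cast
  rw [mul_add, mul_pow]
  field_simp

theorem scaledHarmonic_one_eq (n : ℕ) : scaledHarmonic 1 n = ((n + 1).stirlingFirst 2 : ℚ) := by
  induction n with
  | zero => simp [scaledHarmonic_zero, Nat.stirlingFirst_eq_zero_of_lt]
  | succ n ih =>
    rw [scaledHarmonic_succ, ih, Nat.stirlingFirst_succ_succ (n + 1) 1,
      Nat.stirlingFirst_one_right]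
    push_cast
    ring

/-- Newton's identity: the Stirling number at (n + 1, k + 1) is n! times the k-th elementary
symmetric function of 1, 1/2, …, 1/n. The recurrences of both sides verify it directly. -/
theorem scaledHarmonic_two_eq (n : ℕ) : scaledHarmonic 2 n =
    ((n + 1).stirlingFirst 2 : ℚ) ^ 2 -
      2 * (n + 1).stirlingFirst 1 * (n + 1).stirlingFirst 3 := by
  induction n with
  | zero => simp [scaledHarmonic_zero, Nat.stirlingFirst_eq_zero_of_lt]
  | succ n ih =>
    rw [scaledHarmonic_succ, ih, Nat.stirlingFirst_succ_succ (n + 1) 1,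
      Nat.stirlingFirst_succ_succ (n + 1) 2, Nat.stirlingFirst_one_right,
      Nat.stirlingFirst_one_right, Nat.factorial_succ]
    push_cast
    ring

theorem scaledHarmonic_three_eq (n : ℕ) : scaledHarmonic 3 n =
    ((n + 1).stirlingFirst 2 : ℚ) ^ 3 -
      3 * (n + 1).stirlingFirst 1 * (n + 1).stirlingFirst 2 * (n + 1).stirlingFirst 3 +
      3 * ((n + 1).stirlingFirst 1 : ℚ) ^ 2 * (n + 1).stirlingFirst 4 := by
  induction n with
  | zero => simp [scaledHarmonic_zero, Nat.stirlingFirst_eq_zero_of_lt]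
  | succ n ih =>
    rw [scaledHarmonic_succ, ih, Nat.stirlingFirst_succ_succ (n + 1) 1,
      Nat.stirlingFirst_succ_succ (n + 1) 2, Nat.stirlingFirst_succ_succ (n + 1) 3,
      Nat.stirlingFirst_one_right, Nat.stirlingFirst_one_right, Nat.factorial_succ]
    push_cast
    ring

theorem congrMod_scaledHarmonic_one {p : ℕ} (hp : 1 ≤ p) (n : ℕ) :
    CongrMod p (scaledHarmonic 1 n) (stirlingConv p (n + 1) 2 : ℚ) := by
  rw [scaledHarmonic_one_eq]
  exact congrMod_stirlingFirst (stirlingFirst_modEq_stirlingConv hp _ _)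

theorem congrMod_scaledHarmonic_two {p : ℕ} (hp : 1 ≤ p) (n : ℕ) :
    CongrMod p (scaledHarmonic 2 n) (harmConv2 p n : ℚ) := by
  have h := stirlingFirst_modEq_stirlingConv hp (n + 1)
  have := congrMod_of_modEq (K := ℚ) (((h 2).pow 2).sub (((h 1).mul_left 2).mul (h 3)))
  rw [scaledHarmonic_two_eq]
  unfold harmConv2
  push_cast at this ⊢
  exact this

theorem congrMod_scaledHarmonic_three {p : ℕ} (hp : 1 ≤ p) (n : ℕ) :
    CongrMod p (scaledHarmonic 3 n) (harmConv3 p n : ℚ) := by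
  have h := stirlingFirst_modEq_stirlingConv hp (n + 1)
  have := congrMod_of_modEq (K := ℚ) ((((h 2).pow 3).sub
    ((((h 1).mul_left 3).mul (h 2)).mul (h 3))).add ((((h 1).pow 2).mul_left 3).mul (h 4)))
  rw [scaledHarmonic_three_eq]
  unfold harmConv3
  push_cast at this ⊢
  exact this

theorem coeff_ratSeries (a : ℕ → ℤ) (n : ℕ) : PowerSeries.coeff n (ratSeries a) = a n := by
  rw [ratSeries, PowerSeries.coeff_mk]

theorem congrMod_gfH1Mod4A (n : ℕ) :
    CongrMod 4 (scaledHarmonic 1 n) (PowerSeries.coeff (n + 1) gfH1Mod4A) := by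
  rw [gfH1Mod4A_eq, PowerSeries.coeff_succ_X_mul, coeff_ratSeries]
  exact congrMod_scaledHarmonic_one (by norm_num) n

theorem congrMod_gfH1Mod4B (n : ℕ) :
    CongrMod 4 (scaledHarmonic 1 n) (PowerSeries.coeff n gfH1Mod4B) := by
  rw [gfH1Mod4B_eq, coeff_ratSeries]
  exact congrMod_scaledHarmonic_one (by norm_num) n

theorem congrMod_gfH1Mod4C {n : ℕ} (hn : 1 ≤ n) :
    CongrMod 4 (scaledHarmonic 1 n) (PowerSeries.coeff (n - 1) gfH1Mod4C) := by
  obtain ⟨n, rfl⟩ : ∃ k, n = k + 1 := ⟨n - 1, by omega⟩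
  rw [Nat.add_sub_cancel, ← PowerSeries.coeff_succ_X_mul, X_mul_gfH1Mod4C, coeff_ratSeries]
  exact congrMod_scaledHarmonic_one (by norm_num) (n + 1)

theorem congrMod_gfH1Mod5 (n : ℕ) :
    CongrMod 5 (scaledHarmonic 1 n) (PowerSeries.coeff n gfH1Mod5) := by
  rw [gfH1Mod5_eq, coeff_ratSeries]
  exact congrMod_scaledHarmonic_one (by norm_num) n

theorem congrMod_gfH1Mod6 (n : ℕ) :
    CongrMod 6 (scaledHarmonic 1 n) (PowerSeries.coeff n gfH1Mod6) := by
  rw [gfH1Mod6_eq, coeff_ratSeries]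
  exact congrMod_scaledHarmonic_one (by norm_num) n

theorem congrMod_gfH2Mod2 (n : ℕ) :
    CongrMod 2 (scaledHarmonic 2 n) (PowerSeries.coeff n gfH2Mod2) := by
  rw [gfH2Mod2_eq_ratSeries, coeff_ratSeries]
  exact congrMod_scaledHarmonic_two (by norm_num) n

theorem congrMod_gfH2Mod3 (n : ℕ) :
    CongrMod 3 (scaledHarmonic 2 n) (PowerSeries.coeff n gfH2Mod3) := by
  rw [gfH2Mod3_eq_ratSeries, coeff_ratSeries]
  exact congrMod_scaledHarmonic_two (by norm_num) n

theorem congrMod_gfH3Mod2 (n : ℕ) :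
    CongrMod 2 (scaledHarmonic 3 n) (PowerSeries.coeff n gfH3Mod2) := by
  rw [gfH3Mod2_eq_ratSeries, coeff_ratSeries]
  exact congrMod_scaledHarmonic_three (by norm_num) n

theorem congrMod_gfH3Mod3 (n : ℕ) :
    CongrMod 3 (scaledHarmonic 3 n) (PowerSeries.coeff n gfH3Mod3) := by
  rw [gfH3Mod3_eq_ratSeries, coeff_ratSeries]
  exact congrMod_scaledHarmonic_three (by norm_num) n

theorem listPoly_one_mul (f : ℤ⟦X⟧) : (listPoly [1] : ℤ⟦X⟧) * f = f := by
  simp [listPoly]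

theorem map_coeff_harmConv2 {h : ℕ} (hh : 1 ≤ h) {N : List ℤ}
    (hc : checkSeriesStart 0 1 1 h 4 harmList2 [1] N.length (N.map some) = true) :
    (List.range N.length).map (fun n => PowerSeries.coeff n (ratSeries (harmConv2 h))) =
      N.map (fun x : ℤ => (x : ℚ)) := by
  refine List.ext_getElem (by simp) fun i hi hi' => ?_
  have := Int.modEq_zero_iff.1 (checkSeriesStart_sound (x := N.getD i 0) hh isCoprime_one_right
    harmList2_modEq (fun n => (harmList2_coeffsFrom 1 _ n).trans (by rw [one_pow])) hc i
    (by simpa using hi) (by simp))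
  rw [listPoly_one_mul, PowerSeries.coeff_mk] at this
  simp only [List.getElem_map, List.getElem_range, coeff_ratSeries, this]
  rw [List.getD_eq_getElem]

theorem map_coeff_harmConv3 {h : ℕ} (hh : 1 ≤ h) {N : List ℤ}
    (hc : checkSeriesStart 0 1 1 h 5 harmList3 [1] N.length (N.map some) = true) :
    (List.range N.length).map (fun n => PowerSeries.coeff n (ratSeries (harmConv3 h))) =
      N.map (fun x : ℤ => (x : ℚ)) := by
  refine List.ext_getElem (by simp) fun i hi hi' => ?_
  have := Int.modEq_zero_iff.1 (checkSeriesStart_sound (x := N.getD i 0) hh isCoprime_one_right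
    harmList3_modEq (fun n => (harmList3_coeffsFrom 1 _ n).trans (by rw [one_pow])) hc i
    (by simpa using hi) (by simp))
  rw [listPoly_one_mul, PowerSeries.coeff_mk] at this
  simp only [List.getElem_map, List.getElem_range, coeff_ratSeries, this]
  rw [List.getD_eq_getElem]

theorem map_coeff_gfH2Mod2 : (List.range 7).map (fun n => PowerSeries.coeff n gfH2Mod2) =
    [0, 1, 5, 33, 176, 880, 4224] := by
  rw [gfH2Mod2_eq_ratSeries]
  refine (map_coeff_harmConv2 (N := [0, 1, 5, 33, 176, 880, 4224]) (by norm_num)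
    (by decide +kernel)).trans (by norm_num)

theorem map_coeff_gfH2Mod3 : (List.range 7).map (fun n => PowerSeries.coeff n gfH2Mod3) =
    [0, 1, 5, 49, 820, 18232, 437616] := by
  rw [gfH2Mod3_eq_ratSeries]
  refine (map_coeff_harmConv2 (N := [0, 1, 5, 49, 820, 18232, 437616]) (by norm_num)
    (by decide +kernel)).trans (by norm_num)

theorem map_coeff_gfH3Mod2 : (List.range 7).map (fun n => PowerSeries.coeff n gfH3Mod2) =
    [0, 1, 9, 129, 1344, 13440, 129024] := by
  rw [gfH3Mod2_eq_ratSeries]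
  refine (map_coeff_harmConv3 (N := [0, 1, 9, 129, 1344, 13440, 129024]) (by norm_num)
    (by decide +kernel)).trans (by norm_num)

theorem map_coeff_gfH3Mod3 : (List.range 7).map (fun n => PowerSeries.coeff n gfH3Mod3) =
    [0, 1, 9, 251, 16280, 1586800, 171547200] := by
  rw [gfH3Mod3_eq_ratSeries]
  refine (map_coeff_harmConv3 (N := [0, 1, 9, 251, 16280, 1586800, 171547200]) (by norm_num)
    (by decide +kernel)).trans (by norm_num)

/-- The coefficient of z^n in the remainder formula, solved for p_n(1, R); this is possible because
FQ_h has constant term 1. The error keeps its factor h!. -/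
theorem exists_genProd_eq (h n : ℕ) : ∃ c : ℤ[X], (n < 2 * h → c = 0) ∧
    genProd 1 Polynomial.X n = -(∑ k ∈ Finset.range n, (h.choose (n - k) : ℤ[X]) *
      genProd 1 (1 - (h : ℤ[X]) - Polynomial.X) (n - k) * genProd 1 Polynomial.X k) +
      (convP (1 : ℤ[X]) Polynomial.X h).coeff n + (h.factorial : ℤ[X]) * c := by
  have key := congrArg (PowerSeries.coeff n) (convQ_mul_mk_genProd (1 : ℤ[X]) Polynomial.X h)
  refine ⟨genProd 1 Polynomial.X h *
    PowerSeries.coeff n (PowerSeries.X ^ (2 * h) * convRem (1 : ℤ[X]) Polynomial.X h),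
    fun hn => ?_, ?_⟩
  · rw [PowerSeries.coeff_X_pow_mul', if_neg (by omega), mul_zero]
  · rw [map_add, mul_assoc (PowerSeries.C _), PowerSeries.coeff_C_mul, one_pow, one_mul, mul_assoc,
      Polynomial.coeff_coe, mul_comm _ (PowerSeries.mk _), PowerSeries.coeff_mul,
      Finset.Nat.sum_antidiagonal_eq_sum_range_succ_mk, Finset.sum_range_succ, Nat.sub_self,
      Polynomial.coeff_coe, coeff_zero_convQ, mul_one, PowerSeries.coeff_mk] at key
    rw [add_assoc, ← key, ← add_assoc, add_eq_right.2]
    rw [neg_add_eq_zero]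
    refine Finset.sum_congr rfl fun k _ => ?_
    rw [PowerSeries.coeff_mk, Polynomial.coeff_coe, coeff_convQ, mul_one, mul_comm]

theorem scaledHarmonic_one_sub_one {n : ℕ} (hn : 1 ≤ n) :
    scaledHarmonic 1 (n - 1) = (((genProd (1 : ℤ[X]) Polynomial.X n).coeff 2 : ℤ) : ℚ) := by
  rw [scaledHarmonic_one_eq, Nat.sub_add_cancel hn, ← stirlingFirst_eq_coeff_genProd,
    Int.cast_natCast]

theorem scaledHarmonic_one_eq_convP {h n : ℕ} (hh : 1 ≤ h) (hn : 1 ≤ n) (hnh : n ≤ h) :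
    scaledHarmonic 1 (n - 1) =
      (((-(∑ k ∈ Finset.range n, (h.choose (n - k) : ℤ[X]) *
          genProd 1 (1 - (h : ℤ[X]) - Polynomial.X) (n - k) * genProd 1 Polynomial.X k) +
        (convP (1 : ℤ[X]) Polynomial.X h).coeff n).coeff 2 : ℤ) : ℚ) := by
  obtain ⟨c, hc, e⟩ := exists_genProd_eq h n
  rw [scaledHarmonic_one_sub_one hn, e, hc (by omega), mul_zero, add_zero]

/-- For n ≥ h the numerator FP_h has no coefficient of z^n, and the remaining error is divisible by
h!, hence by h. -/
theorem congrMod_scaledHarmonic_one_sum {h n : ℕ} (hh : 1 ≤ h) (hn : h ≤ n) :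
    CongrMod h (scaledHarmonic 1 (n - 1))
      (((-(∑ k ∈ Finset.range n, (h.choose (n - k) : ℤ[X]) *
          genProd 1 (1 - (h : ℤ[X]) - Polynomial.X) (n - k) *
            genProd 1 Polynomial.X k)).coeff 2 : ℤ) : ℚ) := by
  obtain ⟨c, hc, e⟩ := exists_genProd_eq h n
  rw [scaledHarmonic_one_sub_one (by omega)]
  refine congrMod_of_modEq ?_
  rw [e, coeff_convP_of_le _ _ _ _ hn, add_zero, Polynomial.coeff_add, Polynomial.coeff_natCast_mul]
  refine Int.modEq_iff_dvd.2 ?_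
  rw [sub_add_cancel_left, dvd_neg]
  exact Dvd.dvd.mul_right (Int.natCast_dvd_natCast.2 (Nat.dvd_factorial (by omega) le_rfl)) _

/-! ### Stirling numbers modulo 2 and modulo 3 -/

theorem genProd_map {A B : Type*} [CommRing A] [CommRing B] (f : A →+* B) (α R : A) (n : ℕ) :
    f (genProd α R n) = genProd (f α) (f R) n := by
  simp [genProd]

theorem coeff_modEq_of_map_eq {p : ℕ} {P Q : ℤ[X]}
    (h : P.map (Int.castRingHom (ZMod p)) = Q.map (Int.castRingHom (ZMod p))) (m : ℕ) :
    P.coeff m ≡ Q.coeff m [ZMOD p] := by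
  rw [← ZMod.intCast_eq_intCast_iff]
  simpa using congrArg (fun r => Polynomial.coeff r m) h

/-- In characteristic 2 the factor R + j depends only on the parity of j, so the product collapses
to counting even and odd j below n. -/
theorem genProd_one_of_two_eq_zero {A : Type*} [CommRing A] (h2 : (2 : A) = 0) (R : A) (n : ℕ) :
    genProd 1 R n = R ^ ((n + 1) / 2) * (R + 1) ^ (n / 2) := by
  have key : ∀ k : ℕ, genProd 1 R (2 * k) = R ^ k * (R + 1) ^ k := by
    intro k
    induction k with
    | zero => simp [genProd_zero]
    | succ k ih =>
      rw [show 2 * (k + 1) = 2 * k + 1 + 1 by ring, genProd_succ, genProd_succ, ih]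
      push_cast
      rw [h2]
      ring
  rcases Nat.even_or_odd' n with ⟨k, rfl | rfl⟩
  · rw [key, show (2 * k + 1) / 2 = k by omega, show 2 * k / 2 = k by omega]
  · rw [genProd_succ, key, show (2 * k + 1 + 1) / 2 = k + 1 by omega,
      show (2 * k + 1) / 2 = k by omega]
    push_cast
    rw [h2]
    ring

theorem genProd_one_of_three_eq_zero {A : Type*} [CommRing A] (h3 : (3 : A) = 0) (R : A) (n : ℕ) :
    genProd 1 R n = R ^ ((n + 2) / 3) * (R + 1) ^ ((n + 1) / 3) * (R + 2) ^ (n / 3) := by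
  have key : ∀ k : ℕ, genProd 1 R (3 * k) = R ^ k * (R + 1) ^ k * (R + 2) ^ k := by
    intro k
    induction k with
    | zero => simp [genProd_zero]
    | succ k ih =>
      rw [show 3 * (k + 1) = 3 * k + 1 + 1 + 1 by ring, genProd_succ, genProd_succ, genProd_succ,
        ih]
      push_cast
      rw [h3]
      ring
  obtain ⟨k, rfl | rfl | rfl⟩ : ∃ k, n = 3 * k ∨ n = 3 * k + 1 ∨ n = 3 * k + 2 :=
    ⟨n / 3, by omega⟩
  · rw [key, show (3 * k + 2) / 3 = k by omega, show (3 * k + 1) / 3 = k by omega,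
      show 3 * k / 3 = k by omega]
  · rw [genProd_succ, key, show (3 * k + 1 + 2) / 3 = k + 1 by omega,
      show (3 * k + 1 + 1) / 3 = k by omega, show (3 * k + 1) / 3 = k by omega]
    push_cast
    rw [h3]
    ring
  · rw [genProd_succ, genProd_succ, key, show (3 * k + 2 + 2) / 3 = k + 1 by omega,
      show (3 * k + 2 + 1) / 3 = k + 1 by omega, show (3 * k + 2) / 3 = k by omega]
    push_cast
    rw [h3]
    ring

theorem map_genProd_X {p : ℕ} (n : ℕ) :
    (genProd (1 : ℤ[X]) Polynomial.X n).map (Int.castRingHom (ZMod p)) =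
      genProd 1 Polynomial.X n := by
  have := genProd_map (Polynomial.mapRingHom (Int.castRingHom (ZMod p))) 1 Polynomial.X n
  simpa using this

theorem stirlingFirst_modEq_two (n m : ℕ) : (n.stirlingFirst m : ℤ) ≡
    ((Polynomial.X : ℤ[X]) ^ ((n + 1) / 2) * (Polynomial.X + 1) ^ (n / 2)).coeff m [ZMOD 2] := by
  rw [stirlingFirst_eq_coeff_genProd]
  refine coeff_modEq_of_map_eq (p := 2) ?_ m
  have h2 : (2 : (ZMod 2)[X]) = 0 := by
    rw [← map_ofNat (Polynomial.C (R := ZMod 2)) 2, show (OfNat.ofNat 2 : ZMod 2) = 0 from rfl,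
      map_zero]
  rw [map_genProd_X, genProd_one_of_two_eq_zero h2]
  simp

theorem stirlingFirst_modEq_three (n m : ℕ) : (n.stirlingFirst m : ℤ) ≡
    ((Polynomial.X : ℤ[X]) ^ ((n + 2) / 3) * (Polynomial.X + 1) ^ ((n + 1) / 3) *
      (Polynomial.X + 2) ^ (n / 3)).coeff m [ZMOD 3] := by
  rw [stirlingFirst_eq_coeff_genProd]
  refine coeff_modEq_of_map_eq (p := 3) ?_ m
  have h3 : (3 : (ZMod 3)[X]) = 0 := by
    rw [← map_ofNat (Polynomial.C (R := ZMod 3)) 3, show (OfNat.ofNat 3 : ZMod 3) = 0 from rfl,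
      map_zero]
  rw [map_genProd_X, genProd_one_of_three_eq_zero h3]
  simp

theorem binomZ_sub_eq_coeff (a b m : ℕ) : (binomZ b ((m : ℤ) - a) : ℤ) =
    ((Polynomial.X : ℤ[X]) ^ a * (Polynomial.X + 1) ^ b).coeff m := by
  rw [Polynomial.coeff_X_pow_mul', binomZ]
  by_cases h : a ≤ m
  · rw [if_pos h, if_pos (by omega), Polynomial.coeff_X_add_one_pow,
      show ((m : ℤ) - a).toNat = m - a by omega]
  · rw [if_neg h, if_neg (by omega), Nat.cast_zero]

/-- Signs do not matter modulo 2, so the sum is the value at n of X^⌈n/2⌉ (X + 1)^⌊n/2⌋. For n ≥ 2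
both sides are even, since n or n + 1 is; n = 1 is checked directly. -/
theorem factorial_modEq_two_sum {n : ℕ} (hn : 1 ≤ n) : (n.factorial : ℤ) ≡
    ∑ m ∈ Finset.Icc 1 n,
      (binomZ (n / 2) ((m : ℤ) - ((n + 1) / 2 : ℕ)) : ℤ) * (-1) ^ (n - m) * (n : ℤ) ^ m +
      (if n = 0 then 1 else 0) [ZMOD 2] := by
  set P : ℤ[X] := Polynomial.X ^ ((n + 1) / 2) * (Polynomial.X + 1) ^ (n / 2) with hP
  have hdeg : P.natDegree < n + 1 := by
    refine lt_of_le_of_lt (Polynomial.natDegree_mul_le.trans (add_le_add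
      (Polynomial.natDegree_X_pow_le _) (Polynomial.natDegree_pow_le.trans
        (Nat.mul_le_mul_left _ (show (Polynomial.X + 1 : ℤ[X]).natDegree ≤ 1 by compute_degree)))))
      (by omega)
  have heval : P.eval (n : ℤ) = ∑ m ∈ Finset.Icc 1 n, P.coeff m * (n : ℤ) ^ m := by
    rw [Polynomial.eval_eq_sum_range' hdeg, Finset.sum_range_succ', pow_zero, mul_one,
      show P.coeff 0 = 0 by rw [hP, Polynomial.coeff_X_pow_mul', if_neg (by omega)], add_zero,
      Finset.range_eq_Ico, Finset.sum_Ico_add' (fun m => P.coeff m * (n : ℤ) ^ m) 0 n 1]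
    rfl
  rw [if_neg (by omega), add_zero]
  have hsum : ∑ m ∈ Finset.Icc 1 n,
      (binomZ (n / 2) ((m : ℤ) - ((n + 1) / 2 : ℕ)) : ℤ) * (-1) ^ (n - m) * (n : ℤ) ^ m ≡
      P.eval (n : ℤ) [ZMOD 2] := by
    rw [heval]
    refine Int.ModEq.sum fun m _ => ?_
    rw [binomZ_sub_eq_coeff, mul_assoc]
    refine Int.ModEq.mul_left _ ?_
    have : (-1 : ℤ) ^ (n - m) ≡ 1 ^ (n - m) [ZMOD 2] := Int.ModEq.pow _ rfl
    rw [one_pow] at this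
    simpa using this.mul_right ((n : ℤ) ^ m)
  refine Int.ModEq.trans ?_ hsum.symm
  rw [hP, Polynomial.eval_mul, Polynomial.eval_pow, Polynomial.eval_pow, Polynomial.eval_add,
    Polynomial.eval_X, Polynomial.eval_one]
  rcases Nat.lt_or_ge n 2 with h | h
  · obtain rfl : n = 1 := by omega
    rfl
  · have h1 : (n.factorial : ℤ) ≡ 0 [ZMOD 2] :=
      Int.modEq_zero_iff_dvd.2 (by exact_mod_cast Nat.dvd_factorial (by norm_num) h)
    refine h1.trans (Int.modEq_zero_iff_dvd.2 ?_).symm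
    rcases Nat.even_or_odd n with he | ho
    · exact Dvd.dvd.mul_right (dvd_pow (by exact_mod_cast he.two_dvd) (by omega)) _
    · exact Dvd.dvd.mul_left (dvd_pow (by exact_mod_cast (ho.add_one).two_dvd) (by omega)) _

theorem coeff_three_product (a b c m : ℕ) :
    ((((Polynomial.X : ℤ[X]) ^ a * (Polynomial.X + 1) ^ b * (Polynomial.X + 2) ^ c).coeff m : ℤ) :
      ℚ) = ∑ k ∈ Finset.range (m + 1), (b.choose k : ℚ) *
        (binomZ c ((m : ℤ) - k - (a : ℕ)) : ℚ) * (2 : ℚ) ^ ((a : ℤ) + c - ((m : ℤ) - k)) := by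
  have e : (Polynomial.X : ℤ[X]) ^ a * (Polynomial.X + 1) ^ b * (Polynomial.X + 2) ^ c =
      (Polynomial.X + 1) ^ b * (Polynomial.X ^ a * (Polynomial.X + Polynomial.C 2) ^ c) := by
    rw [map_ofNat]
    ring
  rw [e, Polynomial.coeff_mul, Finset.Nat.sum_antidiagonal_eq_sum_range_succ_mk, Int.cast_sum]
  refine Finset.sum_congr rfl fun k hk => ?_
  have hk := Finset.mem_range.1 hk
  rw [Polynomial.coeff_X_add_one_pow, Polynomial.coeff_X_pow_mul', Int.cast_mul, mul_assoc,
    Int.cast_natCast, binomZ]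
  congr 1
  by_cases h : a ≤ m - k
  · rw [if_pos h, if_pos (by omega), Polynomial.coeff_X_add_C_pow,
      show ((m : ℤ) - k - a).toNat = m - k - a by omega]
    -- The exponent of 2 is negative exactly when the binomial coefficient vanishes, so the rational
    -- power does no harm.
    rcases lt_or_ge c (m - k - a) with hc | hc
    · rw [Nat.choose_eq_zero_of_lt hc]
      simp
    · rw [show (a : ℤ) + c - ((m : ℤ) - k) = ((c - (m - k - a) : ℕ) : ℤ) by omega, zpow_natCast]
      push_cast
      ring
  · rw [if_neg h, if_neg (by omega)]
    simp

theorem congrMod_three_sum (n m : ℕ) : CongrMod 3 (n.stirlingFirst m : ℚ)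
    (∑ k ∈ Finset.range (m + 1), (((n + 1) / 3).choose k : ℚ) *
      (binomZ (n / 3) ((m : ℤ) - k - ((n + 2) / 3 : ℕ)) : ℚ) *
      (2 : ℚ) ^ (((n + 2) / 3 : ℕ) + (n / 3 : ℕ) - ((m : ℤ) - k))) := by
  rw [← coeff_three_product]
  exact congrMod_stirlingFirst (stirlingFirst_modEq_three n m)

/-! ### Closed forms for `h = 2` and `h = 3` -/

/-- The sequence shifted by one place. -/
def seqPre (f : ℕ → ℤ) : ℕ → ℤ
  | 0 => 0
  | m + 1 => f m

theorem coeff_X_mul_eq_seqPre (p : ℤ[X]) :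
    (Polynomial.X * p).coeff = seqPre p.coeff := by
  funext m
  cases m with
  | zero => simp [seqPre]
  | succ m => simp [seqPre, Polynomial.coeff_X_mul]

/-- The coefficients of `Conv_2(1, R; z)`. -/
def convTwo : ℕ → ℕ → ℤ
  | 0 => fun m => if m = 0 then 1 else 0
  | 1 => seqPre fun m => if m = 0 then 1 else 0
  | n + 2 => fun m => 2 * convTwo (n + 1) m + 2 * seqPre (convTwo (n + 1)) m -
      seqPre (convTwo n) m - seqPre (seqPre (convTwo n)) m

/-- The coefficients of `Conv_3(1, R; z)`. -/
def convThree : ℕ → ℕ → ℤ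
  | 0 => fun m => if m = 0 then 1 else 0
  | 1 => seqPre fun m => if m = 0 then 1 else 0
  | 2 => fun m => if m = 1 ∨ m = 2 then 1 else 0
  | n + 3 => fun m => 6 * convThree (n + 2) m + 3 * seqPre (convThree (n + 2)) m -
      6 * convThree (n + 1) m - 9 * seqPre (convThree (n + 1)) m -
      3 * seqPre (seqPre (convThree (n + 1))) m + 2 * seqPre (convThree n) m +
      3 * seqPre (seqPre (convThree n)) m + seqPre (seqPre (seqPre (convThree n))) m

theorem coeff_convRow_one {h : ℕ} (hh : 2 ≤ h) : (convRow h 1).coeff =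
    seqPre fun m => if m = 0 then 1 else 0 := by
  rw [show (1 : ℕ) = 0 + 1 from rfl, convRow_succ (by omega), convRow_zero (by omega), mul_one,
    Nat.cast_zero, map_zero, zero_add, ← mul_one (Polynomial.X : ℤ[X]), coeff_X_mul_eq_seqPre]
  congr 1
  funext m
  rw [Polynomial.coeff_one]

theorem coeff_convRow_two (n : ℕ) : (convRow 2 n).coeff = convTwo n := by
  induction n using Nat.twoStepInduction with
  | zero =>
    funext m
    rw [convRow_zero (by norm_num), Polynomial.coeff_one, convTwo]
  | one => rw [coeff_convRow_one le_rfl, convTwo]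
  | more n ih0 ih1 =>
    -- This is the recurrence read from FQ_2 = 1 - 2(R + 1) z + R(R + 1) z².
    have e : convRow 2 (n + 2) = Polynomial.C 2 * convRow 2 (n + 1) +
        Polynomial.C 2 * (Polynomial.X * convRow 2 (n + 1)) - Polynomial.X * convRow 2 n -
        Polynomial.X * (Polynomial.X * convRow 2 n) := by
      rw [convRow_rec]
      simp only [Finset.sum_range_succ, Finset.sum_range_zero, genProd_succ, genProd_zero,
        show n + 2 - 1 - 0 = n + 1 by omega, show n + 2 - 1 - 1 = n by omega, map_ofNat]
      norm_num
      ring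
    funext m
    rw [e, Polynomial.coeff_sub, Polynomial.coeff_sub, Polynomial.coeff_add, Polynomial.coeff_C_mul,
      Polynomial.coeff_C_mul, coeff_X_mul_eq_seqPre, coeff_X_mul_eq_seqPre, coeff_X_mul_eq_seqPre,
      coeff_X_mul_eq_seqPre, ih0, ih1, convTwo]

theorem coeff_convRow_three (n : ℕ) : (convRow 3 n).coeff = convThree n := by
  have h1 := coeff_convRow_one (h := 3) (by norm_num)
  induction n using Nat.strong_induction_on with
  | _ n ih =>
  match n with
  | 0 =>
    funext m
    rw [convRow_zero (by norm_num), Polynomial.coeff_one, convThree]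
  | 1 => rw [h1, convThree]
  | 2 =>
    funext m
    have e : convRow 3 2 = convRow 3 1 + Polynomial.X * convRow 3 1 := by
      rw [show (2 : ℕ) = 1 + 1 from rfl, convRow_succ (by norm_num)]
      push_cast
      rw [map_one]
      ring
    rw [e, Polynomial.coeff_add, coeff_X_mul_eq_seqPre, h1, convThree]
    match m with
    | 0 => rfl
    | 1 => rfl
    | 2 => rfl
    | m + 3 => simp [seqPre]
  | n + 3 =>
    -- Here FQ_3 = 1 - 3(R + 2) z + 3(R + 1)(R + 2) z² - R(R + 1)(R + 2) z³.
    have e : convRow 3 (n + 3) = Polynomial.C 6 * convRow 3 (n + 2) +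
        Polynomial.C 3 * (Polynomial.X * convRow 3 (n + 2)) - Polynomial.C 6 * convRow 3 (n + 1) -
        Polynomial.C 9 * (Polynomial.X * convRow 3 (n + 1)) -
        Polynomial.C 3 * (Polynomial.X * (Polynomial.X * convRow 3 (n + 1))) +
        Polynomial.C 2 * (Polynomial.X * convRow 3 n) +
        Polynomial.C 3 * (Polynomial.X * (Polynomial.X * convRow 3 n)) +
        Polynomial.X * (Polynomial.X * (Polynomial.X * convRow 3 n)) := by
      rw [convRow_rec]
      simp only [Finset.sum_range_succ, Finset.sum_range_zero, genProd_succ, genProd_zero,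
        show n + 3 - 1 - 0 = n + 2 by omega, show n + 3 - 1 - 1 = n + 1 by omega,
        show n + 3 - 1 - 2 = n by omega, map_ofNat, show (3 : ℕ).choose (0 + 1) = 3 from rfl,
        show (3 : ℕ).choose (1 + 1) = 3 from rfl, show (3 : ℕ).choose (2 + 1) = 1 from rfl]
      push_cast
      ring
    funext m
    simp only [e, Polynomial.coeff_sub, Polynomial.coeff_add, Polynomial.coeff_C_mul,
      coeff_X_mul_eq_seqPre, ih (n + 2) (by omega), ih (n + 1) (by omega), ih n (by omega),
      convThree]

theorem convTwo_zero (k : ℕ) : (convTwo (k + 1) 0 : ℚ) = 0 := by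
  induction k with
  | zero => norm_num [convTwo, seqPre]
  | succ k ih =>
    have e : convTwo (k + 1 + 1) 0 = 2 * convTwo (k + 1) 0 + 2 * 0 - 0 - 0 := rfl
    rw [e]
    push_cast
    rw [ih]
    norm_num

/-- Within a fixed column the recurrence is multiplication by 2 plus terms from lower columns, so
each column is found from the previous ones. The index offset encodes the range n > m. -/
theorem convTwo_one (k : ℕ) : (convTwo (k + 2) 1 : ℚ) = 2 ^ k := by
  induction k using Nat.twoStepInduction with
  | zero => norm_num [show convTwo (0 + 2) 1 = 1 by decide +kernel]
  | one => norm_num [show convTwo (1 + 2) 1 = 2 by decide +kernel]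
  | more k ih0 ih1 =>
    have e : convTwo (k + 2 + 2) 1 =
        2 * convTwo (k + 1 + 2) 1 + 2 * convTwo (k + 1 + 2) 0 - convTwo (k + 2) 0 - 0 := rfl
    have a1 : (convTwo (k + 1 + 2) 0 : ℚ) = _ := convTwo_zero (k + 2)
    have a2 : (convTwo (k + 2) 0 : ℚ) = _ := convTwo_zero (k + 1)
    rw [e]
    push_cast at *
    rw [ih1, a1, a2]
    ring

theorem convTwo_two (k : ℕ) : (convTwo (k + 3) 2 : ℚ) = 2 ^ k * (3 / 2) * (k + 2) := by
  induction k using Nat.twoStepInduction with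
  | zero => norm_num [show convTwo (0 + 3) 2 = 3 by decide +kernel]
  | one => norm_num [show convTwo (1 + 3) 2 = 9 by decide +kernel]
  | more k ih0 ih1 =>
    have e : convTwo (k + 2 + 3) 2 =
        2 * convTwo (k + 1 + 3) 2 + 2 * convTwo (k + 1 + 3) 1 - convTwo (k + 3) 1 - convTwo (k + 3) 0 := rfl
    have a1 : (convTwo (k + 1 + 3) 1 : ℚ) = _ := convTwo_one (k + 2)
    have a2 : (convTwo (k + 3) 1 : ℚ) = _ := convTwo_one (k + 1)
    have a3 : (convTwo (k + 3) 0 : ℚ) = _ := convTwo_zero (k + 2)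
    rw [e]
    push_cast at *
    rw [ih1, a1, a2, a3]
    ring

theorem convTwo_three (k : ℕ) : (convTwo (k + 4) 3 : ℚ) = 2 ^ k / 8 * (9 * (k + 4) - 20) * (k + 3) := by
  induction k using Nat.twoStepInduction with
  | zero => norm_num [show convTwo (0 + 4) 3 = 6 by decide +kernel]
  | one => norm_num [show convTwo (1 + 4) 3 = 25 by decide +kernel]
  | more k ih0 ih1 =>
    have e : convTwo (k + 2 + 4) 3 =
        2 * convTwo (k + 1 + 4) 3 + 2 * convTwo (k + 1 + 4) 2 - convTwo (k + 4) 2 - convTwo (k + 4) 1 := rfl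
    have a1 : (convTwo (k + 1 + 4) 2 : ℚ) = _ := convTwo_two (k + 2)
    have a2 : (convTwo (k + 4) 2 : ℚ) = _ := convTwo_two (k + 1)
    have a3 : (convTwo (k + 4) 1 : ℚ) = _ := convTwo_one (k + 2)
    rw [e]
    push_cast at *
    rw [ih1, a1, a2, a3]
    ring

theorem convTwo_four (k : ℕ) : (convTwo (k + 5) 4 : ℚ) = 2 ^ k / 16 * (3 * (k + 5) - 10) * (3 * (k + 5) - 7) * (k + 4) := by
  induction k using Nat.twoStepInduction with
  | zero => norm_num [show convTwo (0 + 5) 4 = 10 by decide +kernel]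
  | one => norm_num [show convTwo (1 + 5) 4 = 55 by decide +kernel]
  | more k ih0 ih1 =>
    have e : convTwo (k + 2 + 5) 4 =
        2 * convTwo (k + 1 + 5) 4 + 2 * convTwo (k + 1 + 5) 3 - convTwo (k + 5) 3 - convTwo (k + 5) 2 := rfl
    have a1 : (convTwo (k + 1 + 5) 3 : ℚ) = _ := convTwo_three (k + 2)
    have a2 : (convTwo (k + 5) 3 : ℚ) = _ := convTwo_three (k + 1)
    have a3 : (convTwo (k + 5) 2 : ℚ) = _ := convTwo_two (k + 2)
    rw [e]
    push_cast at *
    rw [ih1, a1, a2, a3]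
    ring

theorem convTwo_five (k : ℕ) : (convTwo (k + 6) 5 : ℚ) = 2 ^ k / 128 *
    (27 * (k + 6) ^ 3 - 279 * (k + 6) ^ 2 + 934 * (k + 6) - 1008) * (k + 5) := by
  induction k using Nat.twoStepInduction with
  | zero => norm_num [show convTwo (0 + 6) 5 = 15 by decide +kernel]
  | one => norm_num [show convTwo (1 + 6) 5 = 105 by decide +kernel]
  | more k ih0 ih1 =>
    have e : convTwo (k + 2 + 6) 5 =
        2 * convTwo (k + 1 + 6) 5 + 2 * convTwo (k + 1 + 6) 4 - convTwo (k + 6) 4 - convTwo (k + 6) 3 := rfl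
    have a1 : (convTwo (k + 1 + 6) 4 : ℚ) = _ := convTwo_four (k + 2)
    have a2 : (convTwo (k + 6) 4 : ℚ) = _ := convTwo_four (k + 1)
    have a3 : (convTwo (k + 6) 3 : ℚ) = _ := convTwo_three (k + 2)
    rw [e]
    push_cast at *
    rw [ih1, a1, a2, a3]
    ring

theorem convTwo_six (k : ℕ) : (convTwo (k + 7) 6 : ℚ) = 2 ^ k / 256 / 5 *
    (9 * (k + 7) ^ 2 - 71 * (k + 7) + 120) * (3 * (k + 7) - 14) * (3 * (k + 7) - 11) * (k + 6) := by
  induction k using Nat.twoStepInduction with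
  | zero => norm_num [show convTwo (0 + 7) 6 = 21 by decide +kernel]
  | one => norm_num [show convTwo (1 + 7) 6 = 182 by decide +kernel]
  | more k ih0 ih1 =>
    have e : convTwo (k + 2 + 7) 6 =
        2 * convTwo (k + 1 + 7) 6 + 2 * convTwo (k + 1 + 7) 5 - convTwo (k + 7) 5 - convTwo (k + 7) 4 := rfl
    have a1 : (convTwo (k + 1 + 7) 5 : ℚ) = _ := convTwo_five (k + 2)
    have a2 : (convTwo (k + 7) 5 : ℚ) = _ := convTwo_five (k + 1)
    have a3 : (convTwo (k + 7) 4 : ℚ) = _ := convTwo_four (k + 2)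
    rw [e]
    push_cast at *
    rw [ih1, a1, a2, a3]
    ring

/-- The coordinates of `(3 + √3)^n` in the basis `1, √3`. -/
def powThree : ℕ → ℤ × ℤ
  | 0 => (1, 0)
  | n + 1 => (3 * (powThree n).1 + 3 * (powThree n).2, (powThree n).1 + 3 * (powThree n).2)

theorem convThree_zero (k : ℕ) : (convThree (k + 1) 0 : ℚ) = 0 := by
  induction k using Nat.twoStepInduction with
  | zero => norm_num [show convThree (0 + 1) 0 = 0 by decide +kernel]
  | one => norm_num [show convThree (1 + 1) 0 = 0 by decide +kernel]
  | more k ih0 ih1 =>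
    have e : convThree (k + 2 + 1) 0 =
        6 * convThree (k + 1 + 1) 0 + 3 * 0 - 6 * convThree (k + 1) 0 - 9 * 0 - 3 * 0 + 2 * 0 + 3 * 0 + 0 := rfl
    rw [e]
    push_cast at *
    rw [ih1, ih0]
    ring

/-- The characteristic roots of a column are 3 ± √3. Writing their powers in the coordinates
`powThree` keeps the inductions rational. -/
theorem convThree_one (k : ℕ) : (convThree (k + 2) 1 : ℚ) = 1 / 18 *
    ((9) * (powThree (k + 2)).1 -
      3 * (5) * (powThree (k + 2)).2) := by
  induction k using Nat.twoStepInduction with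
  | zero => norm_num [show convThree (0 + 2) 1 = 1 by decide +kernel, powThree]
  | one => norm_num [show convThree (1 + 2) 1 = 2 by decide +kernel, powThree]
  | more k ih0 ih1 =>
    have e : convThree (k + 2 + 2) 1 =
        6 * convThree (k + 1 + 2) 1 + 3 * convThree (k + 1 + 2) 0 - 6 * convThree (k + 2) 1 - 9 * convThree (k + 2) 0 - 3 * 0 + 2 * convThree (k + 1) 0 + 3 * 0 + 0 := rfl
    have a1 : (convThree (k + 1 + 2) 0 : ℚ) = _ := convThree_zero (k + 2)
    have a3 : (convThree (k + 2) 0 : ℚ) = _ := convThree_zero (k + 1)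
    have a4 : (convThree (k + 1) 0 : ℚ) = _ := convThree_zero k
    rw [e]
    push_cast at *
    rw [ih1, a1, ih0, a3, a4]
    simp only [powThree]
    push_cast
    ring

theorem convThree_two (k : ℕ) : (convThree (k + 3) 2 : ℚ) = 1 / 108 *
    ((44 * (k + 3) - 41) * (powThree (k + 3)).1 -
      3 * (25 * (k + 3) - 24) * (powThree (k + 3)).2) := by
  induction k using Nat.twoStepInduction with
  | zero => norm_num [show convThree (0 + 3) 2 = 3 by decide +kernel, powThree]
  | one => norm_num [show convThree (1 + 3) 2 = 11 by decide +kernel, powThree]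
  | more k ih0 ih1 =>
    have e : convThree (k + 2 + 3) 2 =
        6 * convThree (k + 1 + 3) 2 + 3 * convThree (k + 1 + 3) 1 - 6 * convThree (k + 3) 2 - 9 * convThree (k + 3) 1 - 3 * convThree (k + 3) 0 + 2 * convThree (k + 2) 1 + 3 * convThree (k + 2) 0 + 0 := rfl
    have a1 : (convThree (k + 1 + 3) 1 : ℚ) = _ := convThree_one (k + 2)
    have a3 : (convThree (k + 3) 1 : ℚ) = _ := convThree_one (k + 1)
    have a4 : (convThree (k + 3) 0 : ℚ) = _ := convThree_zero (k + 2)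
    have a5 : (convThree (k + 2) 1 : ℚ) = _ := convThree_one k
    have a6 : (convThree (k + 2) 0 : ℚ) = _ := convThree_zero (k + 1)
    rw [e]
    push_cast at *
    rw [ih1, a1, ih0, a3, a4, a5, a6]
    simp only [powThree]
    push_cast
    ring

theorem convThree_three (k : ℕ) : (convThree (k + 4) 3 : ℚ) = 1 / 7776 *
    ((1299 * (k + 4) ^ 2 - 3837 * (k + 4) + 2412) * (powThree (k + 4)).1 -
      3 * (745 * (k + 4) ^ 2 - 2217 * (k + 4) + 1418) * (powThree (k + 4)).2) := by
  induction k using Nat.twoStepInduction with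
  | zero => norm_num [show convThree (0 + 4) 3 = 6 by decide +kernel, powThree]
  | one => norm_num [show convThree (1 + 4) 3 = 35 by decide +kernel, powThree]
  | more k ih0 ih1 =>
    have e : convThree (k + 2 + 4) 3 =
        6 * convThree (k + 1 + 4) 3 + 3 * convThree (k + 1 + 4) 2 - 6 * convThree (k + 4) 3 - 9 * convThree (k + 4) 2 - 3 * convThree (k + 4) 1 + 2 * convThree (k + 3) 2 + 3 * convThree (k + 3) 1 + convThree (k + 3) 0 := rfl
    have a1 : (convThree (k + 1 + 4) 2 : ℚ) = _ := convThree_two (k + 2)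
    have a3 : (convThree (k + 4) 2 : ℚ) = _ := convThree_two (k + 1)
    have a4 : (convThree (k + 4) 1 : ℚ) = _ := convThree_one (k + 2)
    have a5 : (convThree (k + 3) 2 : ℚ) = _ := convThree_two k
    have a6 : (convThree (k + 3) 1 : ℚ) = _ := convThree_one (k + 1)
    have a7 : (convThree (k + 3) 0 : ℚ) = _ := convThree_zero (k + 2)
    rw [e]
    push_cast at *
    rw [ih1, a1, ih0, a3, a4, a5, a6, a7]
    simp only [powThree]
    push_cast
    ring

theorem convThree_four (k : ℕ) : (convThree (k + 5) 4 : ℚ) = 1 / 139968 *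
    ((6409 * (k + 5) ^ 3 - 38778 * (k + 5) ^ 2 + 70901 * (k + 5) - 37092) * (powThree (k + 5)).1 -
      3 * (3690 * (k + 5) ^ 3 - 22374 * (k + 5) ^ 2 + 41088 * (k + 5) - 21708) * (powThree (k + 5)).2) := by
  induction k using Nat.twoStepInduction with
  | zero => norm_num [show convThree (0 + 5) 4 = 10 by decide +kernel, powThree]
  | one => norm_num [show convThree (1 + 5) 4 = 85 by decide +kernel, powThree]
  | more k ih0 ih1 =>
    have e : convThree (k + 2 + 5) 4 =
        6 * convThree (k + 1 + 5) 4 + 3 * convThree (k + 1 + 5) 3 - 6 * convThree (k + 5) 4 - 9 * convThree (k + 5) 3 - 3 * convThree (k + 5) 2 + 2 * convThree (k + 4) 3 + 3 * convThree (k + 4) 2 + convThree (k + 4) 1 := rfl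
    have a1 : (convThree (k + 1 + 5) 3 : ℚ) = _ := convThree_three (k + 2)
    have a3 : (convThree (k + 5) 3 : ℚ) = _ := convThree_three (k + 1)
    have a4 : (convThree (k + 5) 2 : ℚ) = _ := convThree_two (k + 2)
    have a5 : (convThree (k + 4) 3 : ℚ) = _ := convThree_three k
    have a6 : (convThree (k + 4) 2 : ℚ) = _ := convThree_two (k + 1)
    have a7 : (convThree (k + 4) 1 : ℚ) = _ := convThree_one (k + 2)
    rw [e]
    push_cast at *
    rw [ih1, a1, ih0, a3, a4, a5, a6, a7]
    simp only [powThree]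
    push_cast
    ring

/-- The cases n < m and n = m are equalities, and for n > m the closed form replaces the convergent
in the general congruence. -/
theorem congrMod_stirlingFirst_of_closed {K : Type*} [Field K] {p m : ℕ} (hp : 1 ≤ p) (F : ℕ → K)
    (hF : ∀ k, (stirlingConv p (k + (m + 1)) m : K) = F (k + (m + 1))) (n : ℕ) :
    CongrMod p (n.stirlingFirst m : K)
      (F n * (if m + 1 ≤ n then 1 else 0) + (if n = m then 1 else 0)) := by
  rcases lt_trichotomy n m with h | rfl | h
  · rw [if_neg (by omega), if_neg (by omega), Nat.stirlingFirst_eq_zero_of_lt h]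
    exact ⟨0, by simp⟩
  · rw [if_neg (by omega), if_pos rfl, Nat.stirlingFirst_self]
    exact ⟨0, by simp⟩
  · obtain ⟨k, rfl⟩ : ∃ k, n = k + (m + 1) := ⟨n - (m + 1), by omega⟩
    rw [if_pos (by omega), if_neg (by omega), mul_one, add_zero, ← hF]
    exact congrMod_stirlingFirst (stirlingFirst_modEq_stirlingConv hp _ _)

theorem congrMod_two_stirlingFirst_one (n : ℕ) : CongrMod 2 (n.stirlingFirst 1 : ℚ)
    ((2 : ℚ) ^ n / 4 * (if 2 ≤ n then 1 else 0) +
      (if n = 1 then 1 else 0)) := by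
  refine congrMod_stirlingFirst_of_closed (p := 2) (by norm_num)
    (fun n => (2 : ℚ) ^ n / 4) (fun k => ?_) n
  rw [stirlingConv_eq, coeff_convRow_two, convTwo_one]
  push_cast
  ring

theorem congrMod_two_stirlingFirst_two (n : ℕ) : CongrMod 2 (n.stirlingFirst 2 : ℚ)
    (3 * (2 : ℚ) ^ n / 16 * (n - 1) * (if 3 ≤ n then 1 else 0) +
      (if n = 2 then 1 else 0)) := by
  refine congrMod_stirlingFirst_of_closed (p := 2) (by norm_num)
    (fun n => 3 * (2 : ℚ) ^ n / 16 * (n - 1)) (fun k => ?_) n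
  rw [stirlingConv_eq, coeff_convRow_two, convTwo_two]
  push_cast
  ring

theorem congrMod_two_stirlingFirst_three (n : ℕ) : CongrMod 2 (n.stirlingFirst 3 : ℚ)
    ((2 : ℚ) ^ ((n : ℤ) - 7) * (9 * n - 20) * (n - 1) * (if 4 ≤ n then 1 else 0) +
      (if n = 3 then 1 else 0)) := by
  refine congrMod_stirlingFirst_of_closed (p := 2) (by norm_num)
    (fun n => (2 : ℚ) ^ ((n : ℤ) - 7) * (9 * n - 20) * (n - 1)) (fun k => ?_) n
  rw [stirlingConv_eq, coeff_convRow_two, convTwo_three]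
  rw [zpow_sub₀ (by norm_num), zpow_natCast, pow_add]
  push_cast
  norm_num [zpow_ofNat]
  ring

theorem congrMod_two_stirlingFirst_four (n : ℕ) : CongrMod 2 (n.stirlingFirst 4 : ℚ)
    ((2 : ℚ) ^ ((n : ℤ) - 9) * (3 * n - 10) * (3 * n - 7) * (n - 1) * (if 5 ≤ n then 1 else 0) +
      (if n = 4 then 1 else 0)) := by
  refine congrMod_stirlingFirst_of_closed (p := 2) (by norm_num)
    (fun n => (2 : ℚ) ^ ((n : ℤ) - 9) * (3 * n - 10) * (3 * n - 7) * (n - 1)) (fun k => ?_) n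
  rw [stirlingConv_eq, coeff_convRow_two, convTwo_four]
  rw [zpow_sub₀ (by norm_num), zpow_natCast, pow_add]
  push_cast
  norm_num [zpow_ofNat]
  ring

theorem congrMod_two_stirlingFirst_five (n : ℕ) : CongrMod 2 (n.stirlingFirst 5 : ℚ)
    ((2 : ℚ) ^ ((n : ℤ) - 13) * (27 * n ^ 3 - 279 * n ^ 2 + 934 * n - 1008) * (n - 1) * (if 6 ≤ n then 1 else 0) +
      (if n = 5 then 1 else 0)) := by
  refine congrMod_stirlingFirst_of_closed (p := 2) (by norm_num)
    (fun n => (2 : ℚ) ^ ((n : ℤ) - 13) * (27 * n ^ 3 - 279 * n ^ 2 + 934 * n - 1008) * (n - 1)) (fun k => ?_) n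
  rw [stirlingConv_eq, coeff_convRow_two, convTwo_five]
  rw [zpow_sub₀ (by norm_num), zpow_natCast, pow_add]
  push_cast
  norm_num [zpow_ofNat]
  ring

theorem congrMod_two_stirlingFirst_six (n : ℕ) : CongrMod 2 (n.stirlingFirst 6 : ℚ)
    ((2 : ℚ) ^ ((n : ℤ) - 15) / 5 * (9 * n ^ 2 - 71 * n + 120) * (3 * n - 14) *
        (3 * n - 11) * (n - 1) * (if 7 ≤ n then 1 else 0) +
      (if n = 6 then 1 else 0)) := by
  refine congrMod_stirlingFirst_of_closed (p := 2) (by norm_num)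
    (fun n => (2 : ℚ) ^ ((n : ℤ) - 15) / 5 * (9 * n ^ 2 - 71 * n + 120) * (3 * n - 14) *
        (3 * n - 11) * (n - 1)) (fun k => ?_) n
  rw [stirlingConv_eq, coeff_convRow_two, convTwo_six]
  rw [zpow_sub₀ (by norm_num), zpow_natCast, pow_add]
  push_cast
  norm_num [zpow_ofNat]
  ring

theorem pow_three_add_sqrt (j : ℤ) (hj : j ^ 2 = 1) (n : ℕ) :
    (3 + j * √3 : ℝ) ^ n = (powThree n).1 + (powThree n).2 * (j * √3) := by
  have h3 : (√3 : ℝ) ^ 2 = 3 := Real.sq_sqrt (by norm_num)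
  have hj' : (j : ℝ) ^ 2 = 1 := by exact_mod_cast hj
  induction n with
  | zero => simp [powThree]
  | succ n ih =>
    rw [pow_succ, ih]
    simp only [powThree]
    push_cast
    linear_combination (powThree n).2 * (√3 : ℝ) ^ 2 * hj' + (powThree n).2 * h3

/-- Adding the two conjugates cancels the √3-part and doubles the rest; this links the stated sums
to the integer coordinates. -/
theorem sum_sqrt_three (A B : ℝ) (n : ℕ) :
    ∑ j ∈ ({1, -1} : Finset ℤ), (A - B * (j * √3)) * (3 + j * √3) ^ n =
      2 * (A * (powThree n).1 - 3 * B * (powThree n).2) := by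
  have h3 : (√3 : ℝ) ^ 2 = 3 := Real.sq_sqrt (by norm_num)
  rw [Finset.sum_pair (by norm_num), pow_three_add_sqrt 1 (by norm_num),
    pow_three_add_sqrt (-1) (by norm_num)]
  push_cast
  linear_combination (-2 * B * (powThree n).2) * h3

theorem congrMod_three_stirlingFirst_one (n : ℕ) : CongrMod 3 (n.stirlingFirst 1 : ℝ)
    ((∑ j ∈ ({1, -1} : Finset ℤ),
      1 / 36 * (9 - 5 * j * √3) * (3 + j * √3) ^ n) *
        (if 2 ≤ n then 1 else 0) + (if n = 1 then 1 else 0)) := by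
  refine congrMod_stirlingFirst_of_closed (p := 3) (by norm_num)
    (fun n => ∑ j ∈ ({1, -1} : Finset ℤ),
      1 / 36 * (9 - 5 * j * √3) * (3 + j * √3) ^ n)
    (fun k => ?_) n
  have h := congrArg (fun x : ℚ => (x : ℝ)) (convThree_one k)
  have e := sum_sqrt_three (1 / 36 * (9))
    (1 / 36 * (5)) (k + 2)
  rw [stirlingConv_eq, coeff_convRow_three]
  push_cast at h e ⊢
  rw [h]
  refine Eq.trans ?_ (e.symm.trans (Finset.sum_congr rfl fun j _ => ?_))
  · ring
  · ring

theorem congrMod_three_stirlingFirst_two (n : ℕ) : CongrMod 3 (n.stirlingFirst 2 : ℝ)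
    ((∑ j ∈ ({1, -1} : Finset ℤ),
      1 / 216 * ((44 * n - 41) - (25 * n - 24) * (j * √3)) * (3 + j * √3) ^ n) *
        (if 3 ≤ n then 1 else 0) + (if n = 2 then 1 else 0)) := by
  refine congrMod_stirlingFirst_of_closed (p := 3) (by norm_num)
    (fun n => ∑ j ∈ ({1, -1} : Finset ℤ),
      1 / 216 * ((44 * n - 41) - (25 * n - 24) * (j * √3)) * (3 + j * √3) ^ n)
    (fun k => ?_) n
  have h := congrArg (fun x : ℚ => (x : ℝ)) (convThree_two k)
  have e := sum_sqrt_three (1 / 216 * (44 * ((k + 3 : ℕ) : ℝ) - 41))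
    (1 / 216 * (25 * ((k + 3 : ℕ) : ℝ) - 24)) (k + 3)
  rw [stirlingConv_eq, coeff_convRow_three]
  push_cast at h e ⊢
  rw [h]
  refine Eq.trans ?_ (e.symm.trans (Finset.sum_congr rfl fun j _ => ?_))
  · ring
  · ring

theorem congrMod_three_stirlingFirst_three (n : ℕ) : CongrMod 3 (n.stirlingFirst 3 : ℝ)
    ((∑ j ∈ ({1, -1} : Finset ℤ),
      1 / 15552 * ((1299 * n ^ 2 - 3837 * n + 2412) -
        (745 * n ^ 2 - 2217 * n + 1418) * (j * √3)) * (3 + j * √3) ^ n) *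
        (if 4 ≤ n then 1 else 0) + (if n = 3 then 1 else 0)) := by
  refine congrMod_stirlingFirst_of_closed (p := 3) (by norm_num)
    (fun n => ∑ j ∈ ({1, -1} : Finset ℤ),
      1 / 15552 * ((1299 * n ^ 2 - 3837 * n + 2412) -
        (745 * n ^ 2 - 2217 * n + 1418) * (j * √3)) * (3 + j * √3) ^ n)
    (fun k => ?_) n
  have h := congrArg (fun x : ℚ => (x : ℝ)) (convThree_three k)
  have e := sum_sqrt_three (1 / 15552 * (1299 * ((k + 4 : ℕ) : ℝ) ^ 2 - 3837 * ((k + 4 : ℕ) : ℝ) + 2412))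
    (1 / 15552 * (745 * ((k + 4 : ℕ) : ℝ) ^ 2 - 2217 * ((k + 4 : ℕ) : ℝ) + 1418)) (k + 4)
  rw [stirlingConv_eq, coeff_convRow_three]
  push_cast at h e ⊢
  rw [h]
  refine Eq.trans ?_ (e.symm.trans (Finset.sum_congr rfl fun j _ => ?_))
  · ring
  · ring

theorem congrMod_three_stirlingFirst_four (n : ℕ) : CongrMod 3 (n.stirlingFirst 4 : ℝ)
    ((∑ j ∈ ({1, -1} : Finset ℤ),
      1 / 279936 * ((6409 * n ^ 3 - 38778 * n ^ 2 + 70901 * n - 37092) -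
        (3690 * n ^ 3 - 22374 * n ^ 2 + 41088 * n - 21708) * (j * √3)) *
        (3 + j * √3) ^ n) *
        (if 5 ≤ n then 1 else 0) + (if n = 4 then 1 else 0)) := by
  refine congrMod_stirlingFirst_of_closed (p := 3) (by norm_num)
    (fun n => ∑ j ∈ ({1, -1} : Finset ℤ),
      1 / 279936 * ((6409 * n ^ 3 - 38778 * n ^ 2 + 70901 * n - 37092) -
        (3690 * n ^ 3 - 22374 * n ^ 2 + 41088 * n - 21708) * (j * √3)) *
        (3 + j * √3) ^ n)
    (fun k => ?_) n
  have h := congrArg (fun x : ℚ => (x : ℝ)) (convThree_four k)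
  have e := sum_sqrt_three (1 / 279936 * (6409 * ((k + 5 : ℕ) : ℝ) ^ 3 - 38778 * ((k + 5 : ℕ) : ℝ) ^ 2 + 70901 * ((k + 5 : ℕ) : ℝ) - 37092))
    (1 / 279936 * (3690 * ((k + 5 : ℕ) : ℝ) ^ 3 - 22374 * ((k + 5 : ℕ) : ℝ) ^ 2 + 41088 * ((k + 5 : ℕ) : ℝ) - 21708)) (k + 5)
  rw [stirlingConv_eq, coeff_convRow_three]
  push_cast at h e ⊢
  rw [h]
  refine Eq.trans ?_ (e.symm.trans (Finset.sum_congr rfl fun j _ => ?_))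
  · ring
  · ring

theorem omegaPoly_two_roots : {w : ℂ | Polynomial.aeval w (omegaPoly 2) = 0} = {2} := by
  ext w
  have e : Polynomial.aeval w (omegaPoly 2) = 2 - w := by
    simp [omegaPoly, Finset.sum_range_succ, Nat.factorial, map_ofNat]
    ring
  rw [Set.mem_ofPred_eq, e, sub_eq_zero, Set.mem_singleton_iff, eq_comm]

theorem omegaPoly_three_roots : {w : ℂ | Polynomial.aeval w (omegaPoly 3) = 0} =
    {((3 - √3 : ℝ) : ℂ), ((3 + √3 : ℝ) : ℂ)} := by
  ext w
  have h3 : ((√3 : ℝ) : ℂ) ^ 2 = 3 := by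
    rw [← Complex.ofReal_pow, Real.sq_sqrt (by norm_num)]
    norm_num
  have e : Polynomial.aeval w (omegaPoly 3) = (w - (3 - √3 : ℝ)) * (w - (3 + √3 : ℝ)) := by
    simp [omegaPoly, Finset.sum_range_succ, Nat.factorial, map_ofNat]
    linear_combination h3
  rw [Set.mem_ofPred_eq, e, mul_eq_zero, sub_eq_zero, sub_eq_zero]
  rfl

/-! ### Rational forms and quasi-polynomials -/

/-- The reversed polynomial differs from FQ_h at R = 0 only by a sign, which the numerator absorbs.
-/
theorem exists_reverse_omegaPoly_pow_mul {h : ℕ} (hh : 1 ≤ h) {m : ℕ} (hm : 1 ≤ m) :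
    ∃ N : ℤ[X], ((omegaPoly h).reverse : ℤ⟦X⟧) ^ m *
      PowerSeries.mk (fun n => stirlingConv h n m) = (N : ℤ⟦X⟧) := by
  obtain ⟨s, rfl⟩ : ∃ s, h = s + 1 := ⟨h - 1, by omega⟩
  obtain ⟨N, hN, -⟩ := exists_numerator s
  refine ⟨((-1) ^ s) ^ m * N m, ?_⟩
  have e : ((omegaPoly (s + 1)).reverse : ℤ⟦X⟧) = (-1) ^ s * (denSlice (s + 1) 0 : ℤ⟦X⟧) := by
    rw [denSlice_zero_eq, Polynomial.coe_mul, Polynomial.coe_pow, Polynomial.coe_neg,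
      Polynomial.coe_one, ← mul_assoc, ← mul_pow]
    simp
  rw [e, mul_pow, mul_assoc, ← convSlice, (hN m hm).1]
  simp

/-- One family of polynomials serves all three formulas: for n > m the convergent coefficients are
exact when n ≤ h < 2h and congruent modulo h otherwise. The diagonal n = m is handled by the
bracket, since the exponential form starts only beyond it. -/
theorem exists_quasiPolynomial_stirlingFirst {h : ℕ} (hh : 2 ≤ h) :
    ∃ ω : Fin (h - 1) → ℂ, Function.Injective ω ∧
      Set.range ω = {w : ℂ | Polynomial.aeval w (omegaPoly h) = 0} ∧
      ∀ m : ℕ, 1 ≤ m → ∃ q : Fin (h - 1) → ℂ[X],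
        (∀ i, (q i).degree = ((m - 1 : ℕ) : WithBot ℕ)) ∧
        (∀ n : ℕ, m < n →
          (stirlingConv h n m : ℂ) = ∑ i, (q i).eval (n : ℂ) * ω i ^ n) ∧
        (∀ n : ℕ, m ≤ n → n ≤ h →
          (n.stirlingFirst m : ℂ) =
            (∑ i, (q i).eval (n : ℂ) * ω i ^ n) * (if m < n then 1 else 0) +
              (if n = m then 1 else 0)) ∧
        (∀ n : ℕ, m ≤ n →
          CongrMod h (n.stirlingFirst m : ℂ)
            ((∑ i, (q i).eval (n : ℂ) * ω i ^ n) * (if m < n then 1 else 0) +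
              (if n = m then 1 else 0))) := by
  obtain ⟨s, rfl⟩ : ∃ s, h = s + 1 := ⟨h - 1, by omega⟩
  rw [Nat.add_sub_cancel]
  obtain ⟨ω, hinj, hω⟩ := exists_omegaPoly_roots s
  refine ⟨ω, hinj, hω, fun m hm => ?_⟩
  obtain ⟨q, hq, hqn⟩ := exists_quasiPolynomial_stirlingConv (by omega) hinj hω hm
  refine ⟨q, hq, hqn, fun n hmn hn => ?_, fun n hmn => ?_⟩
  · rcases hmn.lt_or_eq with hlt | rfl
    · rw [if_pos hlt, if_neg (by omega), mul_one, add_zero, ← hqn n hlt,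
        ← stirlingFirst_eq_stirlingConv (by omega), Int.cast_natCast]
    · rw [if_neg (lt_irrefl _), if_pos rfl, mul_zero, zero_add, Nat.stirlingFirst_self,
        Nat.cast_one]
  · rcases hmn.lt_or_eq with hlt | rfl
    · rw [if_pos hlt, if_neg (by omega), mul_one, add_zero, ← hqn n hlt]
      exact congrMod_stirlingFirst (stirlingFirst_modEq_stirlingConv (by omega) n m)
    · rw [if_neg (lt_irrefl _), if_pos rfl, mul_zero, zero_add, Nat.stirlingFirst_self]
      exact ⟨0, by simp⟩

theorem mainTheorem10 :
    -- exact generation of the Stirling numbers, and the congruence for `p_n(1, R)`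
    (∀ n m : ℕ, (n.stirlingFirst m : ℤ) = (genProd (1 : ℤ[X]) Polynomial.X n).coeff m) ∧
    (∀ h : ℕ, 2 ≤ h → ∀ n m : ℕ, 1 ≤ m → m ≤ n → n ≤ h →
      (n.stirlingFirst m : ℤ) = stirlingConv h n m) ∧
    (∀ h : ℕ, 2 ≤ h → ∀ n m : ℕ,
      (genProd (1 : ℤ[X]) Polynomial.X n).coeff m ≡ stirlingConv h n m [ZMOD h]) ∧
    -- the `α`-factorial triangles
    (∀ α : ℤ, 1 ≤ α → ∀ n m : ℕ, 1 ≤ n → 1 ≤ m →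
      alphaTriangle α n m =
        (genProd (Polynomial.C α) (Polynomial.X + 1) (n - 1)).coeff (m - 1) ∧
      ∀ p : ℕ, 2 ≤ p →
        alphaTriangle α n m ≡
          convCoeff p α (Polynomial.X + 1) (n - 1) (m - 1) [ZMOD p]) ∧
    -- the coefficient of `R^m` in `Conv_h(1, R; z)` is rational in `z`, with denominator the
    -- `m`-th power of the reflected polynomial
    (∀ h : ℕ, 2 ≤ h → ∀ m : ℕ, 1 ≤ m → ∃ N : ℤ[X],
      ((omegaPoly h).reverse : ℤ⟦X⟧) ^ m * PowerSeries.mk (fun n => stirlingConv h n m) =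
        (N : ℤ⟦X⟧)) ∧
    -- quasi-polynomial formulas in the `h - 1` distinct reflected roots
    (∀ h : ℕ, 2 ≤ h → ∃ ω : Fin (h - 1) → ℂ, Function.Injective ω ∧
      Set.range ω = {w : ℂ | Polynomial.aeval w (omegaPoly h) = 0} ∧
      ∀ m : ℕ, 1 ≤ m → ∃ q : Fin (h - 1) → ℂ[X],
        (∀ i, (q i).degree = ((m - 1 : ℕ) : WithBot ℕ)) ∧
        (∀ n : ℕ, m < n →
          (stirlingConv h n m : ℂ) = ∑ i, (q i).eval (n : ℂ) * ω i ^ n) ∧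
        (∀ n : ℕ, m ≤ n → n ≤ h →
          (n.stirlingFirst m : ℂ) =
            (∑ i, (q i).eval (n : ℂ) * ω i ^ n) * (if m < n then 1 else 0) +
              (if n = m then 1 else 0)) ∧
        (∀ n : ℕ, m ≤ n →
          CongrMod h (n.stirlingFirst m : ℂ)
            ((∑ i, (q i).eval (n : ℂ) * ω i ^ n) * (if m < n then 1 else 0) +
              (if n = m then 1 else 0)))) ∧
    {w : ℂ | Polynomial.aeval w (omegaPoly 2) = 0} = {2} ∧
    {w : ℂ | Polynomial.aeval w (omegaPoly 3) = 0} =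
      {((3 - √3 : ℝ) : ℂ), ((3 + √3 : ℝ) : ℂ)} ∧
    -- modulo 2
    (∀ n : ℕ, 1 ≤ n →
      (n.factorial : ℤ) ≡
        ∑ m ∈ Finset.Icc 1 n,
          (binomZ (n / 2) ((m : ℤ) - ((n + 1) / 2 : ℕ)) : ℤ) * (-1) ^ (n - m) * (n : ℤ) ^ m +
        (if n = 0 then 1 else 0) [ZMOD 2]) ∧
    (∀ n : ℕ, CongrMod 2 (n.stirlingFirst 1 : ℚ)
      ((2 : ℚ) ^ n / 4 * (if 2 ≤ n then 1 else 0) + (if n = 1 then 1 else 0))) ∧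
    (∀ n : ℕ, CongrMod 2 (n.stirlingFirst 2 : ℚ)
      (3 * (2 : ℚ) ^ n / 16 * (n - 1) * (if 3 ≤ n then 1 else 0) +
        (if n = 2 then 1 else 0))) ∧
    (∀ n : ℕ, CongrMod 2 (n.stirlingFirst 3 : ℚ)
      ((2 : ℚ) ^ ((n : ℤ) - 7) * (9 * n - 20) * (n - 1) * (if 4 ≤ n then 1 else 0) +
        (if n = 3 then 1 else 0))) ∧
    (∀ n : ℕ, CongrMod 2 (n.stirlingFirst 4 : ℚ)
      ((2 : ℚ) ^ ((n : ℤ) - 9) * (3 * n - 10) * (3 * n - 7) * (n - 1) *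
        (if 5 ≤ n then 1 else 0) + (if n = 4 then 1 else 0))) ∧
    (∀ n : ℕ, CongrMod 2 (n.stirlingFirst 5 : ℚ)
      ((2 : ℚ) ^ ((n : ℤ) - 13) * (27 * n ^ 3 - 279 * n ^ 2 + 934 * n - 1008) * (n - 1) *
        (if 6 ≤ n then 1 else 0) + (if n = 5 then 1 else 0))) ∧
    (∀ n : ℕ, CongrMod 2 (n.stirlingFirst 6 : ℚ)
      ((2 : ℚ) ^ ((n : ℤ) - 15) / 5 * (9 * n ^ 2 - 71 * n + 120) * (3 * n - 14) *
        (3 * n - 11) * (n - 1) * (if 7 ≤ n then 1 else 0) + (if n = 6 then 1 else 0))) ∧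
    (∀ n m : ℕ, 1 ≤ m → m ≤ n →
      ((n.stirlingFirst m : ℤ) ≡
        (binomZ (n / 2) ((m : ℤ) - ((n + 1) / 2 : ℕ)) : ℤ) [ZMOD 2]) ∧
      (binomZ (n / 2) ((m : ℤ) - ((n + 1) / 2 : ℕ)) : ℤ) =
        ((Polynomial.X : ℤ[X]) ^ ((n + 1) / 2) * (Polynomial.X + 1) ^ (n / 2)).coeff m) ∧
    -- modulo 3; here `(n + 2) / 3 = ⌈n / 3⌉` and `(n + 1) / 3 = ⌈(n - 1) / 3⌉`
    (∀ n m : ℕ, 1 ≤ m → m ≤ n →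
      ((n.stirlingFirst m : ℤ) ≡
        ((Polynomial.X : ℤ[X]) ^ ((n + 2) / 3) * (Polynomial.X + 1) ^ ((n + 1) / 3) *
          (Polynomial.X + 2) ^ (n / 3)).coeff m [ZMOD 3]) ∧
      CongrMod 3 (n.stirlingFirst m : ℚ)
        (∑ k ∈ Finset.range (m + 1),
          (((n + 1) / 3).choose k : ℚ) *
            (binomZ (n / 3) ((m : ℤ) - k - ((n + 2) / 3 : ℕ)) : ℚ) *
            (2 : ℚ) ^ (((n + 2) / 3 : ℕ) + (n / 3 : ℕ) - ((m : ℤ) - k)))) ∧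
    (∀ n : ℕ, CongrMod 3 (n.stirlingFirst 1 : ℝ)
      ((∑ j ∈ ({1, -1} : Finset ℤ),
        1 / 36 * (9 - 5 * j * √3) * (3 + j * √3) ^ n) * (if 2 ≤ n then 1 else 0) +
        (if n = 1 then 1 else 0))) ∧
    (∀ n : ℕ, CongrMod 3 (n.stirlingFirst 2 : ℝ)
      ((∑ j ∈ ({1, -1} : Finset ℤ),
        1 / 216 * ((44 * n - 41) - (25 * n - 24) * (j * √3)) * (3 + j * √3) ^ n) *
          (if 3 ≤ n then 1 else 0) +
        (if n = 2 then 1 else 0))) ∧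
    (∀ n : ℕ, CongrMod 3 (n.stirlingFirst 3 : ℝ)
      ((∑ j ∈ ({1, -1} : Finset ℤ),
        1 / 15552 * ((1299 * n ^ 2 - 3837 * n + 2412) -
          (745 * n ^ 2 - 2217 * n + 1418) * (j * √3)) * (3 + j * √3) ^ n) *
          (if 4 ≤ n then 1 else 0) +
        (if n = 3 then 1 else 0))) ∧
    (∀ n : ℕ, CongrMod 3 (n.stirlingFirst 4 : ℝ)
      ((∑ j ∈ ({1, -1} : Finset ℤ),
        1 / 279936 * ((6409 * n ^ 3 - 38778 * n ^ 2 + 70901 * n - 37092) -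
          (3690 * n ^ 3 - 22374 * n ^ 2 + 41088 * n - 21708) * (j * √3)) *
          (3 + j * √3) ^ n) * (if 5 ≤ n then 1 else 0) +
        (if n = 4 then 1 else 0))) ∧
    -- first-order harmonic numbers
    (∀ n : ℕ, scaledHarmonic 1 n = ((n + 1).stirlingFirst 2 : ℚ)) ∧
    (∀ n : ℕ, CongrMod 4 (scaledHarmonic 1 n) (PowerSeries.coeff (n + 1) gfH1Mod4A)) ∧
    (∀ n : ℕ, CongrMod 4 (scaledHarmonic 1 n) (PowerSeries.coeff n gfH1Mod4B)) ∧
    (∀ n : ℕ, 1 ≤ n →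
      CongrMod 4 (scaledHarmonic 1 n) (PowerSeries.coeff (n - 1) gfH1Mod4C)) ∧
    (∀ n : ℕ, CongrMod 5 (scaledHarmonic 1 n) (PowerSeries.coeff n gfH1Mod5)) ∧
    (∀ n : ℕ, CongrMod 6 (scaledHarmonic 1 n) (PowerSeries.coeff n gfH1Mod6)) ∧
    (∀ h n : ℕ, 1 ≤ h → 1 ≤ n → n ≤ h →
      scaledHarmonic 1 (n - 1) =
        (((-(∑ k ∈ Finset.range n, (h.choose (n - k) : ℤ[X]) *
            genProd 1 (1 - (h : ℤ[X]) - Polynomial.X) (n - k) * genProd 1 Polynomial.X k) +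
          (convP (1 : ℤ[X]) Polynomial.X h).coeff n).coeff 2 : ℤ) : ℚ)) ∧
    (∀ h n : ℕ, 1 ≤ h → h ≤ n →
      CongrMod h (scaledHarmonic 1 (n - 1))
        (((-(∑ k ∈ Finset.range n, (h.choose (n - k) : ℤ[X]) *
            genProd 1 (1 - (h : ℤ[X]) - Polynomial.X) (n - k) *
              genProd 1 Polynomial.X k)).coeff 2 : ℤ) : ℚ)) ∧
    -- second- and third-order harmonic numbers through Stirling numbers and convergents
    (∀ n : ℕ, scaledHarmonic 2 n =
      ((n + 1).stirlingFirst 2 : ℚ) ^ 2 -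
        2 * (n + 1).stirlingFirst 1 * (n + 1).stirlingFirst 3) ∧
    (∀ n : ℕ, scaledHarmonic 3 n =
      ((n + 1).stirlingFirst 2 : ℚ) ^ 3 -
        3 * (n + 1).stirlingFirst 1 * (n + 1).stirlingFirst 2 * (n + 1).stirlingFirst 3 +
        3 * ((n + 1).stirlingFirst 1 : ℚ) ^ 2 * (n + 1).stirlingFirst 4) ∧
    (∀ p : ℕ, 2 ≤ p → ∀ n : ℕ,
      CongrMod p (scaledHarmonic 2 n) (harmConv2 p n : ℚ) ∧
      CongrMod p (scaledHarmonic 3 n) (harmConv3 p n : ℚ)) ∧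
    -- explicit rational generating functions
    (∀ n : ℕ, CongrMod 2 (scaledHarmonic 2 n) (PowerSeries.coeff n gfH2Mod2)) ∧
    gfH2Mod2 = gfH2Mod2PF ∧
    (List.range 7).map (fun n => PowerSeries.coeff n gfH2Mod2) =
      [0, 1, 5, 33, 176, 880, 4224] ∧
    (∀ n : ℕ, CongrMod 3 (scaledHarmonic 2 n) (PowerSeries.coeff n gfH2Mod3)) ∧
    gfH2Mod3 = gfH2Mod3PF ∧
    (List.range 7).map (fun n => PowerSeries.coeff n gfH2Mod3) =
      [0, 1, 5, 49, 820, 18232, 437616] ∧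
    (∀ n : ℕ, CongrMod 2 (scaledHarmonic 3 n) (PowerSeries.coeff n gfH3Mod2)) ∧
    gfH3Mod2 = gfH3Mod2PF ∧
    (List.range 7).map (fun n => PowerSeries.coeff n gfH3Mod2) =
      [0, 1, 9, 129, 1344, 13440, 129024] ∧
    (∀ n : ℕ, CongrMod 3 (scaledHarmonic 3 n) (PowerSeries.coeff n gfH3Mod3)) ∧
    (List.range 7).map (fun n => PowerSeries.coeff n gfH3Mod3) =
      [0, 1, 9, 251, 16280, 1586800, 171547200] ∧
    -- denominators of the second- and third-order generating functions for `p = 4, 5`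
    (∃ N : ℤ[X], (den24 : ℤ⟦X⟧) * PowerSeries.mk (harmConv2 4) = (N : ℤ⟦X⟧)) ∧
    (∃ N : ℤ[X], (den25 : ℤ⟦X⟧) * PowerSeries.mk (harmConv2 5) = (N : ℤ⟦X⟧)) ∧
    (∃ N : ℤ[X], (den34 : ℤ⟦X⟧) * PowerSeries.mk (harmConv3 4) = (N : ℤ⟦X⟧)) ∧
    (∃ N : ℤ[X], (den35 : ℤ⟦X⟧) * PowerSeries.mk (harmConv3 5) = (N : ℤ⟦X⟧)) := by
  refine ⟨stirlingFirst_eq_coeff_genProd,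
    fun h hh n m _ _ hn => stirlingFirst_eq_stirlingConv (by omega) m,
    fun h hh n m => ?_, fun α _ n m hn hm => ?_,
    fun h hh m hm => exists_reverse_omegaPoly_pow_mul (by omega) hm,
    fun h hh => exists_quasiPolynomial_stirlingFirst hh,
    omegaPoly_two_roots, omegaPoly_three_roots, fun n hn => factorial_modEq_two_sum hn,
    congrMod_two_stirlingFirst_one, congrMod_two_stirlingFirst_two,
    congrMod_two_stirlingFirst_three, congrMod_two_stirlingFirst_four,
    congrMod_two_stirlingFirst_five, congrMod_two_stirlingFirst_six,
    fun n m _ _ => ⟨?_, binomZ_sub_eq_coeff _ _ _⟩,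
    fun n m _ _ => ⟨stirlingFirst_modEq_three n m, congrMod_three_sum n m⟩,
    congrMod_three_stirlingFirst_one, congrMod_three_stirlingFirst_two,
    congrMod_three_stirlingFirst_three, congrMod_three_stirlingFirst_four,
    scaledHarmonic_one_eq, congrMod_gfH1Mod4A, congrMod_gfH1Mod4B,
    fun n hn => congrMod_gfH1Mod4C hn, congrMod_gfH1Mod5, congrMod_gfH1Mod6,
    fun h n hh hn hnh => scaledHarmonic_one_eq_convP hh hn hnh,
    fun h n hh hn => congrMod_scaledHarmonic_one_sum hh hn,
    scaledHarmonic_two_eq, scaledHarmonic_three_eq,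
    fun p hp n => ⟨congrMod_scaledHarmonic_two (by omega) n,
      congrMod_scaledHarmonic_three (by omega) n⟩,
    congrMod_gfH2Mod2, gfH2Mod2_eq, map_coeff_gfH2Mod2,
    congrMod_gfH2Mod3, gfH2Mod3_eq, map_coeff_gfH2Mod3,
    congrMod_gfH3Mod2, gfH3Mod2_eq, map_coeff_gfH3Mod2,
    congrMod_gfH3Mod3, map_coeff_gfH3Mod3,
    exists_den24_mul_harmConv2, exists_den25_mul_harmConv2,
    exists_den34_mul_harmConv3, exists_den35_mul_harmConv3⟩
  · rw [← stirlingFirst_eq_coeff_genProd]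
    exact stirlingFirst_modEq_stirlingConv (by omega) n m
  · obtain ⟨n, rfl⟩ : ∃ k, n = k + 1 := ⟨n - 1, by omega⟩
    obtain ⟨m, rfl⟩ : ∃ k, m = k + 1 := ⟨m - 1, by omega⟩
    rw [Nat.add_sub_cancel, Nat.add_sub_cancel, alphaTriangle_eq]
    exact ⟨rfl, fun p hp => convCoeff_modEq (by omega) α _ n m⟩
  · rw [binomZ_sub_eq_coeff]
    exact stirlingFirst_modEq_two n m
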